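/- Points of $\mathbb R^2$ are written $(y_1,y_2)$, and $\mathbb P_n^2$ is the space of real polynomials in two variables of total degree at most $n$. For a set $X$ write $\|p\|_X=\max_{x\in X}|p(x)|$. A weakly admissible mesh (WAM) of a compact, polynomial determining set $K\subset\mathbb R^2$ (only the zero polynomial vanishes on $K$) with constants $C(A_n)$ is a sequence of finite sets $A_n\subset K$, $n\ge 1$, such that $\|p\|_K\le C(A_n)\|p\|_{A_n}$ for all $p\in\mathbb P^2_n$, $\dim\mathbb P_n^2=\binom{n+2}{2}\le\operatorname{card}(A_n)=\mathcal O(n^\alpha)$ for some $\alpha>0$, and $C(A_n)=\mathcal O(n^\beta)$ for some $\beta>0$. For $N\ge1$ let $\mathcal C_{N+1}=\{\cos(j\pi/N):0\le j\le N\}$, let $\mathcal C_{N+1}^{\rm odd}$ and $\mathcal C_{N+1}^{\rm even}$ be its points of odd and even index $j$, and let $\mathrm{Pad}_N=(\mathcal C^{\rm odd}_{N+1}\times\mathcal C^{\rm even}_{N+2})\cup(\mathcal C^{\rm even}_{N+1}\times\mathcal C^{\rm odd}_{N+2})$ be the Padua points of degree $N$ in $[-1,1]^2$. For a nondegenerate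 triangle with vertices $u,v,w$, the Duffy map is $$t(y)=\tfrac14(v-u)(1+y_1)(1-y_2)+\tfrac12(w-u)(1+y_2)+u .$$ **Theorem.** For every nondegenerate triangle, $t$ is a polynomial map of degree at most $2$ with $t([-1,1]^2)$ equal to the triangle. Moreover there is a sequence of constants $C_n=\mathcal O(\log^2 n)$ $(n\to\infty)$, independent of the triangle and of the polygon below, such that: 1. For every nondegenerate triangle, $A_n=t(\mathrm{Pad}_{2n})$, $n\ge1$, is a WAM of the triangle with constants $C(A_n)=C_n$, and $\operatorname{card}(A_n)=2n^2+2n+2$ for every $n\ge 1$. 2. Let $K$ be the closed region bounded by a simple closed polygon with $m\ge3$ vertices (the polygonal curve together with the bounded components of its complement). Then $K$ can be subdivided into $m-2$ nondegenerate triangles (with union $K$ and pairwise disjoint interiors). For every such subdivision, the union $A_n$ of the meshes in part 1 over the $m-2$ triangles is a WAM of $K$ with constants $C(A_n)=C_n=\mathcal O(\log^2 n)$, and $\operatorname{card}(A_n)\le(m-2)(2n^2+2n+2)$ for every $n\ge1$. -/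

import Mathlib

open Filter Asymptotics

namespace WAM

/-! Points of `ℝ^d` are functions `Fin d → ℝ`; only linear, topological and boundedness notions are
used, so the choice of a norm on `ℝ^d` is immaterial. -/

/-- `‖p‖_X = sup_{x ∈ X} |p(x)|`; a maximum when `X` is nonempty and compact (or finite). -/
noncomputable def supNorm {d : ℕ} (X : Set (Fin d → ℝ)) (p : MvPolynomial (Fin d) ℝ) : ℝ :=
  sSup ((fun x => |MvPolynomial.eval x p|) '' X)

/-- A set is polynomial determining if only the zero polynomial vanishes on it. -/
def PolynomialDetermining {d : ℕ} (K : Set (Fin d → ℝ)) : Prop :=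
  ∀ p : MvPolynomial (Fin d) ℝ, (∀ x ∈ K, MvPolynomial.eval x p = 0) → p = 0

/-- `(A n)`, `n = 1, 2, …`, is a weakly admissible mesh of the compact, polynomial determining
set `K ⊆ ℝ^d`, with constants `C(A_n) = C n`. -/
structure IsWAM {d : ℕ} (K : Set (Fin d → ℝ)) (A : ℕ → Finset (Fin d → ℝ)) (C : ℕ → ℝ) :
    Prop where
  isCompact : IsCompact K
  determining : PolynomialDetermining K
  subset : ∀ n, 1 ≤ n → (A n : Set (Fin d → ℝ)) ⊆ K
  bound : ∀ n, 1 ≤ n → ∀ p ∈ MvPolynomial.restrictTotalDegree (Fin d) ℝ n,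
    supNorm K p ≤ C n * supNorm (A n : Set (Fin d → ℝ)) p
  dim_le_card : ∀ n, 1 ≤ n → (n + d).choose d ≤ (A n).card
  card_growth : ∃ α : ℝ, 0 < α ∧
    (fun n : ℕ => ((A n).card : ℝ)) =O[atTop] (fun n : ℕ => (n : ℝ) ^ α)
  const_growth : ∃ β : ℝ, 0 < β ∧ C =O[atTop] (fun n : ℕ => (n : ℝ) ^ β)

/-- The points of odd index `j` among the `N + 1` Chebyshev-Lobatto points `cos (j π / N)`,
`0 ≤ j ≤ N`. -/
noncomputable def chebOdd (N : ℕ) : Finset ℝ :=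
  ((Finset.range (N + 1)).filter Odd).image (fun j : ℕ => Real.cos ((j : ℝ) * Real.pi / (N : ℝ)))

/-- The points of even index `j` among the `N + 1` Chebyshev-Lobatto points `cos (j π / N)`,
`0 ≤ j ≤ N`. -/
noncomputable def chebEven (N : ℕ) : Finset ℝ :=
  ((Finset.range (N + 1)).filter Even).image (fun j : ℕ => Real.cos ((j : ℝ) * Real.pi / (N : ℝ)))

/-- The Padua points of degree `N`. -/
noncomputable def padua (N : ℕ) : Finset (Fin 2 → ℝ) :=
  (chebOdd N ×ˢ chebEven (N + 1) ∪ chebEven N ×ˢ chebOdd (N + 1)).image (fun z => ![z.1, z.2])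

/-- The square `[-1,1]²`. -/
def square : Set (Fin 2 → ℝ) := {y | ∀ i, y i ∈ Set.Icc (-1 : ℝ) 1}

/-- The closed triangle with the three (affinely independent) vertices of `T`. -/
def triangleSet (T : Affine.Triangle ℝ (Fin 2 → ℝ)) : Set (Fin 2 → ℝ) :=
  convexHull ℝ (Set.range T.points)

/-- The Duffy map of the triangle with vertices `u = T.points 0`, `v = T.points 1`,
`w = T.points 2`. -/
noncomputable def duffy (T : Affine.Triangle ℝ (Fin 2 → ℝ)) (y : Fin 2 → ℝ) : Fin 2 → ℝ :=
  (1 / 4 * (1 + y 0) * (1 - y 1)) • (T.points 1 - T.points 0)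
    + (1 / 2 * (1 + y 1)) • (T.points 2 - T.points 0) + T.points 0

/-- The image under the Duffy map of the Padua points of degree `2 n`. -/
noncomputable def triangleMesh (T : Affine.Triangle ℝ (Fin 2 → ℝ)) (n : ℕ) :
    Finset (Fin 2 → ℝ) :=
  (padua (2 * n)).image (duffy T)

/-- The closed polygonal curve through the vertices of `P` is simple: its sides are nondegenerate
and the curve does not meet itself. -/
def IsSimple {m : ℕ} (P : Polygon (Fin 2 → ℝ) m) : Prop :=
  ∀ i j : Fin m, ∀ s ∈ Set.Ico (0 : ℝ) 1, ∀ t ∈ Set.Ico (0 : ℝ) 1,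
    P.edgePath ℝ i s = P.edgePath ℝ j t → i = j ∧ s = t

/-- The closed region bounded by `P`: the boundary curve together with the bounded connected
components of its complement. -/
def region {m : ℕ} (P : Polygon (Fin 2 → ℝ) m) : Set (Fin 2 → ℝ) :=
  {x | x ∈ P.boundary ℝ ∨ Bornology.IsBounded (connectedComponentIn (P.boundary ℝ)ᶜ x)}

/-- The triangles `T i` subdivide `K`: they cover exactly `K` and do not overlap. -/
def IsSubdivision {k : ℕ} (T : Fin k → Affine.Triangle ℝ (Fin 2 → ℝ)) (K : Set (Fin 2 → ℝ)) :
    Prop :=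
  (⋃ i, triangleSet (T i)) = K ∧
    ∀ i j, i ≠ j → Disjoint (interior (triangleSet (T i))) (interior (triangleSet (T j)))

/-- The union of the Duffy-Padua meshes of finitely many triangles. -/
noncomputable def unionMesh {k : ℕ} (T : Fin k → Affine.Triangle ℝ (Fin 2 → ℝ)) (n : ℕ) :
    Finset (Fin 2 → ℝ) :=
  Finset.univ.biUnion (fun i => triangleMesh (T i) n)

end WAM

/-!
**The norming inequality on the square.** For even `N` the Padua points of degree `N` lie on the
curve `γ t = (cos ((N+1) t), -cos (N t))`, whose parameters `kπ/(N(N+1))` all give Padua points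
(`generating_curve_mem_padua`). A polynomial of degree at most `N` restricted to `γ` is a polynomial
of degree at most `N(N+1)` in `cos t`, sampled at Chebyshev-Lobatto points, so its maximum on `γ` is
at most `O(log N)` times its maximum on the Padua points (`abs_eval_le_of_lobatto`). The vertical
line `x = cos θ` meets `γ` in the level set `T_{N+1}(y) = -cos (N θ)`. If `|sin (N θ)| ≥ 1/2`, this
level set has `N+1` well-separated points, and Lagrange interpolation costs one more logarithm
(`abs_eval_le_of_level_set`). The remaining vertical lines cost only an absolute constant: a
polynomial of degree at most `N` in `x` is controlled by its values at the points `cos θ` with `|sin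
(N θ)| ≥ 1/2`, because `6N` equally spaced angles have this property and a discrete de la
Vallée-Poussin operator on them is bounded (`abs_eval_le_of_sin_ge`). Together this is
`abs_eval_le_of_padua`, with a constant of order `log² n` for `N = 2n`. The Duffy map is quadratic
and maps the square onto the triangle, so that a polynomial of degree `n` on the triangle pulls back
to one of degree `2n` on the square. It collapses the side `y₂ = 1`, with its `n` Padua points, to
one vertex and is injective elsewhere, whence the number of mesh points (`card_triangleMesh`). The
inequality passes to finite unions of triangles with the same constant (`isWAM_unionMesh`).

**Triangulating a polygon.** By induction on the number of vertices, a simple closed polygon `B` is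
shown to be the outline of a union `U` of `m - 2` non-overlapping triangles with `frontier U ⊆ B ⊆
U` (`SimpleLoop.boundsTriangles`). A vertex `v` of largest norm is strictly exposed. If the triangle
formed by `v` and its two neighbours contains no further vertex, its third side is a diagonal;
otherwise the contained vertex farthest from that side is joined to `v` by a diagonal. Since an edge
of the polygon can leave the triangle only across its third side
(`SimpleLoop.bary_nonneg_of_mem_edge`), the diagonal meets the polygon only in its endpoints. The
two regions supplied by the induction hypothesis then meet exactly in the diagonal
(`region_gluing`): a bounded set whose frontier lies in a convex set is contained in it, and neither
partial polygon lies in the other region. In the first case `v` lies outside the convex hull of the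
other vertices, and the other vertices lie outside the triangle; in the second case one escapes from
points of both polygons near `v` into the half-plane beyond `v` (`exists_lineMap_notMem`).

**The region bounded by a polygon.** No Jordan curve theorem is used. Along with the triangles the
induction carries the property `HasLog U`: for each `x` outside `U` the function `z - x` has a
continuous logarithm on `U`. It holds for convex sets and survives gluing along a segment. If the
component of `x` in the complement of `U` were bounded, the logarithm would extend to a nowhere
vanishing continuous function on the plane equal to `z - x` near infinity, which is impossible
(`HasLog.not_isBounded`). Hence the complement of `U` has only unbounded components, and `U` is the
polygonal curve together with the bounded components of its complement (`region_eq`).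
-/

namespace WAM

/-! ### One-variable norming sets: Lagrange interpolation at trigonometric nodes -/

open Polynomial in
/-- Lagrange interpolation written with any nonzero polynomial `ω` whose roots are the nodes. -/
lemma eval_eq_sum_of_roots {ι : Type*} (s : Finset ι) (v : ι → ℝ)
    (hv : Set.InjOn v s) (ω : ℝ[X]) (hω : ω ≠ 0) (hdeg : ω.natDegree ≤ s.card)
    (hroot : ∀ i ∈ s, ω.eval (v i) = 0) (f : ℝ[X]) (hf : f.degree < s.card) (y : ℝ)
    (hy : ∀ i ∈ s, y ≠ v i) :
    f.eval y = ∑ i ∈ s, f.eval (v i) * ω.eval y / ((y - v i) * (derivative ω).eval (v i)) := by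
  classical
  have hdvd : Lagrange.nodal s v ∣ ω := by
    rw [Lagrange.nodal_eq]
    refine Finset.prod_dvd_of_coprime (fun i hi j hj hij => ?_) fun i hi => ?_
    · exact isCoprime_X_sub_C_of_isUnit_sub
        (isUnit_iff_ne_zero.mpr (sub_ne_zero.mpr fun h => hij (hv hi hj h)))
    · exact dvd_iff_isRoot.mpr (hroot i hi)
  obtain ⟨g, hg⟩ := hdvd
  have hg0 : g ≠ 0 := by rintro rfl; simp at hg; exact hω hg
  have hgdeg : g.natDegree = 0 := by
    have := natDegree_mul (Lagrange.nodal_ne_zero (s := s) (v := v)) hg0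
    rw [← hg, Lagrange.natDegree_nodal] at this
    omega
  obtain ⟨a, rfl⟩ := natDegree_eq_zero.mp hgdeg
  have ha : a ≠ 0 := by simpa using hg0
  have h1 := Lagrange.eq_interpolate hv hf
  have h2 := Lagrange.eval_interpolate_not_at_node (s := s) (v := v) (x := y)
    (fun i => f.eval (v i)) hy
  rw [← h1] at h2
  rw [h2, Finset.mul_sum]
  refine Finset.sum_congr rfl fun i hi => ?_
  have h3 : eval (v i) (derivative ω) = a * eval (v i) (derivative (Lagrange.nodal s v)) := by
    rw [hg, derivative_mul]; simp [mul_comm]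
  rw [Lagrange.nodalWeight_eq_eval_derivative_nodal hi, h3, hg, eval_mul, eval_C]
  simp only [div_eq_mul_inv, mul_inv]
  field_simp

lemma abs_sin_nat_mul_le (m : ℕ) (y : ℝ) : |Real.sin (m * y)| ≤ m * |Real.sin y| := by
  induction m with
  | zero => simp
  | succ k ih =>
    have : ((k + 1 : ℕ) : ℝ) * y = k * y + y := by push_cast; ring
    rw [this, Real.sin_add]
    calc _ ≤ |Real.sin (k * y) * Real.cos y| + |Real.cos (k * y) * Real.sin y| := abs_add_le _ _
      _ ≤ |Real.sin (k * y)| * 1 + 1 * |Real.sin y| := by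
          rw [abs_mul, abs_mul]
          gcongr <;> exact Real.abs_cos_le_one _
      _ ≤ _ := by push_cast; linarith

lemma inv_sin_le {y : ℝ} (h0 : 0 < y) (h1 : y < Real.pi) :
    (Real.sin y)⁻¹ ≤ Real.pi / 2 * (y⁻¹ + (Real.pi - y)⁻¹) := by
  have hpi := Real.pi_pos
  have key : ∀ z : ℝ, 0 < z → z ≤ Real.pi / 2 → (Real.sin z)⁻¹ ≤ Real.pi / 2 * z⁻¹ := by
    intro z hz hz'
    have := Real.mul_le_sin hz.le hz'
    calc (Real.sin z)⁻¹ ≤ (2 / Real.pi * z)⁻¹ := by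
          apply inv_anti₀ (by positivity) this
      _ = _ := by field_simp
  have hz : 0 < Real.pi - y := by linarith
  rcases le_total y (Real.pi / 2) with h | h
  · refine (key y h0 h).trans ?_
    gcongr
    have : 0 < (Real.pi - y)⁻¹ := by positivity
    linarith
  · have := key (Real.pi - y) hz (by linarith)
    rw [Real.sin_pi_sub] at this
    refine this.trans ?_
    gcongr
    have : 0 < y⁻¹ := by positivity
    linarith

/-- The Dirichlet-type quotients `|sin (m y) / sin y|` summed over `m` equally spaced nodes:
this is the source of every logarithm in the Lebesgue constants. -/
lemma sum_abs_sin_div_le (m : ℕ) (hm : 1 ≤ m) (x : ℝ) :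
    ∑ i ∈ Finset.range m, |Real.sin (m * (x - Real.pi * i / m))| / |Real.sin (x - Real.pi * i / m)|
      ≤ m * (3 + Real.log m) := by
  have hpi := Real.pi_pos
  have hm0 : (0 : ℝ) < m := by exact_mod_cast hm
  set F : ℝ → ℝ := fun y => |Real.sin (m * y)| / |Real.sin y| with hF
  have hFle : ∀ y, F y ≤ m := fun y =>
    div_le_of_le_mul₀ (abs_nonneg _) hm0.le (abs_sin_nat_mul_le m y)
  have hFper : ∀ y, F (y - Real.pi) = F y := by
    intro y
    simp only [hF, mul_sub, Real.sin_sub_nat_mul_pi, Real.sin_sub_pi, abs_neg, abs_mul, abs_pow,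
      abs_one, one_pow, one_mul]
  set S : ℝ → ℝ := fun x => ∑ i ∈ Finset.range m, F (x - Real.pi * i / m) with hS
  have hSper : Function.Periodic S (Real.pi / m) := by
    intro x
    have h1 := Finset.sum_range_succ (fun i : ℕ => F (x + Real.pi / m - Real.pi * i / m)) m
    have h2 := Finset.sum_range_succ' (fun i : ℕ => F (x + Real.pi / m - Real.pi * i / m)) m
    have h3 : F (x + Real.pi / m - Real.pi * m / m) =
        F (x + Real.pi / m - Real.pi * (0:ℕ) / m) := by
      rw [mul_div_cancel_right₀ _ hm0.ne', hFper]; simp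
    have h4 : ∀ i : ℕ, x + Real.pi / m - Real.pi * ((i + 1 : ℕ) : ℝ) / m = x - Real.pi * i / m := by
      intro i; push_cast; field_simp; ring
    simp only [h4] at h2
    simp only [hS]
    linarith
  change S x ≤ _
  obtain ⟨x', hx', hxx'⟩ := hSper.exists_mem_Ico₀ (by positivity) x
  rw [hxx']
  clear hxx'
  obtain ⟨hx0, hx1⟩ := hx'
  rcases hm.eq_or_lt with h1 | h1
  · have : S x' ≤ m := by
      simp only [hS, ← h1, Finset.sum_range_one]
      simpa [← h1] using hFle (x' - Real.pi * (0 : ℕ) / (1 : ℕ))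
    have hl : 0 ≤ Real.log m := Real.log_natCast_nonneg m
    nlinarith
  obtain ⟨k, rfl⟩ : ∃ k, m = k + 2 := ⟨m - 2, by omega⟩
  have hterm : ∀ j ∈ Finset.range k,
      F (x' - Real.pi * ((j + 1 + 1 : ℕ) : ℝ) / ((k + 2 : ℕ) : ℝ)) ≤
      ((k + 2 : ℕ) : ℝ) / 2 * (((j : ℝ) + 1)⁻¹ + (((k - 1 - j : ℕ) : ℝ) + 1)⁻¹) := by
    intro j hj
    have hjk : j < k := Finset.mem_range.mp hj
    have hcast : ((k - 1 - j : ℕ) : ℝ) + 1 = k - j := by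
      rw [Nat.sub_sub, Nat.cast_sub (by omega)]; push_cast; ring
    set y := Real.pi * ((j + 1 + 1 : ℕ) : ℝ) / ((k + 2 : ℕ) : ℝ) - x' with hy
    have hjk' : (j : ℝ) + 1 ≤ k := by exact_mod_cast hjk
    have hy1 : Real.pi * (j + 1) / ((k + 2 : ℕ) : ℝ) ≤ y := by
      have : Real.pi * ((j + 1 + 1 : ℕ) : ℝ) / ((k + 2 : ℕ) : ℝ) =
        Real.pi * (j + 1) / ((k + 2 : ℕ) : ℝ) + Real.pi / ((k + 2 : ℕ) : ℝ) := by
        push_cast; ring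
      rw [hy, this]; linarith
    have hy2 : Real.pi * (k - j) / ((k + 2 : ℕ) : ℝ) ≤ Real.pi - y := by
      have : Real.pi - Real.pi * ((j + 1 + 1 : ℕ) : ℝ) / ((k + 2 : ℕ) : ℝ) =
        Real.pi * (k - j) / ((k + 2 : ℕ) : ℝ) := by
        field_simp; push_cast; ring
      rw [← this, hy]; linarith
    have hp1 : 0 < Real.pi * (j + 1) / ((k + 2 : ℕ) : ℝ) := by positivity
    have hp2 : 0 < Real.pi * (k - j) / ((k + 2 : ℕ) : ℝ) := by
      have : (0 : ℝ) < k - j := by linarith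
      positivity
    have hy0 : 0 < y := by linarith
    have hypi : y < Real.pi := by linarith
    have hneg : x' - Real.pi * ((j + 1 + 1 : ℕ) : ℝ) / ((k + 2 : ℕ) : ℝ) = -y := by rw [hy]; ring
    rw [hneg]
    have hs : 0 < Real.sin y := Real.sin_pos_of_pos_of_lt_pi hy0 hypi
    calc F (-y) ≤ 1 / Real.sin y := by
          simp only [hF, Real.sin_neg, abs_neg, abs_of_pos hs]
          gcongr
          exact Real.abs_sin_le_one _
      _ = (Real.sin y)⁻¹ := one_div _
      _ ≤ Real.pi / 2 * (y⁻¹ + (Real.pi - y)⁻¹) := inv_sin_le hy0 hypi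
      _ ≤ Real.pi / 2 * ((Real.pi * (j + 1) / ((k + 2 : ℕ) : ℝ))⁻¹ +
            (Real.pi * (k - j) / ((k + 2 : ℕ) : ℝ))⁻¹) := by
          gcongr
      _ = _ := by
          rw [hcast]
          have : (0 : ℝ) < k - j := by linarith
          field_simp
  have hH : ∑ j ∈ Finset.range k, ((j : ℝ) + 1)⁻¹ ≤ 1 + Real.log ((k + 2 : ℕ) : ℝ) := by
    have h := harmonic_le_one_add_log k
    have h' : ((harmonic k : ℚ) : ℝ) = ∑ j ∈ Finset.range k, ((j : ℝ) + 1)⁻¹ := by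
      simp [harmonic]
    rw [h'] at h
    refine h.trans ?_
    rcases Nat.eq_zero_or_pos k with rfl | hk
    · simp; positivity
    · have : Real.log (k : ℝ) ≤ Real.log ((k + 2 : ℕ) : ℝ) := by
        apply Real.log_le_log (by exact_mod_cast hk); push_cast; linarith
      linarith
  have hrefl := Finset.sum_range_reflect (fun j : ℕ => ((j : ℝ) + 1)⁻¹) k
  simp only [hS]
  rw [Finset.sum_range_succ', Finset.sum_range_succ']
  have hsum := Finset.sum_le_sum hterm
  rw [← Finset.mul_sum, Finset.sum_add_distrib, hrefl] at hsum
  have a1 := hFle (x' - Real.pi * ((0 : ℕ) : ℝ) / ((k + 2 : ℕ) : ℝ))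
  have a2 := hFle (x' - Real.pi * ((0 + 1 : ℕ) : ℝ) / ((k + 2 : ℕ) : ℝ))
  have hbound : ((k + 2 : ℕ) : ℝ) / 2 * (∑ j ∈ Finset.range k, ((j : ℝ) + 1)⁻¹ +
      ∑ j ∈ Finset.range k, ((j : ℝ) + 1)⁻¹) ≤
      ((k + 2 : ℕ) : ℝ) * (1 + Real.log ((k + 2 : ℕ) : ℝ)) := by
    have := mul_le_mul_of_nonneg_left hH hm0.le
    linarith
  linarith

/-- The two Dirichlet-type quotients attached to the nodes `cos (τ + 2πl/m)` and the point `cos φ`,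
summed over the nodes. -/
lemma sum_pair_le (m : ℕ) (hm : 1 ≤ m) (φ τ : ℝ) :
    ∑ l ∈ Finset.range m,
      (|Real.sin (m * ((φ - (τ + 2 * Real.pi * l / m)) / 2))| /
          |Real.sin ((φ - (τ + 2 * Real.pi * l / m)) / 2)| +
        |Real.sin (m * ((φ + (τ + 2 * Real.pi * l / m)) / 2))| /
          |Real.sin ((φ + (τ + 2 * Real.pi * l / m)) / 2)|) ≤ 2 * m * (3 + Real.log m) := by
  have h1 := sum_abs_sin_div_le m hm ((φ - τ) / 2)
  have h2 := sum_abs_sin_div_le m hm (-((φ + τ) / 2))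
  rw [Finset.sum_add_distrib]
  have e1 : ∀ l : ℕ, (φ - (τ + 2 * Real.pi * l / m)) / 2 = (φ - τ) / 2 - Real.pi * l / m := by
    intro l; ring
  have e2 : ∀ l : ℕ, (φ + (τ + 2 * Real.pi * l / m)) / 2 =
      -(-((φ + τ) / 2) - Real.pi * l / m) := by
    intro l; ring
  simp only [e1]
  simp only [e2, mul_neg, Real.sin_neg, abs_neg]
  linarith

lemma abs_cos_sub_cos (φ ψ : ℝ) : |Real.cos φ - Real.cos ψ| =
    2 * (|Real.sin ((φ - ψ) / 2)| * |Real.sin ((φ + ψ) / 2)|) := by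
  rw [Real.cos_sub_cos, abs_mul, abs_mul]
  simp; ring

lemma abs_sin_le_half_left (φ ψ : ℝ) :
    |Real.sin φ| ≤ |Real.sin ((φ - ψ) / 2)| + |Real.sin ((φ + ψ) / 2)| := by
  have : φ = (φ - ψ) / 2 + (φ + ψ) / 2 := by ring
  conv_lhs => rw [this, Real.sin_add]
  refine (abs_add_le _ _).trans ?_
  rw [abs_mul, abs_mul]
  have h1 := Real.abs_cos_le_one ((φ - ψ) / 2)
  have h2 := Real.abs_cos_le_one ((φ + ψ) / 2)
  have := abs_nonneg (Real.sin ((φ - ψ) / 2))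
  have := abs_nonneg (Real.sin ((φ + ψ) / 2))
  nlinarith

lemma abs_sin_le_half_right (φ ψ : ℝ) :
    |Real.sin ψ| ≤ |Real.sin ((φ - ψ) / 2)| + |Real.sin ((φ + ψ) / 2)| := by
  have := abs_sin_le_half_left ψ φ
  rwa [add_comm ψ, ← neg_sub φ ψ, neg_div, Real.sin_neg, abs_neg] at this

open Polynomial in
/-- A Lagrange-interpolation bound in terms of a bound for the individual terms. -/
lemma abs_eval_le_of_nodes {ι : Type*} (s : Finset ι) (v : ι → ℝ)
    (hv : Set.InjOn v s) (ω : ℝ[X]) (hω : ω ≠ 0) (hdeg : ω.natDegree ≤ s.card)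
    (hroot : ∀ i ∈ s, ω.eval (v i) = 0) (f : ℝ[X]) (hf : f.degree < s.card) (y : ℝ)
    (B L : ℝ) (hL : 1 ≤ L) (hB : 0 ≤ B) (hfB : ∀ i ∈ s, |f.eval (v i)| ≤ B)
    (hsum : (∀ i ∈ s, y ≠ v i) →
      ∑ i ∈ s, |ω.eval y| / (|y - v i| * |(derivative ω).eval (v i)|) ≤ L) :
    |f.eval y| ≤ L * B := by
  by_cases hy : ∀ i ∈ s, y ≠ v i
  · rw [eval_eq_sum_of_roots s v hv ω hω hdeg hroot f hf y hy]
    refine (Finset.abs_sum_le_sum_abs _ _).trans ?_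
    have := mul_le_mul_of_nonneg_right (hsum hy) hB
    refine le_trans ?_ this
    rw [Finset.sum_mul]
    refine Finset.sum_le_sum fun i hi => ?_
    rw [abs_div, abs_mul, abs_mul, mul_div_assoc, mul_comm]
    gcongr
    exact hfB i hi
  · push Not at hy
    obtain ⟨i, hi, rfl⟩ := hy
    have := hfB i hi
    nlinarith

open Polynomial in
/-- The zeros of `T_m - cos β` are a norming set for polynomials of degree `< m`, with a
logarithmic constant, as long as `cos β` stays away from `±1`. -/
lemma abs_eval_le_of_level_set (m : ℕ) (hm : 1 ≤ m) (β : ℝ) (hβ : 1 / 2 ≤ |Real.sin β|)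
    (f : ℝ[X]) (hf : f.degree < m) (B : ℝ)
    (hfB : ∀ ψ : ℝ, Real.cos (m * ψ) = Real.cos β → |f.eval (Real.cos ψ)| ≤ B) (φ : ℝ) :
    |f.eval (Real.cos φ)| ≤ 4 * (3 + Real.log m) * B := by
  have hpi := Real.pi_pos
  have hm0 : (0 : ℝ) < m := by exact_mod_cast hm
  have hlog : 0 ≤ Real.log m := Real.log_natCast_nonneg m
  set ψ : ℕ → ℝ := fun l => β / m + 2 * Real.pi * l / m with hψ
  have hmψ : ∀ l : ℕ, m * ψ l = β + l * (2 * Real.pi) := by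
    intro l; simp only [hψ]; field_simp
  have hcosψ : ∀ l, Real.cos (m * ψ l) = Real.cos β := by
    intro l; rw [hmψ, Real.cos_add_nat_mul_two_pi]
  have hsinψ : ∀ l, Real.sin (m * ψ l) = Real.sin β := by
    intro l; rw [hmψ, Real.sin_add_nat_mul_two_pi]
  have hsβ : Real.sin β ≠ 0 := by
    intro h; rw [h, abs_zero] at hβ; linarith
  have hB : 0 ≤ B := (abs_nonneg _).trans (hfB (ψ 0) (hcosψ 0))
  set ω : ℝ[X] := Chebyshev.T ℝ m - C (Real.cos β) with hω
  have hωdeg : ω.natDegree = m := by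
    rw [hω, natDegree_sub_C, Chebyshev.natDegree_T]; simp
  have hωeval : ∀ φ, ω.eval (Real.cos φ) = Real.cos (m * φ) - Real.cos β := by
    intro φ; rw [hω, eval_sub, Chebyshev.T_real_cos]; simp
  have hω' : ∀ φ, (derivative ω).eval (Real.cos φ) * Real.sin φ = m * Real.sin (m * φ) := by
    intro φ
    have := Chebyshev.U_real_cos φ ((m : ℤ) - 1)
    rw [hω, derivative_sub, derivative_C, sub_zero, Chebyshev.T_derivative_eq_U]
    simp only [eval_mul, Int.cast_natCast, eval_natCast, mul_assoc, this]
    simp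
  refine abs_eval_le_of_nodes (Finset.range m) (fun l => Real.cos (ψ l)) ?_ ω ?_ (by simp [hωdeg])
    ?_ f (by simpa using hf) (Real.cos φ) B _ (by linarith) hB
    (fun l _ => hfB _ (hcosψ l)) ?_
  · intro l hl l' hl' h
    simp only [Finset.coe_range, Set.mem_Iio] at hl hl'
    rw [Real.cos_eq_cos_iff] at h
    obtain ⟨k, hk | hk⟩ := h
    · have : (m : ℝ) * ψ l' = 2 * k * Real.pi * m + m * ψ l := by rw [hk]; ring
      rw [hmψ, hmψ] at this
      have h2 : (l' : ℝ) = k * m + l := by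
        have h3 : (2 * Real.pi) * (l' - k * m - l) = 0 := by linarith
        have := (mul_eq_zero.mp h3).resolve_left (by positivity)
        linarith
      have h4 : (l' : ℤ) = k * m + l := by exact_mod_cast h2
      have h5 : (l' : ℤ) % m = (l : ℤ) % m := by rw [h4]; simp
      rw [Int.emod_eq_of_lt (by omega) (by omega), Int.emod_eq_of_lt (by omega) (by omega)] at h5
      exact_mod_cast h5.symm
    · exfalso
      have : (m : ℝ) * ψ l' = 2 * k * Real.pi * m - m * ψ l := by rw [hk]; ring
      rw [hmψ, hmψ] at this
      apply hsβ
      rw [Real.sin_eq_zero_iff]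
      refine ⟨k * m - l - l', ?_⟩
      push_cast
      linarith
  · intro h
    have := hωdeg
    rw [h, natDegree_zero] at this
    omega
  · intro l _
    rw [hωeval, hcosψ, sub_self]
  · intro hne
    have hterm : ∀ l ∈ Finset.range m, |ω.eval (Real.cos φ)| /
        (|Real.cos φ - Real.cos (ψ l)| * |(derivative ω).eval (Real.cos (ψ l))|) ≤
        2 / m * (|Real.sin (m * ((φ - ψ l) / 2))| / |Real.sin ((φ - ψ l) / 2)| +
        |Real.sin (m * ((φ + ψ l) / 2))| / |Real.sin ((φ + ψ l) / 2)|) := by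
      intro l hl
      have hd := abs_cos_sub_cos φ (ψ l)
      have hne' : 0 < |Real.cos φ - Real.cos (ψ l)| := abs_pos.mpr (sub_ne_zero.mpr (hne l hl))
      have hr := abs_sin_le_half_right φ (ψ l)
      have hω'l : |(derivative ω).eval (Real.cos (ψ l))| * |Real.sin (ψ l)| = m * |Real.sin β| := by
        rw [← abs_mul, hω', abs_mul, hsinψ, Nat.abs_cast]
      have hnum : |ω.eval (Real.cos φ)| = 2 * (|Real.sin (m * ((φ - ψ l) / 2))| *
          |Real.sin (m * ((φ + ψ l) / 2))|) := by
        rw [hωeval, ← hcosψ l, abs_cos_sub_cos]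
        congr 4 <;> ring_nf
      have hA := Real.abs_sin_le_one (m * ((φ - ψ l) / 2))
      have hB' := Real.abs_sin_le_one (m * ((φ + ψ l) / 2))
      rw [hnum, hd]
      rw [hd] at hne'
      set a := |Real.sin ((φ - ψ l) / 2)|
      set b := |Real.sin ((φ + ψ l) / 2)|
      set A := |Real.sin (m * ((φ - ψ l) / 2))|
      set A' := |Real.sin (m * ((φ + ψ l) / 2))|
      set D := |(derivative ω).eval (Real.cos (ψ l))|
      have hA0 : 0 ≤ A := abs_nonneg _
      have hA'0 : 0 ≤ A' := abs_nonneg _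
      have ha : 0 < a := (abs_nonneg _).lt_of_ne' fun h => by
        simp [a, h] at hne'
      have hb : 0 < b := (abs_nonneg _).lt_of_ne' fun h => by
        simp [b, h] at hne'
      have hD : m / (2 * (a + b)) ≤ D := by
        rw [div_le_iff₀ (by positivity)]
        have : 0 ≤ D := abs_nonneg _
        nlinarith
      calc 2 * (A * A') / (2 * (a * b) * D)
          ≤ 2 * (A * A') / (2 * (a * b) * (m / (2 * (a + b)))) := by gcongr
        _ = 2 / m * (A * A' / a + A * A' / b) := by field_simp; ring
        _ ≤ 2 / m * (A * 1 / a + 1 * A' / b) := by gcongr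
        _ = _ := by rw [mul_one, one_mul]
    refine (Finset.sum_le_sum hterm).trans ?_
    rw [← Finset.mul_sum]
    have := sum_pair_le m hm φ (β / m)
    calc _ ≤ 2 / m * (2 * m * (3 + Real.log m)) := by gcongr
      _ = _ := by field_simp; ring

open Polynomial in
/-- The Chebyshev-Lobatto points `cos (kπ/M)`, `0 ≤ k ≤ M`, are a norming set for polynomials of
degree at most `M`, with a logarithmic constant. -/
lemma abs_eval_le_of_lobatto (M : ℕ) (hM : 1 ≤ M) (f : ℝ[X]) (hf : f.natDegree ≤ M) (B : ℝ)
    (hfB : ∀ k : ℕ, k ≤ M → |f.eval (Real.cos (k * Real.pi / M))| ≤ B) (φ : ℝ) :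
    |f.eval (Real.cos φ)| ≤ 2 * (3 + Real.log (2 * M)) * B := by
  have hpi := Real.pi_pos
  have hM0 : (0 : ℝ) < M := by exact_mod_cast hM
  have hlog : 0 ≤ Real.log (2 * M) := Real.log_nonneg (by
    have : (1 : ℝ) ≤ M := by exact_mod_cast hM
    linarith)
  have hB : 0 ≤ B := (abs_nonneg _).trans (hfB 0 (Nat.zero_le _))
  set ψ : ℕ → ℝ := fun k => k * Real.pi / M with hψ
  have hMψ : ∀ k : ℕ, M * ψ k = k * Real.pi := by
    intro k; simp only [hψ]; field_simp
  set U : ℝ[X] := Chebyshev.U ℝ ((M : ℤ) - 1) with hU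
  have hUeval : ∀ φ, U.eval (Real.cos φ) * Real.sin φ = Real.sin (M * φ) := by
    intro φ
    have := Chebyshev.U_real_cos φ ((M : ℤ) - 1)
    rw [hU, this]; simp
  have hU0 : U ≠ 0 := Chebyshev.U_ne_zero ℝ _ (by omega)
  set ω : ℝ[X] := (X ^ 2 - 1) * U with hω
  have hX : (X ^ 2 - 1 : ℝ[X]).natDegree = 2 := by
    rw [← C_1, natDegree_sub_C, natDegree_X_pow]
  have hX0 : (X ^ 2 - 1 : ℝ[X]) ≠ 0 := by
    intro h; rw [h, natDegree_zero] at hX; omega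
  have hωdeg : ω.natDegree = M + 1 := by
    rw [hω, natDegree_mul hX0 hU0, hX, hU]
    have : ((M : ℤ) - 1) = ((M - 1 : ℕ) : ℤ) := by omega
    rw [this, Chebyshev.natDegree_U_natCast]; omega
  have hωeval : ∀ φ, ω.eval (Real.cos φ) = -(Real.sin φ * Real.sin (M * φ)) := by
    intro φ
    rw [hω, eval_mul, ← hUeval]
    have := Real.sin_sq_add_cos_sq φ
    simp only [eval_sub, eval_pow, eval_X, eval_one]
    linear_combination (U.eval (Real.cos φ)) * (this)
  have hder : derivative ω = X * U + (M : ℝ[X]) * Chebyshev.T ℝ M := by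
    have := Chebyshev.add_one_mul_T_eq_poly_in_U (R := ℝ) ((M : ℤ) - 1)
    simp only [sub_add_cancel, Int.cast_sub, Int.cast_natCast, Int.cast_one] at this
    rw [this, hω, derivative_mul]
    simp only [derivative_sub, derivative_X_pow, derivative_one, hU]
    simp only [Nat.cast_ofNat, map_ofNat]
    ring
  have hTψ : ∀ k, (Chebyshev.T ℝ M).eval (Real.cos (ψ k)) = (-1) ^ k := by
    intro k
    rw [Chebyshev.T_real_cos, Int.cast_natCast, hMψ, Real.cos_nat_mul_pi]
  refine (abs_eval_le_of_nodes (Finset.range (M + 1)) (fun k => Real.cos (ψ k)) ?_ ω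
    (mul_ne_zero hX0 hU0) (by simp [hωdeg]) ?_ f ?_ (Real.cos φ) B _ (by linarith) hB
    (fun k hk => hfB k (by simpa [Nat.lt_succ_iff] using hk)) ?_)
  · have hmem : ∀ k ∈ Finset.range (M + 1), ψ k ∈ Set.Icc 0 Real.pi := by
      intro k hk
      have hk' : (k : ℝ) ≤ M := by
        exact_mod_cast Nat.lt_succ_iff.mp (Finset.mem_range.mp hk)
      refine ⟨by positivity, ?_⟩
      simp only [hψ]
      rw [div_le_iff₀ hM0]
      nlinarith
    intro k hk l hl h
    have := Real.injOn_cos (hmem k hk) (hmem l hl) h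
    have h2 : (M : ℝ) * ψ k = M * ψ l := by rw [this]
    rw [hMψ, hMψ] at h2
    exact_mod_cast mul_right_cancel₀ hpi.ne' h2
  · intro k _
    rw [hωeval, hMψ, Real.sin_nat_mul_pi]; simp
  · refine lt_of_le_of_lt degree_le_natDegree ?_
    rw [Finset.card_range]
    exact_mod_cast Nat.lt_succ_of_le hf
  · intro hne
    have hω' : ∀ k ∈ Finset.range (M + 1), (M : ℝ) ≤ |(derivative ω).eval (Real.cos (ψ k))| := by
      intro k hk
      rw [hder, eval_add, eval_mul, eval_mul, hTψ, eval_X, eval_natCast]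
      have hs := hUeval (ψ k)
      rw [hMψ, Real.sin_nat_mul_pi] at hs
      rcases mul_eq_zero.mp hs with h | h
      · simp [h, abs_mul]
      · -- at the two endpoints `±1` both summands equal `± M`, with the same sign
        have hkM : k ≤ M := Nat.lt_succ_iff.mp (Finset.mem_range.mp hk)
        rw [Real.sin_eq_zero_iff] at h
        obtain ⟨j, hj⟩ := h
        have h2 : (M : ℝ) * (j * Real.pi) = k * Real.pi := by rw [hj, hMψ]
        have h3 : (M : ℤ) * j = k := by
          have : (M : ℝ) * j = k := by
            apply mul_right_cancel₀ hpi.ne'; linarith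
          exact_mod_cast this
        have hk01 : k = 0 ∨ k = M := by
          rcases Nat.eq_zero_or_pos k with h0 | h0
          · exact Or.inl h0
          · right
            have : 0 < j := by
              by_contra hcon
              have : (M : ℤ) * j ≤ 0 := mul_nonpos_of_nonneg_of_nonpos (by positivity) (by omega)
              omega
            have : (M : ℤ) * 1 ≤ M * j := by gcongr; omega
            omega
        rcases hk01 with rfl | hkM
        · have : U.eval (1 : ℝ) = M := by rw [hU, Chebyshev.U_eval_one]; simp
          simp only [hψ, Nat.cast_zero, zero_mul, zero_div, Real.cos_zero, this, pow_zero]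
          rw [abs_of_nonneg (by positivity)]
          linarith
        · have hcos : Real.cos (ψ k) = -1 := by
            simp only [hψ, hkM]
            rw [mul_div_cancel_left₀ _ hM0.ne', Real.cos_pi]
          obtain ⟨r, rfl⟩ : ∃ r, M = r + 1 := ⟨M - 1, by omega⟩
          have : U.eval (-1 : ℝ) = (-1) ^ r * ((r : ℝ) + 1) := by
            rw [hU, Chebyshev.U_eval_neg_one]
            simp [Int.negOnePow_def]
          rw [hcos, this, hkM]
          have h5 : (-1 : ℝ) * ((-1) ^ r * (r + 1)) + ((r + 1 : ℕ) : ℝ) * (-1) ^ (r + 1) =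
              (-1) ^ (r + 1) * (2 * (r + 1)) := by
            push_cast; ring
          rw [h5, abs_mul, abs_pow, abs_neg, abs_one, one_pow, one_mul,
            abs_of_nonneg (by positivity)]
          push_cast; linarith
    have h2M : ((2 * M : ℕ) : ℝ) = 2 * M := by push_cast; ring
    have hterm : ∀ k ∈ Finset.range (M + 1), |ω.eval (Real.cos φ)| /
        (|Real.cos φ - Real.cos (ψ k)| * |(derivative ω).eval (Real.cos (ψ k))|) ≤
        1 / (2 * M) * (|Real.sin ((2 * M : ℕ) * ((φ - (0 + 2 * Real.pi * k / (2 * M : ℕ))) / 2))| /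
            |Real.sin ((φ - (0 + 2 * Real.pi * k / (2 * M : ℕ))) / 2)| +
          |Real.sin ((2 * M : ℕ) * ((φ + (0 + 2 * Real.pi * k / (2 * M : ℕ))) / 2))| /
            |Real.sin ((φ + (0 + 2 * Real.pi * k / (2 * M : ℕ))) / 2)|) := by
      intro k hk
      have e : 0 + 2 * Real.pi * k / (2 * M : ℕ) = ψ k := by
        simp only [hψ, h2M]; field_simp; ring
      rw [e, h2M]
      have hd := abs_cos_sub_cos φ (ψ k)
      have hne' : 0 < |Real.cos φ - Real.cos (ψ k)| := abs_pos.mpr (sub_ne_zero.mpr (hne k hk))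
      have hr := abs_sin_le_half_left φ (ψ k)
      have hS1 : |Real.sin (2 * M * ((φ - ψ k) / 2))| = |Real.sin (M * φ)| := by
        rw [show 2 * M * ((φ - ψ k) / 2) = M * φ - M * ψ k by ring, hMψ, Real.sin_sub_nat_mul_pi,
          abs_mul, abs_pow, abs_neg, abs_one, one_pow, one_mul]
      have hS2 : |Real.sin (2 * M * ((φ + ψ k) / 2))| = |Real.sin (M * φ)| := by
        rw [show 2 * M * ((φ + ψ k) / 2) = M * φ + M * ψ k by ring, hMψ, Real.sin_add_nat_mul_pi,
          abs_mul, abs_pow, abs_neg, abs_one, one_pow, one_mul]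
      rw [hS1, hS2, hωeval, abs_neg, abs_mul, hd]
      rw [hd] at hne'
      have hD := hω' k hk
      set a := |Real.sin ((φ - ψ k) / 2)|
      set b := |Real.sin ((φ + ψ k) / 2)|
      have ha : 0 < a := (abs_nonneg _).lt_of_ne' fun h => by
        simp [a, h] at hne'
      have hb : 0 < b := (abs_nonneg _).lt_of_ne' fun h => by
        simp [b, h] at hne'
      calc |Real.sin φ| * |Real.sin (M * φ)| /
            (2 * (a * b) * |(derivative ω).eval (Real.cos (ψ k))|)
          ≤ (a + b) * |Real.sin (M * φ)| / (2 * (a * b) * M) := by gcongr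
        _ = _ := by field_simp; ring
    refine (Finset.sum_le_sum hterm).trans ?_
    rw [← Finset.mul_sum]
    have h := sum_pair_le (2 * M) (by omega) φ 0
    have hsub := Finset.sum_le_sum_of_subset_of_nonneg
      (f := fun k : ℕ =>
          (|Real.sin ((2 * M : ℕ) * ((φ - (0 + 2 * Real.pi * k / (2 * M : ℕ))) / 2))| /
            |Real.sin ((φ - (0 + 2 * Real.pi * k / (2 * M : ℕ))) / 2)| +
          |Real.sin ((2 * M : ℕ) * ((φ + (0 + 2 * Real.pi * k / (2 * M : ℕ))) / 2))| /
            |Real.sin ((φ + (0 + 2 * Real.pi * k / (2 * M : ℕ))) / 2)|))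
      (Finset.range_mono (show M + 1 ≤ 2 * M by omega)) (fun k _ _ => by positivity)
    have h3 := hsub.trans h
    calc _ ≤ 1 / (2 * M) * (2 * (2 * M : ℕ) * (3 + Real.log (2 * M : ℕ))) := by gcongr
      _ = _ := by rw [h2M]; field_simp

/-! ### A discrete de la Vallée-Poussin operator -/

/-- The trigonometric monomial `exp (i a θ)`. -/
noncomputable def expMode (a : ℤ) (θ : ℝ) : ℂ := Complex.exp ((a : ℂ) * θ * Complex.I)

/-- The Dirichlet kernel `∑_{|a| ≤ L} exp (i a θ)`. -/
noncomputable def dirichlet (L : ℕ) (θ : ℝ) : ℂ :=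
  ∑ a ∈ Finset.Icc (-(L : ℤ)) L, expMode a θ

lemma expMode_add (a b : ℤ) (θ : ℝ) : expMode (a + b) θ = expMode a θ * expMode b θ := by
  simp only [expMode, ← Complex.exp_add]; congr 1; push_cast; ring

lemma expMode_sub_arg (a : ℤ) (φ θ : ℝ) : expMode a (φ - θ) = expMode a φ * expMode (-a) θ := by
  simp only [expMode, ← Complex.exp_add]; congr 1; push_cast; ring

lemma conj_expMode (a : ℤ) (θ : ℝ) : (starRingEnd ℂ) (expMode a θ) = expMode (-a) θ := by
  simp only [expMode, ← Complex.exp_conj]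
  simp

lemma expMode_zero (θ : ℝ) : expMode 0 θ = 1 := by simp [expMode]

/-- Orthogonality of the modes on `m` equally spaced nodes. -/
lemma sum_expMode (m : ℕ) (hm : 1 ≤ m) (τ : ℝ) (j : ℤ) (hj : |j| < m) :
    ∑ i ∈ Finset.range m, expMode j (τ + 2 * Real.pi * i / m) = if j = 0 then (m : ℂ) else 0 := by
  have hm0 : (m : ℂ) ≠ 0 := by exact_mod_cast (by omega : m ≠ 0)
  split_ifs with h
  · simp [h, expMode_zero]
  · set ζ : ℂ := Complex.exp (2 * Real.pi * Complex.I * (j / m)) with hζ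
    have h1 : ∀ i : ℕ, expMode j (τ + 2 * Real.pi * i / m) = expMode j τ * ζ ^ i := by
      intro i
      simp only [expMode, hζ, ← Complex.exp_nat_mul, ← Complex.exp_add]
      congr 1; push_cast; ring
    have hζm : ζ ^ m = 1 := by
      rw [hζ, ← Complex.exp_nat_mul, Complex.exp_eq_one_iff]
      exact ⟨j, by field_simp⟩
    have hζ1 : ζ ≠ 1 := by
      rw [hζ, Ne, Complex.exp_eq_one_iff]
      rintro ⟨n, hn⟩
      have h2 : (j : ℂ) = n * m := by
        have hp : (2 * Real.pi * Complex.I : ℂ) ≠ 0 := Complex.two_pi_I_ne_zero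
        have : (2 * Real.pi * Complex.I : ℂ) * (j / m) = (2 * Real.pi * Complex.I) * n := by
          rw [hn]; ring
        have := mul_left_cancel₀ hp this
        field_simp at this
        rw [this]; ring
      have h3 : j = n * m := by exact_mod_cast h2
      have : j = 0 := Int.eq_zero_of_abs_lt_dvd (Dvd.intro_left n h3.symm) (by simpa using hj)
      exact h this
    simp only [h1, ← Finset.mul_sum]
    rw [geom_sum_eq hζ1, hζm]
    simp

/-- Parseval's identity for the Dirichlet kernel on equally spaced nodes. -/
lemma sum_norm_dirichlet_sq (m L : ℕ) (hL : 2 * L < m) (τ φ : ℝ) :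
    ∑ i ∈ Finset.range m, ‖dirichlet L (φ - (τ + 2 * Real.pi * i / m))‖ ^ 2 = m * (2 * L + 1) := by
  have key : ∑ i ∈ Finset.range m, (((‖dirichlet L (φ - (τ + 2 * Real.pi * i / m))‖ ^ 2 : ℝ)) : ℂ)
      = m * (2 * L + 1) := by
    have h1 : ∀ i : ℕ, (((‖dirichlet L (φ - (τ + 2 * Real.pi * i / m))‖ ^ 2 : ℝ)) : ℂ) =
        ∑ a ∈ Finset.Icc (-(L : ℤ)) L, ∑ b ∈ Finset.Icc (-(L : ℤ)) L,
          expMode (a - b) φ * expMode (b - a) (τ + 2 * Real.pi * i / m) := by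
      intro i
      rw [← Complex.normSq_eq_norm_sq, ← Complex.mul_conj, dirichlet, map_sum, Finset.sum_mul_sum]
      refine Finset.sum_congr rfl fun a _ => Finset.sum_congr rfl fun b _ => ?_
      rw [conj_expMode, ← expMode_add, expMode_sub_arg]
      rw [show -(a + -b) = b - a by ring, ← sub_eq_add_neg]
    simp only [h1]
    rw [Finset.sum_comm]
    have h2 : ∀ a ∈ Finset.Icc (-(L : ℤ)) L,
        ∑ i ∈ Finset.range m, ∑ b ∈ Finset.Icc (-(L : ℤ)) L,
          expMode (a - b) φ * expMode (b - a) (τ + 2 * Real.pi * i / m) = m := by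
      intro a ha
      rw [Finset.sum_comm]
      simp only [← Finset.mul_sum]
      rw [Finset.sum_eq_single a]
      · rw [sum_expMode m (by omega) τ _ (by simp; omega)]
        simp [expMode_zero]
      · intro b hb hba
        rw [Finset.mem_Icc] at ha hb
        rw [sum_expMode m (by omega) τ _ (by rw [abs_lt]; omega), if_neg (by omega), mul_zero]
      · exact fun h => absurd ha h
    rw [Finset.sum_congr rfl h2, Finset.sum_const, Int.card_Icc, nsmul_eq_mul]
    have : (((L : ℤ) + 1 - -(L : ℤ)).toNat : ℂ) = 2 * L + 1 := by
      have : ((L : ℤ) + 1 - -(L : ℤ)).toNat = 2 * L + 1 := by omega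
      rw [this]; push_cast; ring
    rw [this]; ring
  exact_mod_cast key

/-- The kernel `dirichlet N * dirichlet (2 N)`, sampled at `6 N` nodes, reproduces the modes of
frequency at most `N`. -/
lemma sum_expMode_mul_kernel (N : ℕ) (hN : 1 ≤ N) (τ φ : ℝ) (k : ℤ) (hk : |k| ≤ N) :
    ∑ i ∈ Finset.range (6 * N), expMode k (τ + 2 * Real.pi * i / (6 * N : ℕ)) *
      (dirichlet N (φ - (τ + 2 * Real.pi * i / (6 * N : ℕ))) *
        dirichlet (2 * N) (φ - (τ + 2 * Real.pi * i / (6 * N : ℕ)))) =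
      ((6 * N : ℕ) * (2 * N + 1) : ℂ) * expMode k φ := by
  have h1 : ∀ i : ℕ, expMode k (τ + 2 * Real.pi * i / (6 * N : ℕ)) *
      (dirichlet N (φ - (τ + 2 * Real.pi * i / (6 * N : ℕ))) *
        dirichlet (2 * N) (φ - (τ + 2 * Real.pi * i / (6 * N : ℕ)))) =
      ∑ a ∈ Finset.Icc (-(N : ℤ)) N, ∑ b ∈ Finset.Icc (-((2 * N : ℕ) : ℤ)) (2 * N : ℕ),
        expMode (a + b) φ * expMode (k - a - b) (τ + 2 * Real.pi * i / (6 * N : ℕ)) := by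
    intro i
    rw [dirichlet, dirichlet, Finset.sum_mul_sum, Finset.mul_sum]
    refine Finset.sum_congr rfl fun a _ => ?_
    rw [Finset.mul_sum]
    refine Finset.sum_congr rfl fun b _ => ?_
    rw [expMode_sub_arg, expMode_sub_arg, expMode_add,
      show k - a - b = k + (-a + -b) by ring, expMode_add, expMode_add]
    ring
  simp only [h1]
  rw [Finset.sum_comm]
  rw [abs_le] at hk
  have h2 : ∀ a ∈ Finset.Icc (-(N : ℤ)) N,
      ∑ i ∈ Finset.range (6 * N), ∑ b ∈ Finset.Icc (-((2 * N : ℕ) : ℤ)) (2 * N : ℕ),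
        expMode (a + b) φ * expMode (k - a - b) (τ + 2 * Real.pi * i / (6 * N : ℕ)) =
      (6 * N : ℕ) * expMode k φ := by
    intro a ha
    rw [Finset.sum_comm]
    simp only [← Finset.mul_sum]
    rw [Finset.mem_Icc] at ha
    rw [Finset.sum_eq_single (k - a)]
    · rw [sum_expMode _ (by omega) τ _ (by simp; omega), if_pos (by ring),
        show a + (k - a) = k by ring, mul_comm]
    · intro b hb hba
      rw [Finset.mem_Icc] at hb
      push_cast at hb
      rw [sum_expMode _ (by omega) τ _ (by rw [abs_lt]; push_cast; omega), if_neg (by omega),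
        mul_zero]
    · intro h
      exact absurd (Finset.mem_Icc.mpr (by push_cast; omega)) h
  rw [Finset.sum_congr rfl h2, Finset.sum_const, Int.card_Icc, nsmul_eq_mul]
  have : (((N : ℤ) + 1 - -(N : ℤ)).toNat : ℂ) = 2 * N + 1 := by
    have : ((N : ℤ) + 1 - -(N : ℤ)).toNat = 2 * N + 1 := by omega
    rw [this]; push_cast; ring
  rw [this]; ring

open Polynomial in
/-- The kernel reproduces the polynomials of degree at most `N` in `cos θ`. -/
lemma eval_cos_eq_sum_kernel (N : ℕ) (hN : 1 ≤ N) (τ φ : ℝ) (f : ℝ[X]) (hf : f.natDegree ≤ N) :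
    ∑ i ∈ Finset.range (6 * N), ((f.eval (Real.cos (τ + 2 * Real.pi * i / (6 * N : ℕ))) : ℝ) : ℂ) *
      (dirichlet N (φ - (τ + 2 * Real.pi * i / (6 * N : ℕ))) *
        dirichlet (2 * N) (φ - (τ + 2 * Real.pi * i / (6 * N : ℕ)))) =
      ((6 * N : ℕ) * (2 * N + 1) : ℂ) * ((f.eval (Real.cos φ) : ℝ) : ℂ) := by
  have hpow : ∀ (k : ℕ) (θ : ℝ), ((Real.cos θ ^ k : ℝ) : ℂ) =
      ∑ j ∈ Finset.range (k + 1), ((k.choose j : ℂ) / 2 ^ k) * expMode (2 * j - k) θ := by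
    intro k θ
    push_cast
    rw [Complex.cos, div_pow, add_pow, Finset.sum_div]
    refine Finset.sum_congr rfl fun j hj => ?_
    have hjk : j ≤ k := Nat.lt_succ_iff.mp (Finset.mem_range.mp hj)
    rw [← Complex.exp_nat_mul, ← Complex.exp_nat_mul, ← Complex.exp_add, expMode]
    rw [Nat.cast_sub hjk]
    have : (j : ℂ) * (θ * Complex.I) + (k - j) * (-θ * Complex.I) =
      ((2 * j - k : ℤ) : ℂ) * θ * Complex.I := by push_cast; ring
    rw [this]; ring
  have hmon : ∀ k : ℕ, k ≤ N →
      ∑ i ∈ Finset.range (6 * N), ((Real.cos (τ + 2 * Real.pi * i / (6 * N : ℕ)) ^ k : ℝ) : ℂ) *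
      (dirichlet N (φ - (τ + 2 * Real.pi * i / (6 * N : ℕ))) *
        dirichlet (2 * N) (φ - (τ + 2 * Real.pi * i / (6 * N : ℕ)))) =
      ((6 * N : ℕ) * (2 * N + 1) : ℂ) * ((Real.cos φ ^ k : ℝ) : ℂ) := by
    intro k hk
    simp only [hpow, Finset.sum_mul, Finset.mul_sum]
    rw [Finset.sum_comm]
    refine Finset.sum_congr rfl fun j hj => ?_
    have hjk : j ≤ k := Nat.lt_succ_iff.mp (Finset.mem_range.mp hj)
    have := sum_expMode_mul_kernel N hN τ φ (2 * j - k) (by rw [abs_le]; omega)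
    simp only [mul_assoc, ← Finset.mul_sum] at this ⊢
    rw [this]
    ring
  simp only [eval_eq_sum_range' (Nat.lt_succ_of_le hf)]
  push_cast
  simp only [Finset.sum_mul, Finset.mul_sum]
  rw [Finset.sum_comm]
  refine Finset.sum_congr rfl fun k hk => ?_
  have := hmon k (Nat.lt_succ_iff.mp (Finset.mem_range.mp hk))
  simp only [mul_assoc, ← Finset.mul_sum] at this ⊢
  push_cast at this
  rw [this]
  ring

open Polynomial in
/-- A polynomial of degree at most `N` is controlled on `[-1,1]`, up to an absolute constant, by
its values at the points `cos θ` with `|sin (N θ)| ≥ 1/2`. -/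
lemma abs_eval_le_of_sin_ge (N : ℕ) (hN : 1 ≤ N) (f : ℝ[X]) (hf : f.natDegree ≤ N) (B : ℝ)
    (hfB : ∀ θ : ℝ, 1 / 2 ≤ |Real.sin (N * θ)| → |f.eval (Real.cos θ)| ≤ B) (φ : ℝ) :
    |f.eval (Real.cos φ)| ≤ 2 * B := by
  have hpi := Real.pi_pos
  have hN0 : (0 : ℝ) < N := by exact_mod_cast hN
  -- with `τ = π / (6 N)` all the `6 N` equally spaced nodes satisfy `|sin (N θ)| ≥ 1/2`
  set τ : ℝ := Real.pi / (6 * N) with hτ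
  have hgood : ∀ i : ℕ, 1 / 2 ≤ |Real.sin (N * (τ + 2 * Real.pi * i / (6 * N : ℕ)))| := by
    intro i
    have e : N * (τ + 2 * Real.pi * i / (6 * N : ℕ)) =
        (Real.pi / 6 + (i % 3 : ℕ) * (Real.pi / 3)) + (i / 3 : ℕ) * Real.pi := by
      have : (i : ℝ) = (i % 3 : ℕ) + 3 * (i / 3 : ℕ) := by exact_mod_cast (Nat.mod_add_div i 3).symm
      rw [hτ]
      push_cast
      field_simp
      rw [this]
      ring
    rw [e, Real.sin_add_nat_mul_pi, abs_mul, abs_pow, abs_neg, abs_one, one_pow, one_mul]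
    have h3 : i % 3 < 3 := Nat.mod_lt _ (by norm_num)
    have hc : i % 3 = 0 ∨ i % 3 = 1 ∨ i % 3 = 2 := by omega
    rcases hc with h | h | h <;> rw [h]
    · simp [Real.sin_pi_div_six]
    · rw [show Real.pi / 6 + (1 : ℕ) * (Real.pi / 3) = Real.pi / 2 by push_cast; ring]
      simp; norm_num
    · rw [show Real.pi / 6 + (2 : ℕ) * (Real.pi / 3) = Real.pi - Real.pi / 6 by push_cast; ring,
        Real.sin_pi_sub, Real.sin_pi_div_six]
      norm_num
  have hB : 0 ≤ B := (abs_nonneg _).trans (hfB _ (hgood 0))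
  have hrep := congrArg norm (eval_cos_eq_sum_kernel N hN τ φ f hf)
  rw [norm_mul, Complex.norm_real, Real.norm_eq_abs] at hrep
  have hconst : ‖((6 * N : ℕ) * (2 * N + 1) : ℂ)‖ = (6 * N : ℕ) * (2 * N + 1) := by
    have : ((6 * N : ℕ) * (2 * N + 1) : ℂ) = (((6 * N : ℕ) * (2 * N + 1) : ℝ) : ℂ) := by
      push_cast; rfl
    rw [this, Complex.norm_real, Real.norm_eq_abs, abs_of_nonneg (by positivity)]
  rw [hconst] at hrep
  set t : ℕ → ℝ := fun i => τ + 2 * Real.pi * i / (6 * N : ℕ) with ht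
  have hle : ‖∑ i ∈ Finset.range (6 * N), ((f.eval (Real.cos (t i)) : ℝ) : ℂ) *
      (dirichlet N (φ - t i) * dirichlet (2 * N) (φ - t i))‖ ≤
      ∑ i ∈ Finset.range (6 * N), B / 2 * (‖dirichlet N (φ - t i)‖ ^ 2 +
        ‖dirichlet (2 * N) (φ - t i)‖ ^ 2) := by
    refine (norm_sum_le _ _).trans (Finset.sum_le_sum fun i _ => ?_)
    rw [norm_mul, norm_mul, Complex.norm_real, Real.norm_eq_abs]
    have h1 := hfB _ (hgood i)
    have h2 := two_mul_le_add_sq ‖dirichlet N (φ - t i)‖ ‖dirichlet (2 * N) (φ - t i)‖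
    calc _ ≤ B * (‖dirichlet N (φ - t i)‖ * ‖dirichlet (2 * N) (φ - t i)‖) := by gcongr
      _ ≤ _ := by nlinarith
  rw [hrep, ← Finset.mul_sum, Finset.sum_add_distrib, sum_norm_dirichlet_sq _ _ (by omega),
    sum_norm_dirichlet_sq _ _ (by omega)] at hle
  push_cast at hle
  have h6 : (0 : ℝ) < 6 * N * (2 * N + 1) := by positivity
  have : 6 * N * (2 * N + 1) * |f.eval (Real.cos φ)| ≤ 6 * N * (2 * N + 1) * (2 * B) := by
    refine hle.trans ?_
    have : 0 ≤ B * N * N := by positivity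
    have : 0 ≤ B * N := by positivity
    nlinarith
  exact le_of_mul_le_mul_left this h6

/-! ### The Padua points and their generating curve -/

lemma polynomial_eval_aeval {σ : Type*} (g : σ → Polynomial ℝ) (p : MvPolynomial σ ℝ) (t : ℝ) :
    (MvPolynomial.aeval g p).eval t = MvPolynomial.eval (fun i => (g i).eval t) p := by
  induction p using MvPolynomial.induction_on with
  | C a => simp
  | add p q hp hq => simp [hp, hq]
  | mul_X p i hp => simp [hp]

/-- Every `cos (kπ/N)` is a Chebyshev-Lobatto point whose index has the parity of `k`. -/
lemma exists_lobatto_index (N : ℕ) (hN : 1 ≤ N) (k : ℕ) :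
    ∃ j < N + 1, (Even j ↔ Even k) ∧ Real.cos (j * Real.pi / N) = Real.cos (k * Real.pi / N) := by
  have hN0 : (N : ℝ) ≠ 0 := by exact_mod_cast (by omega : N ≠ 0)
  have hk : (k : ℝ) = (k % (2 * N) : ℕ) + (2 * N) * (k / (2 * N) : ℕ) := by
    exact_mod_cast (Nat.mod_add_div k (2 * N)).symm
  have hcos : Real.cos (k * Real.pi / N) = Real.cos ((k % (2 * N) : ℕ) * Real.pi / N) := by
    have : k * Real.pi / N =
        (k % (2 * N) : ℕ) * Real.pi / N + (k / (2 * N) : ℕ) * (2 * Real.pi) := by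
      conv_lhs => rw [hk]
      field_simp
    rw [this, Real.cos_add_nat_mul_two_pi]
  have hpar : Even (k % (2 * N)) ↔ Even k := by
    rw [Nat.even_iff, Nat.even_iff, Nat.mod_mul_right_mod]
  have hr : k % (2 * N) < 2 * N := Nat.mod_lt _ (by omega)
  rcases le_or_gt (k % (2 * N)) N with h | h
  · exact ⟨_, by omega, hpar, hcos.symm⟩
  · refine ⟨2 * N - k % (2 * N), by omega, ?_, ?_⟩
    · rw [← hpar, Nat.even_sub hr.le]
      simp
    · rw [hcos, Nat.cast_sub hr.le]
      have : ((2 * N : ℕ) - (k % (2 * N) : ℕ) : ℝ) * Real.pi / N =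
          2 * Real.pi - (k % (2 * N) : ℕ) * Real.pi / N := by
        push_cast; field_simp
      rw [this, Real.cos_two_pi_sub]

/-- The point with parameter `kπ/(N(N+1))` of the generating curve is a Padua point, when `N` is
even. -/
lemma generating_curve_mem_padua (N : ℕ) (hN : 1 ≤ N) (hev : Even N) (k : ℕ) :
    ![Real.cos (k * Real.pi / N), -Real.cos (k * Real.pi / (N + 1 : ℕ))] ∈ padua N := by
  obtain ⟨j, hj, hpar, hcos⟩ := exists_lobatto_index N hN k
  obtain ⟨j', hj', hpar', hcos'⟩ := exists_lobatto_index (N + 1) (by omega) (k + (N + 1))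
  have hneg : Real.cos ((k + (N + 1) : ℕ) * Real.pi / (N + 1 : ℕ)) =
      -Real.cos (k * Real.pi / (N + 1 : ℕ)) := by
    rw [← Real.cos_add_pi]
    congr 1
    push_cast
    field_simp
  rw [hneg] at hcos'
  rw [padua, Finset.mem_image]
  refine ⟨(Real.cos (k * Real.pi / N), -Real.cos (k * Real.pi / (N + 1 : ℕ))), ?_, rfl⟩
  rw [Finset.mem_union, Finset.mem_product, Finset.mem_product]
  have hpar'' : Even j' ↔ ¬ Even k := by
    rw [hpar', Nat.even_add, Nat.even_add_one]
    tauto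
  by_cases hk : Even k
  · right
    refine ⟨Finset.mem_image.mpr ⟨j, ?_, hcos⟩, Finset.mem_image.mpr ⟨j', ?_, hcos'⟩⟩
    · simp [hj, hpar, hk]
    · simp only [Finset.mem_filter, Finset.mem_range]
      exact ⟨hj', Nat.not_even_iff_odd.mp (by tauto)⟩
  · left
    refine ⟨Finset.mem_image.mpr ⟨j, ?_, hcos⟩, Finset.mem_image.mpr ⟨j', ?_, hcos'⟩⟩
    · simp only [Finset.mem_filter, Finset.mem_range]
      exact ⟨hj, Nat.not_even_iff_odd.mp (by tauto)⟩
    · simp only [Finset.mem_filter, Finset.mem_range]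
      exact ⟨hj', by tauto⟩

/-- The norming constants of the Padua points of degree `2 n`. -/
noncomputable def paduaConst (n : ℕ) : ℝ :=
  2 * (4 * (3 + Real.log (2 * n + 1 : ℕ)) * (2 * (3 + Real.log (2 * (2 * n * (2 * n + 1) : ℕ)))))

/-- A polynomial of degree at most `N` on the generating curve is a one-variable polynomial of
degree at most `N (N + 1)` in `cos t`, sampled by the Padua points at Chebyshev-Lobatto points. -/
lemma abs_eval_generating_curve_le (N : ℕ) (hN : 1 ≤ N) (hev : Even N)
    (p : MvPolynomial (Fin 2) ℝ) (hp : p.totalDegree ≤ N) (B : ℝ)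
    (hB : ∀ x ∈ padua N, |MvPolynomial.eval x p| ≤ B) (t : ℝ) :
    |MvPolynomial.eval ![Real.cos ((N + 1 : ℕ) * t), -Real.cos (N * t)] p| ≤
      2 * (3 + Real.log (2 * (N * (N + 1) : ℕ))) * B := by
  have hN0 : (N : ℝ) ≠ 0 := by exact_mod_cast (by omega : N ≠ 0)
  set g : Fin 2 → Polynomial ℝ :=
    ![Polynomial.Chebyshev.T ℝ (N + 1 : ℕ), -Polynomial.Chebyshev.T ℝ N] with hg
  have heval : ∀ t, (MvPolynomial.aeval g p).eval (Real.cos t) =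
      MvPolynomial.eval ![Real.cos ((N + 1 : ℕ) * t), -Real.cos (N * t)] p := by
    intro t
    rw [polynomial_eval_aeval]
    congr 1
    congr 1
    funext i
    fin_cases i
    · simp only [hg, Fin.zero_eta, Matrix.cons_val_zero, Polynomial.Chebyshev.T_real_cos]
      push_cast; rfl
    · simp [hg, Polynomial.Chebyshev.T_real_cos]
  rw [← heval]
  refine abs_eval_le_of_lobatto (N * (N + 1)) (by nlinarith) _
    (MvPolynomial.aeval_natDegree_le p hp g ?_) B ?_ t
  · intro i
    fin_cases i
    · simp only [hg, Fin.zero_eta, Matrix.cons_val_zero, Polynomial.Chebyshev.natDegree_T]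
      rw [Int.natAbs_natCast]
    · simp [hg, Polynomial.Chebyshev.natDegree_T]
  · intro k _
    rw [heval]
    have h1 : ((N + 1 : ℕ) : ℝ) * (k * Real.pi / (N * (N + 1) : ℕ)) = k * Real.pi / N := by
      push_cast; field_simp
    have h2 : (N : ℝ) * (k * Real.pi / (N * (N + 1) : ℕ)) = k * Real.pi / (N + 1 : ℕ) := by
      push_cast; field_simp
    rw [h1, h2]
    exact hB _ (generating_curve_mem_padua N hN hev k)

/-- The Padua points of degree `2 n` are a norming set of the square for polynomials of degree at
most `2 n`. -/
lemma abs_eval_le_of_padua (n : ℕ) (hn : 1 ≤ n) (p : MvPolynomial (Fin 2) ℝ)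
    (hp : p.totalDegree ≤ 2 * n) (B : ℝ)
    (hB : ∀ x ∈ padua (2 * n), |MvPolynomial.eval x p| ≤ B) (z : Fin 2 → ℝ) (hz : z ∈ square) :
    |MvPolynomial.eval z p| ≤ paduaConst n * B := by
  set N := 2 * n with hNdef
  have hN : 1 ≤ N := by omega
  have hev : Even N := ⟨n, by omega⟩
  have hcurve := abs_eval_generating_curve_le N hN hev p hp B hB
  set B' := 2 * (3 + Real.log (2 * (N * (N + 1) : ℕ))) * B with hB'
  -- away from the tangencies of the curve, a vertical line meets the curve in a
  -- well-separated level set of `T_{N+1}`.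
  have hline : ∀ θ : ℝ, 1 / 2 ≤ |Real.sin (N * θ)| → ∀ φ : ℝ,
      |MvPolynomial.eval ![Real.cos θ, Real.cos φ] p| ≤ 4 * (3 + Real.log (N + 1 : ℕ)) * B' := by
    intro θ hθ φ
    set g : Fin 2 → Polynomial ℝ := ![Polynomial.C (Real.cos θ), Polynomial.X] with hg
    have heval : ∀ y, (MvPolynomial.aeval g p).eval y = MvPolynomial.eval ![Real.cos θ, y] p := by
      intro y
      rw [polynomial_eval_aeval]
      congr 1
      congr 1
      funext i
      fin_cases i <;> simp [hg]
    have hdeg := MvPolynomial.aeval_natDegree_le p hp g (n := 1)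
      (by intro i; fin_cases i <;> simp [hg])
    rw [← heval]
    refine abs_eval_le_of_level_set (N + 1) (by omega) (N * θ + Real.pi) ?_ _ ?_ B' ?_ φ
    · rwa [Real.sin_add_pi, abs_neg]
    · refine lt_of_le_of_lt Polynomial.degree_le_natDegree ?_
      exact_mod_cast (by omega : (MvPolynomial.aeval g p).natDegree < N + 1)
    · intro ψ hψ
      rw [heval]
      have h1 : Real.cos (N * θ) = Real.cos ((N + 1 : ℕ) * (Real.pi - ψ)) := by
        have : ((N + 1 : ℕ) : ℝ) * (Real.pi - ψ) =
            Real.pi - (N + 1 : ℕ) * ψ + n * (2 * Real.pi) := by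
          rw [hNdef]; push_cast; ring
        rw [this, Real.cos_add_nat_mul_two_pi, Real.cos_pi_sub, hψ, Real.cos_add_pi, neg_neg]
      rw [Real.cos_eq_cos_iff] at h1
      have hpt : ∃ t, Real.cos ((N + 1 : ℕ) * t) = Real.cos θ ∧ -Real.cos (N * t) = Real.cos ψ := by
        obtain ⟨k, hk | hk⟩ := h1
        · refine ⟨θ - (Real.pi - ψ), ?_, ?_⟩
          · rw [show ((N + 1 : ℕ) : ℝ) * (θ - (Real.pi - ψ)) = θ - k * (2 * Real.pi) by
              rw [mul_sub, hk]; push_cast; ring, Real.cos_sub_int_mul_two_pi]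
          · rw [show (N : ℝ) * (θ - (Real.pi - ψ)) = (Real.pi - ψ) - k * (2 * Real.pi) by
              push_cast at hk; linear_combination -hk, Real.cos_sub_int_mul_two_pi,
              Real.cos_pi_sub, neg_neg]
        · refine ⟨-θ - (Real.pi - ψ), ?_, ?_⟩
          · rw [show ((N + 1 : ℕ) : ℝ) * (-θ - (Real.pi - ψ)) = -θ - k * (2 * Real.pi) by
              rw [mul_sub, hk]; push_cast; ring, Real.cos_sub_int_mul_two_pi, Real.cos_neg]
          · rw [show (N : ℝ) * (-θ - (Real.pi - ψ)) = (Real.pi - ψ) - k * (2 * Real.pi) by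
              push_cast at hk; linear_combination -hk, Real.cos_sub_int_mul_two_pi,
              Real.cos_pi_sub, neg_neg]
      obtain ⟨t, ht1, ht2⟩ := hpt
      rw [← ht1, ← ht2]
      exact hcurve t
  -- the remaining vertical lines are reached along the horizontal direction
  have hz0 := hz 0
  have hz1 := hz 1
  set g : Fin 2 → Polynomial ℝ := ![Polynomial.X, Polynomial.C (z 1)] with hg
  have heval : ∀ x, (MvPolynomial.aeval g p).eval x = MvPolynomial.eval ![x, z 1] p := by
    intro x
    rw [polynomial_eval_aeval]
    congr 1
    congr 1
    funext i
    fin_cases i <;> simp [hg]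
  have hdeg := MvPolynomial.aeval_natDegree_le p hp g (n := 1)
    (by intro i; fin_cases i <;> simp [hg])
  have hcos1 : Real.cos (Real.arccos (z 1)) = z 1 := Real.cos_arccos hz1.1 hz1.2
  have hfin := abs_eval_le_of_sin_ge N hN (MvPolynomial.aeval g p) (by simpa using hdeg)
    (4 * (3 + Real.log (N + 1 : ℕ)) * B') (fun θ hθ => by
      rw [heval, ← hcos1]; exact hline θ hθ _) (Real.arccos (z 0))
  rw [Real.cos_arccos hz0.1 hz0.2, heval] at hfin
  have hzz : ![z 0, z 1] = z := by funext i; fin_cases i <;> rfl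
  rw [hzz] at hfin
  refine hfin.trans (le_of_eq ?_)
  rw [hB', paduaConst, hNdef]
  ring

lemma paduaConst_nonneg (n : ℕ) : 0 ≤ paduaConst n := by
  have h1 := Real.log_natCast_nonneg (2 * n + 1)
  have h2 := Real.log_natCast_nonneg (2 * (2 * n * (2 * n + 1)))
  have h3 : ((2 * (2 * n * (2 * n + 1)) : ℕ) : ℝ) = 2 * ((2 * n * (2 * n + 1) : ℕ) : ℝ) := by
    push_cast; ring
  rw [h3] at h2
  unfold paduaConst
  positivity

lemma paduaConst_isBigO : paduaConst =O[atTop] (fun n : ℕ => Real.log (n : ℝ) ^ 2) := by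
  refine IsBigO.of_bound (2 * (4 * 8 * (2 * 11))) ?_
  filter_upwards [eventually_ge_atTop 2] with n hn
  have hn2 : (2 : ℝ) ≤ n := by exact_mod_cast hn
  rw [Real.norm_of_nonneg (paduaConst_nonneg n), Real.norm_of_nonneg (by positivity)]
  have hl2 : Real.log 2 ≤ Real.log n := Real.log_le_log (by norm_num) hn2
  have := Real.log_two_gt_d9
  have h1 : Real.log (2 * n + 1 : ℕ) ≤ 3 * Real.log n := by
    rw [← Real.log_rpow (by linarith)]
    apply Real.log_le_log (by positivity)
    push_cast
    norm_cast
    nlinarith [mul_le_mul' hn hn]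
  have h2 : Real.log (2 * (2 * n * (2 * n + 1) : ℕ)) ≤ 6 * Real.log n := by
    rw [← Real.log_rpow (by linarith)]
    apply Real.log_le_log (by push_cast; positivity)
    norm_cast
    have h4 : 2 ^ 4 ≤ n ^ 4 := Nat.pow_le_pow_left hn 4
    have h6 : n ^ 6 = n ^ 4 * n ^ 2 := by ring
    rw [h6]
    nlinarith
  have h3 := Real.log_natCast_nonneg (2 * n + 1)
  have h4 := Real.log_natCast_nonneg (2 * (2 * n * (2 * n + 1)))
  have h5 : ((2 * (2 * n * (2 * n + 1)) : ℕ) : ℝ) = 2 * ((2 * n * (2 * n + 1) : ℕ) : ℝ) := by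
    push_cast; ring
  rw [h5] at h4
  have hL : 0 ≤ Real.log n := by linarith
  calc paduaConst n ≤ 2 * (4 * (8 * Real.log n) * (2 * (11 * Real.log n))) := by
        unfold paduaConst
        gcongr <;> linarith
    _ = _ := by ring

/-! ### Triangles in coordinates -/

/-- Twice the signed area of the triangle `x y z`. -/
def area (x y z : Fin 2 → ℝ) : ℝ :=
  (y 0 - x 0) * (z 1 - x 1) - (y 1 - x 1) * (z 0 - x 0)

lemma affineIndependent_iff_area_ne_zero (p : Fin 3 → Fin 2 → ℝ) :
    AffineIndependent ℝ p ↔ area (p 0) (p 1) (p 2) ≠ 0 := by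
  rw [affineIndependent_iff]
  constructor
  · intro h hA
    have key : ∀ a b c : ℝ, a + b + c = 0 → a * p 0 0 + b * p 1 0 + c * p 2 0 = 0 →
        a * p 0 1 + b * p 1 1 + c * p 2 1 = 0 → a = 0 ∧ b = 0 ∧ c = 0 := by
      intro a b c h1 h2 h3
      have := h Finset.univ ![a, b, c] (by simpa [Fin.sum_univ_three] using h1) (by
        funext i
        fin_cases i
        · simpa [Fin.sum_univ_three] using h2
        · simpa [Fin.sum_univ_three] using h3)
      exact ⟨this 0 (Finset.mem_univ _), this 1 (Finset.mem_univ _), this 2 (Finset.mem_univ _)⟩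
    unfold area at hA
    obtain ⟨-, h1, h2⟩ := key (-(p 2 1 - p 0 1) + (p 1 1 - p 0 1)) (p 2 1 - p 0 1)
      (-(p 1 1 - p 0 1)) (by ring) (by linear_combination hA) (by ring)
    obtain ⟨-, h3, h4⟩ := key (-(p 2 0 - p 0 0) + (p 1 0 - p 0 0)) (p 2 0 - p 0 0)
      (-(p 1 0 - p 0 0)) (by ring) (by ring) (by linear_combination -hA)
    obtain ⟨-, h5, -⟩ := key (-1) 1 0 (by ring) (by linarith) (by linarith)
    exact one_ne_zero h5
  · intro hA s w hw hsum
    set w' : Fin 3 → ℝ := fun i => if i ∈ s then w i else 0 with hw'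
    have e1 : w' 0 + w' 1 + w' 2 = 0 := by
      rw [← Fin.sum_univ_three, ← hw]
      simp [hw', Finset.sum_ite_mem]
    have e2 : ∀ j, w' 0 * p 0 j + w' 1 * p 1 j + w' 2 * p 2 j = 0 := by
      intro j
      have := congrFun hsum j
      rw [← Fin.sum_univ_three (fun i => w' i * p i j)]
      simpa [hw', Finset.sum_ite_mem, ite_mul] using this
    have e20 := e2 0
    have e21 := e2 1
    unfold area at hA
    have f1 : w' 1 = 0 := by
      apply (mul_eq_zero.mp (_ : w' 1 * _ = 0)).resolve_right hA
      linear_combination (p 2 1 - p 0 1) * e20 - (p 2 0 - p 0 0) * e21 -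
        (p 2 1 * p 0 0 - p 2 0 * p 0 1) * e1
    have f2 : w' 2 = 0 := by
      apply (mul_eq_zero.mp (_ : w' 2 * _ = 0)).resolve_right hA
      linear_combination -(p 1 1 - p 0 1) * e20 + (p 1 0 - p 0 0) * e21 +
        (p 1 1 * p 0 0 - p 1 0 * p 0 1) * e1
    have f0 : w' 0 = 0 := by linarith
    intro i hi
    have : w' i = 0 := by fin_cases i <;> assumption
    simpa [hw', hi] using this

lemma area_points_ne_zero (T : Affine.Triangle ℝ (Fin 2 → ℝ)) :
    area (T.points 0) (T.points 1) (T.points 2) ≠ 0 :=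
  (affineIndependent_iff_area_ne_zero T.points).mp T.independent

/-- The closed triangle as the set of points with nonnegative barycentric coordinates. -/
lemma mem_triangleSet_iff (T : Affine.Triangle ℝ (Fin 2 → ℝ)) (x : Fin 2 → ℝ) :
    x ∈ triangleSet T ↔ ∃ a b : ℝ, 0 ≤ a ∧ 0 ≤ b ∧ a + b ≤ 1 ∧
      x = a • (T.points 1 - T.points 0) + b • (T.points 2 - T.points 0) + T.points 0 := by
  rw [triangleSet]
  constructor
  · intro hx
    rw [← Set.image_univ, ← Finset.coe_univ, ← Finset.coe_image, Finset.mem_convexHull'] at hx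
    obtain ⟨w, hw0, hw1, hwx⟩ := hx
    rw [Finset.sum_image (fun i _ j _ h => T.independent.injective h)] at hw1 hwx
    replace hw1 : ∑ i : Fin 3, w (T.points i) = 1 := hw1
    replace hwx : ∑ i : Fin 3, w (T.points i) • T.points i = x := hwx
    rw [Fin.sum_univ_three] at hw1 hwx
    have := fun i => hw0 (T.points i) (Finset.mem_image_of_mem _ (Finset.mem_univ i))
    refine ⟨w (T.points 1), w (T.points 2), this 1, this 2, by linarith [this 0], ?_⟩
    rw [← hwx]
    have h0 : w (T.points 0) = 1 - w (T.points 1) - w (T.points 2) := by linarith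
    rw [h0]
    module
  · rintro ⟨a, b, ha, hb, hab, rfl⟩
    have hc := convex_convexHull ℝ (Set.range T.points)
    have hm := fun i => subset_convexHull ℝ _ (Set.mem_range_self (f := T.points) i)
    have := hc.sum_mem (t := Finset.univ) (w := ![1 - a - b, a, b]) (z := T.points)
      (by intro i _; fin_cases i <;> simp <;> linarith) (by simp [Fin.sum_univ_succ])
      (fun i _ => hm i)
    replace this : ∑ i : Fin 3, (![1 - a - b, a, b] : Fin 3 → ℝ) i • T.points i ∈
      convexHull ℝ (Set.range T.points) := this
    rw [Fin.sum_univ_three] at this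
    convert this using 1
    simp only [Matrix.cons_val]
    module

/-! ### The Duffy map -/

lemma duffy_image_square (T : Affine.Triangle ℝ (Fin 2 → ℝ)) :
    duffy T '' square = triangleSet T := by
  ext x
  rw [mem_triangleSet_iff]
  constructor
  · rintro ⟨y, hy, rfl⟩
    obtain ⟨h1, h2⟩ := hy 0
    obtain ⟨h3, h4⟩ := hy 1
    refine ⟨_, _, ?_, ?_, ?_, rfl⟩
    · have : 0 ≤ (1 + y 0) * (1 - y 1) := mul_nonneg (by linarith) (by linarith)
      linarith
    · linarith
    · nlinarith
  · rintro ⟨a, b, ha, hb, hab, rfl⟩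
    rcases (show b ≤ 1 by linarith).lt_or_eq with hb1 | hb1
    · have h1b : 0 < 1 - b := by linarith
      refine ⟨![2 * (a / (1 - b)) - 1, 2 * b - 1], ?_, ?_⟩
      · intro i
        have h0 : 0 ≤ a / (1 - b) := by positivity
        have h1 : a / (1 - b) ≤ 1 := by rw [div_le_one h1b]; linarith
        fin_cases i
        · constructor <;> simp <;> linarith
        · constructor <;> simp <;> linarith
      · simp only [duffy, Matrix.cons_val_zero, Matrix.cons_val_one]
        congr 3
        · field_simp; ring
        · ring
    · refine ⟨![0, 1], ?_, ?_⟩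
      · intro i; fin_cases i <;> constructor <;> simp
      · have ha0 : a = 0 := by linarith
        simp [duffy, ha0, hb1]
        norm_num

open MvPolynomial in
/-- The coordinates of the Duffy map as polynomials. -/
noncomputable def duffyPoly (T : Affine.Triangle ℝ (Fin 2 → ℝ)) (i : Fin 2) :
    MvPolynomial (Fin 2) ℝ :=
  C (1 / 4 * (T.points 1 i - T.points 0 i)) * ((C 1 + X 0) * (C 1 - X 1))
    + C (1 / 2 * (T.points 2 i - T.points 0 i)) * (C 1 + X 1) + C (T.points 0 i)

open MvPolynomial in
lemma eval_duffyPoly (T : Affine.Triangle ℝ (Fin 2 → ℝ)) (y : Fin 2 → ℝ) (i : Fin 2) :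
    eval y (duffyPoly T i) = duffy T y i := by
  simp [duffyPoly, duffy]
  ring

open MvPolynomial in
lemma totalDegree_duffyPoly (T : Affine.Triangle ℝ (Fin 2 → ℝ)) (i : Fin 2) :
    (duffyPoly T i).totalDegree ≤ 2 := by
  have hX : ∀ j : Fin 2, (C 1 + X j : MvPolynomial (Fin 2) ℝ).totalDegree ≤ 1 := fun j =>
    (totalDegree_add _ _).trans (by simp)
  have hX' : ∀ j : Fin 2, (C 1 - X j : MvPolynomial (Fin 2) ℝ).totalDegree ≤ 1 := fun j =>
    (totalDegree_sub _ _).trans (by simp)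
  refine (totalDegree_add _ _).trans (max_le ((totalDegree_add _ _).trans (max_le ?_ ?_)) (by simp))
  · refine (totalDegree_mul _ _).trans ?_
    have := totalDegree_mul (C 1 + X 0 : MvPolynomial (Fin 2) ℝ) (C 1 - X 1)
    have := hX 0
    have := hX' 1
    rw [totalDegree_C]
    omega
  · refine (totalDegree_mul _ _).trans ?_
    have := hX 1
    rw [totalDegree_C]
    omega

open MvPolynomial in
lemma totalDegree_aeval_le {σ τ : Type*} (g : σ → MvPolynomial τ ℝ) (d : ℕ)
    (hg : ∀ i, (g i).totalDegree ≤ d) (p : MvPolynomial σ ℝ) :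
    (aeval g p).totalDegree ≤ p.totalDegree * d := by
  rw [aeval_def, eval₂_eq]
  refine totalDegree_finsetSum_le fun m hm => ?_
  refine (totalDegree_mul _ _).trans ?_
  rw [algebraMap_eq, totalDegree_C, zero_add]
  refine (totalDegree_finsetProd _ _).trans ?_
  calc ∑ i ∈ m.support, (g i ^ m i).totalDegree ≤ ∑ i ∈ m.support, m i * d :=
        Finset.sum_le_sum fun i _ => (totalDegree_pow _ _).trans (Nat.mul_le_mul_left _ (hg i))
    _ = (∑ i ∈ m.support, m i) * d := by rw [Finset.sum_mul]
    _ ≤ _ := Nat.mul_le_mul_right _ (le_totalDegree hm)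

open MvPolynomial in
lemma eval_aeval_duffyPoly (T : Affine.Triangle ℝ (Fin 2 → ℝ)) (p : MvPolynomial (Fin 2) ℝ)
    (y : Fin 2 → ℝ) : eval y (aeval (duffyPoly T) p) = eval (duffy T y) p := by
  induction p using MvPolynomial.induction_on with
  | C a => simp
  | add p q hp hq => rw [map_add, map_add, hp, hq, map_add]
  | mul_X p i hp => rw [map_mul, map_mul, hp, aeval_X, eval_duffyPoly, map_mul, eval_X]

/-! ### Counting the mesh points -/

lemma lobatto_injOn (N : ℕ) (hN : 1 ≤ N) :
    Set.InjOn (fun j : ℕ => Real.cos ((j : ℝ) * Real.pi / (N : ℝ))) (Finset.range (N + 1)) := by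
  have hpi := Real.pi_pos
  have hN0 : (0 : ℝ) < N := by exact_mod_cast hN
  have hmem : ∀ k ∈ Finset.range (N + 1), (k : ℝ) * Real.pi / N ∈ Set.Icc 0 Real.pi := by
    intro k hk
    have hk' : (k : ℝ) ≤ N := by exact_mod_cast Nat.lt_succ_iff.mp (Finset.mem_range.mp hk)
    refine ⟨by positivity, ?_⟩
    rw [div_le_iff₀ hN0]
    nlinarith
  intro k hk l hl h
  have := Real.injOn_cos (hmem k hk) (hmem l hl) h
  field_simp at this
  exact_mod_cast this

lemma card_filter_parity (n : ℕ) :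
    ((Finset.range (2 * n)).filter Odd).card = n ∧
      ((Finset.range (2 * n)).filter Even).card = n := by
  induction n with
  | zero => simp
  | succ k ih =>
    have h : 2 * (k + 1) = 2 * k + 1 + 1 := by ring
    have he : Even (2 * k) := even_two_mul k
    have ho : ¬ Odd (2 * k) := Nat.not_odd_iff_even.mpr he
    have ho1 : Odd (2 * k + 1) := odd_two_mul_add_one k
    have he1 : ¬ Even (2 * k + 1) := Nat.not_even_iff_odd.mpr ho1
    rw [h, Finset.range_add_one, Finset.range_add_one]
    simp only [Finset.filter_insert, he, ho, ho1, he1, if_true, if_false]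
    rw [Finset.card_insert_of_notMem (by simp), Finset.card_insert_of_notMem (by simp)]
    omega

lemma card_cheb (N : ℕ) (hN : 1 ≤ N) :
    (chebOdd N).card = ((Finset.range (N + 1)).filter Odd).card ∧
      (chebEven N).card = ((Finset.range (N + 1)).filter Even).card := by
  constructor <;>
  · refine Finset.card_image_of_injOn ((lobatto_injOn N hN).mono ?_)
    exact_mod_cast Finset.filter_subset _ _

lemma card_cheb_two_mul (n : ℕ) (hn : 1 ≤ n) :
    (chebOdd (2 * n)).card = n ∧ (chebEven (2 * n)).card = n + 1 ∧
      (chebOdd (2 * n + 1)).card = n + 1 ∧ (chebEven (2 * n + 1)).card = n + 1 := by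
  obtain ⟨h1, h2⟩ := card_cheb (2 * n) (by omega)
  obtain ⟨h3, h4⟩ := card_cheb (2 * n + 1) (by omega)
  obtain ⟨h5, h6⟩ := card_filter_parity n
  obtain ⟨h7, h8⟩ := card_filter_parity (n + 1)
  rw [show 2 * (n + 1) = 2 * n + 1 + 1 by ring] at h7 h8
  refine ⟨?_, ?_, by rw [h3, h7], by rw [h4, h8]⟩
  · rw [h1, Finset.range_add_one, Finset.filter_insert, if_neg (by simp), h5]
  · rw [h2, Finset.range_add_one, Finset.filter_insert, if_pos (by simp),
      Finset.card_insert_of_notMem (by simp), h6]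

lemma disjoint_cheb (N : ℕ) (hN : 1 ≤ N) : Disjoint (chebOdd N) (chebEven N) := by
  rw [Finset.disjoint_left]
  intro x hx hx'
  rw [chebOdd, Finset.mem_image] at hx
  rw [chebEven, Finset.mem_image] at hx'
  obtain ⟨j, hj, rfl⟩ := hx
  obtain ⟨k, hk, hjk⟩ := hx'
  rw [Finset.mem_filter] at hj hk
  have := lobatto_injOn N hN hk.1 hj.1 hjk
  subst this
  exact (Nat.not_odd_iff_even.mpr hk.2) hj.2

lemma one_mem_chebEven (N : ℕ) : (1 : ℝ) ∈ chebEven N := by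
  rw [chebEven, Finset.mem_image]
  exact ⟨0, by simp, by simp⟩

lemma duffy_eq_iff (T : Affine.Triangle ℝ (Fin 2 → ℝ)) (y z : Fin 2 → ℝ) :
    duffy T y = duffy T z ↔ y 1 = z 1 ∧ (1 + y 0) * (1 - y 1) = (1 + z 0) * (1 - z 1) := by
  constructor
  · intro h
    have hA := area_points_ne_zero T
    have h0 := congrFun h 0
    have h1 := congrFun h 1
    simp only [duffy, Pi.add_apply, Pi.smul_apply, Pi.sub_apply, smul_eq_mul] at h0 h1
    unfold area at hA
    constructor
    · have : (y 1 - z 1) * ((T.points 1 0 - T.points 0 0) * (T.points 2 1 - T.points 0 1) -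
        (T.points 1 1 - T.points 0 1) * (T.points 2 0 - T.points 0 0)) = 0 := by
        linear_combination 2 * (T.points 1 0 - T.points 0 0) * h1 -
          2 * (T.points 1 1 - T.points 0 1) * h0
      have := (mul_eq_zero.mp this).resolve_right hA
      linarith
    · have : ((1 + y 0) * (1 - y 1) - (1 + z 0) * (1 - z 1)) *
        ((T.points 1 0 - T.points 0 0) * (T.points 2 1 - T.points 0 1) -
        (T.points 1 1 - T.points 0 1) * (T.points 2 0 - T.points 0 0)) = 0 := by
        linear_combination -4 * (T.points 2 0 - T.points 0 0) * h1 +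
          4 * (T.points 2 1 - T.points 0 1) * h0
      have := (mul_eq_zero.mp this).resolve_right hA
      linarith
  · rintro ⟨h1, h2⟩
    unfold duffy
    have e : 1 / 4 * (1 + y 0) * (1 - y 1) = 1 / 4 * (1 + z 0) * (1 - z 1) := by linarith
    rw [e, h1]

/-- The Duffy map collapses the side `y₂ = 1` of the square, which carries `n` Padua points, to a
single vertex, and is injective on the other Padua points. -/
lemma card_triangleMesh (T : Affine.Triangle ℝ (Fin 2 → ℝ)) (n : ℕ) (hn : 1 ≤ n) :
    (triangleMesh T n).card = 2 * n ^ 2 + 2 * n + 2 := by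
  obtain ⟨c1, c2, c3, c4⟩ := card_cheb_two_mul n hn
  set O := chebOdd (2 * n)
  set E := chebEven (2 * n)
  set O' := chebOdd (2 * n + 1)
  set E' := chebEven (2 * n + 1)
  have h1E' : (1 : ℝ) ∈ E' := one_mem_chebEven _
  have h1O' : (1 : ℝ) ∉ O' := fun h =>
    Finset.disjoint_left.mp (disjoint_cheb (2 * n + 1) (by omega)) h h1E'
  have hOE : Disjoint O E := disjoint_cheb (2 * n) (by omega)
  set A : Finset (ℝ × ℝ) := O ×ˢ (E'.erase 1) ∪ E ×ˢ O' with hA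
  have hA1 : ∀ z ∈ A, z.2 ≠ 1 := by
    intro z hz h
    rw [hA, Finset.mem_union, Finset.mem_product, Finset.mem_product, h] at hz
    rcases hz with hz | hz
    · simp at hz
    · exact h1O' hz.2
  have hAcard : A.card = 2 * n ^ 2 + 2 * n + 1 := by
    rw [hA, Finset.card_union_of_disjoint, Finset.card_product, Finset.card_product,
      Finset.card_erase_of_mem h1E', c1, c2, c3, c4]
    · rw [Nat.add_sub_cancel]; ring
    · rw [Finset.disjoint_left]
      intro z hz hz'
      rw [Finset.mem_product] at hz hz'
      exact Finset.disjoint_left.mp hOE hz.1 hz'.1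
  set D : ℝ × ℝ → Fin 2 → ℝ := fun z => duffy T ![z.1, z.2] with hD
  have hinj : Set.InjOn D A := by
    intro z hz z' hz' h
    rw [hD] at h
    obtain ⟨h1, h2⟩ := (duffy_eq_iff T _ _).mp h
    simp only [Matrix.cons_val_zero, Matrix.cons_val_one] at h1 h2
    have hz1 := hA1 z' hz'
    rw [h1] at h2
    have h3 : 1 + z.1 = 1 + z'.1 :=
      mul_right_cancel₀ (sub_ne_zero.mpr (Ne.symm hz1)) h2
    exact Prod.ext (by linarith) h1
  have hne : O.Nonempty := by rw [← Finset.card_pos, c1]; omega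
  obtain ⟨o, ho⟩ := hne
  have hmesh : triangleMesh T n = insert (D (o, 1)) (A.image D) := by
    rw [triangleMesh, padua, Finset.image_image]
    ext x
    simp only [Finset.mem_image, Finset.mem_insert, Function.comp]
    constructor
    · rintro ⟨z, hz, rfl⟩
      by_cases h1 : z.2 = 1
      · left
        rw [hD, duffy_eq_iff]
        simp [h1]
      · right
        refine ⟨z, ?_, rfl⟩
        rw [Finset.mem_union, Finset.mem_product, Finset.mem_product] at hz
        rw [hA, Finset.mem_union, Finset.mem_product, Finset.mem_product, Finset.mem_erase]
        tauto
    · rintro (rfl | ⟨z, hz, rfl⟩)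
      · exact ⟨(o, 1), by
          rw [Finset.mem_union, Finset.mem_product]; exact Or.inl ⟨ho, h1E'⟩, rfl⟩
      · refine ⟨z, ?_, rfl⟩
        rw [hA, Finset.mem_union, Finset.mem_product, Finset.mem_product, Finset.mem_erase] at hz
        rw [Finset.mem_union, Finset.mem_product, Finset.mem_product]
        tauto
  rw [hmesh, Finset.card_insert_of_notMem, Finset.card_image_of_injOn hinj, hAcard]
  rw [Finset.mem_image]
  rintro ⟨z, hz, h⟩
  rw [hD] at h
  obtain ⟨h1, -⟩ := (duffy_eq_iff T _ _).mp h
  exact hA1 z hz (by simpa using h1)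

/-! ### Topology of a triangle -/

/-- The barycentric coordinates with respect to the three points `p 0`, `p 1`, `p 2` of the plane,
as quotients of areas. -/
noncomputable def bary (p : Fin 3 → Fin 2 → ℝ) (i : Fin 3) (x : Fin 2 → ℝ) : ℝ :=
  area x (p (i + 1)) (p (i + 2)) / area (p 0) (p 1) (p 2)

lemma continuous_bary (p : Fin 3 → Fin 2 → ℝ) (i : Fin 3) : Continuous (bary p i) := by
  unfold bary area
  fun_prop

lemma bary_sum (p : Fin 3 → Fin 2 → ℝ) (hp : area (p 0) (p 1) (p 2) ≠ 0) (x : Fin 2 → ℝ) :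
    bary p 0 x + bary p 1 x + bary p 2 x = 1 := by
  simp only [bary]
  rw [← add_div, ← add_div, div_eq_one_iff_eq hp]
  simp [area]
  ring

lemma bary_combo (p : Fin 3 → Fin 2 → ℝ) (hp : area (p 0) (p 1) (p 2) ≠ 0) (x : Fin 2 → ℝ) :
    x = bary p 0 x • p 0 + bary p 1 x • p 1 + bary p 2 x • p 2 := by
  funext j
  simp only [Pi.add_apply, Pi.smul_apply, smul_eq_mul, bary]
  rw [div_mul_eq_mul_div, div_mul_eq_mul_div, div_mul_eq_mul_div, ← add_div, ← add_div,
    eq_div_iff hp]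
  fin_cases j
  · simp [area]; ring
  · simp [area]; ring

lemma bary_of_combo (p : Fin 3 → Fin 2 → ℝ) (hp : area (p 0) (p 1) (p 2) ≠ 0) (a b c : ℝ)
    (h : a + b + c = 1) :
    bary p 0 (a • p 0 + b • p 1 + c • p 2) = a ∧ bary p 1 (a • p 0 + b • p 1 + c • p 2) = b ∧
      bary p 2 (a • p 0 + b • p 1 + c • p 2) = c := by
  obtain rfl : a = 1 - b - c := by linarith
  simp only [bary]
  rw [div_eq_iff hp, div_eq_iff hp, div_eq_iff hp]
  refine ⟨?_, ?_, ?_⟩ <;>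
  · simp [area]; ring

/-- Barycentric coordinates are affine. -/
lemma bary_lineMap (p : Fin 3 → Fin 2 → ℝ) (i : Fin 3) (x y : Fin 2 → ℝ) (t : ℝ) :
    bary p i (AffineMap.lineMap x y t) = (1 - t) * bary p i x + t * bary p i y := by
  simp only [bary, AffineMap.lineMap_apply_module, area, Pi.add_apply, Pi.smul_apply, smul_eq_mul]
  ring

lemma mem_triangleSet_iff_bary (T : Affine.Triangle ℝ (Fin 2 → ℝ)) (x : Fin 2 → ℝ) :
    x ∈ triangleSet T ↔ ∀ i, 0 ≤ bary T.points i x := by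
  have hA := area_points_ne_zero T
  rw [mem_triangleSet_iff]
  constructor
  · rintro ⟨a, b, ha, hb, hab, rfl⟩
    have e : a • (T.points 1 - T.points 0) + b • (T.points 2 - T.points 0) + T.points 0 =
      (1 - a - b) • T.points 0 + a • T.points 1 + b • T.points 2 := by module
    obtain ⟨h0, h1, h2⟩ := bary_of_combo T.points hA (1 - a - b) a b (by ring)
    rw [e]
    intro i
    fin_cases i
    · exact le_of_le_of_eq (by linarith) h0.symm
    · exact le_of_le_of_eq ha h1.symm
    · exact le_of_le_of_eq hb h2.symm
  · intro h
    have hs := bary_sum T.points hA x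
    refine ⟨bary T.points 1 x, bary T.points 2 x, h 1, h 2, by linarith [h 0], ?_⟩
    conv_lhs => rw [bary_combo T.points hA x]
    have : bary T.points 0 x = 1 - bary T.points 1 x - bary T.points 2 x := by linarith
    rw [this]
    module

lemma isCompact_triangleSet (T : Affine.Triangle ℝ (Fin 2 → ℝ)) : IsCompact (triangleSet T) :=
  (Set.finite_range T.points).isCompact_convexHull ℝ

lemma convex_triangleSet (T : Affine.Triangle ℝ (Fin 2 → ℝ)) : Convex ℝ (triangleSet T) :=
  convex_convexHull ℝ _

lemma mem_interior_triangleSet (T : Affine.Triangle ℝ (Fin 2 → ℝ)) (x : Fin 2 → ℝ)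
    (h : ∀ i, 0 < bary T.points i x) : x ∈ interior (triangleSet T) := by
  have ho : IsOpen {x | ∀ i, 0 < bary T.points i x} := by
    simp only [Set.ofPred_forall]
    exact isOpen_iInter_of_finite fun i => isOpen_lt continuous_const (continuous_bary _ i)
  refine interior_maximal (fun y hy => ?_) ho h
  exact (mem_triangleSet_iff_bary T y).mpr fun i => (hy i).le

lemma interior_triangleSet_nonempty (T : Affine.Triangle ℝ (Fin 2 → ℝ)) :
    (interior (triangleSet T)).Nonempty := by
  obtain ⟨h0, h1, h2⟩ := bary_of_combo T.points (area_points_ne_zero T) (1 / 3) (1 / 3) (1 / 3)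
    (by norm_num)
  refine ⟨(1 / 3 : ℝ) • T.points 0 + (1 / 3 : ℝ) • T.points 1 + (1 / 3 : ℝ) • T.points 2,
    mem_interior_triangleSet T _ fun i => ?_⟩
  fin_cases i
  · exact lt_of_lt_of_eq (by norm_num) h0.symm
  · exact lt_of_lt_of_eq (by norm_num) h1.symm
  · exact lt_of_lt_of_eq (by norm_num) h2.symm

lemma frontier_triangleSet_subset (T : Affine.Triangle ℝ (Fin 2 → ℝ)) :
    frontier (triangleSet T) ⊆ segment ℝ (T.points 0) (T.points 1) ∪
      segment ℝ (T.points 1) (T.points 2) ∪ segment ℝ (T.points 2) (T.points 0) := by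
  intro x hx
  have hA := area_points_ne_zero T
  have hxT : x ∈ triangleSet T := (isCompact_triangleSet T).isClosed.frontier_subset hx
  rw [frontier] at hx
  have hx2 : ¬ ∀ i, 0 < bary T.points i x := fun h => hx.2 (mem_interior_triangleSet T x h)
  have h0 := (mem_triangleSet_iff_bary T x).mp hxT
  have hs := bary_sum T.points hA x
  have hc := bary_combo T.points hA x
  push Not at hx2
  obtain ⟨i, hi⟩ := hx2
  have hi0 := le_antisymm hi (h0 i)
  fin_cases i
  · left; right
    simp only [Fin.zero_eta] at hi0
    refine ⟨_, _, h0 1, h0 2, by linarith, ?_⟩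
    conv_rhs => rw [hc, hi0]
    module
  · right
    simp only [Fin.mk_one] at hi0
    refine ⟨_, _, h0 2, h0 0, by linarith, ?_⟩
    conv_rhs => rw [hc, hi0]
    module
  · left; left
    simp only [Fin.reduceFinMk] at hi0
    refine ⟨_, _, h0 0, h0 1, by linarith, ?_⟩
    conv_rhs => rw [hc, hi0]
    module

/-! ### The meshes are weakly admissible -/

/-- A set with nonempty interior is polynomial determining: restrict to the lines through an
interior point. -/
lemma polynomialDetermining_of_interior {d : ℕ} (K : Set (Fin d → ℝ)) (hK : (interior K).Nonempty) :
    PolynomialDetermining K := by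
  intro p hp
  obtain ⟨c, hc⟩ := hK
  refine MvPolynomial.funext fun x => ?_
  set g : Fin d → Polynomial ℝ :=
    fun i => Polynomial.C (c i) + Polynomial.X * Polynomial.C (x i - c i) with hg
  have heval : ∀ t : ℝ, (MvPolynomial.aeval g p).eval t =
      MvPolynomial.eval (fun i => c i + t * (x i - c i)) p := by
    intro t
    rw [polynomial_eval_aeval]
    simp [hg]
  have hcont : Continuous (fun t : ℝ => fun i => c i + t * (x i - c i)) := by fun_prop
  have hnhds : ∀ᶠ t in nhds (0 : ℝ), (fun i => c i + t * (x i - c i)) ∈ interior K := by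
    apply hcont.continuousAt.eventually_mem
    simpa using isOpen_interior.mem_nhds hc
  have hzero : MvPolynomial.aeval g p = 0 := by
    refine Polynomial.eq_zero_of_infinite_isRoot _ (Set.Infinite.mono ?_
      (infinite_of_mem_nhds (0 : ℝ) hnhds))
    intro t ht
    rw [Set.mem_ofPred_eq, Polynomial.IsRoot, heval]
    exact hp _ (interior_subset ht)
  have := heval 1
  rw [hzero] at this
  simpa using this.symm

lemma abs_eval_le_supNorm {d : ℕ} (A : Finset (Fin d → ℝ)) (p : MvPolynomial (Fin d) ℝ)
    (x : Fin d → ℝ) (hx : x ∈ A) : |MvPolynomial.eval x p| ≤ supNorm (A : Set (Fin d → ℝ)) p :=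
  le_csSup ((A.finite_toSet.image _).bddAbove) (Set.mem_image_of_mem _ hx)

lemma padua_subset_square (N : ℕ) : (padua N : Set (Fin 2 → ℝ)) ⊆ square := by
  intro x hx
  rw [Finset.mem_coe, padua, Finset.mem_image] at hx
  obtain ⟨z, hz, rfl⟩ := hx
  have hO : ∀ M : ℕ, ∀ a ∈ chebOdd M, a ∈ Set.Icc (-1 : ℝ) 1 := by
    intro M a ha
    obtain ⟨j, -, rfl⟩ := Finset.mem_image.mp ha
    exact Real.cos_mem_Icc _
  have hE : ∀ M : ℕ, ∀ a ∈ chebEven M, a ∈ Set.Icc (-1 : ℝ) 1 := by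
    intro M a ha
    obtain ⟨j, -, rfl⟩ := Finset.mem_image.mp ha
    exact Real.cos_mem_Icc _
  rw [Finset.mem_union, Finset.mem_product, Finset.mem_product] at hz
  intro i
  fin_cases i
  · rcases hz with hz | hz
    · exact hO _ _ hz.1
    · exact hE _ _ hz.1
  · rcases hz with hz | hz
    · exact hE _ _ hz.2
    · exact hO _ _ hz.2

lemma triangleMesh_subset (T : Affine.Triangle ℝ (Fin 2 → ℝ)) (n : ℕ) :
    (triangleMesh T n : Set (Fin 2 → ℝ)) ⊆ triangleSet T := by
  rw [triangleMesh, Finset.coe_image, ← duffy_image_square]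
  exact Set.image_mono (padua_subset_square _)

lemma abs_eval_le_of_triangleMesh (T : Affine.Triangle ℝ (Fin 2 → ℝ)) (n : ℕ) (hn : 1 ≤ n)
    (p : MvPolynomial (Fin 2) ℝ) (hp : p.totalDegree ≤ n) (B : ℝ)
    (hB : ∀ x ∈ triangleMesh T n, |MvPolynomial.eval x p| ≤ B) (x : Fin 2 → ℝ)
    (hx : x ∈ triangleSet T) : |MvPolynomial.eval x p| ≤ paduaConst n * B := by
  rw [← duffy_image_square] at hx
  obtain ⟨y, hy, rfl⟩ := hx
  rw [← eval_aeval_duffyPoly]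
  refine abs_eval_le_of_padua n hn _ ?_ B (fun z hz => ?_) y hy
  · have := totalDegree_aeval_le (duffyPoly T) 2 (totalDegree_duffyPoly T) p
    omega
  · rw [eval_aeval_duffyPoly]
    exact hB _ (Finset.mem_image_of_mem _ hz)

lemma card_unionMesh_le {k : ℕ} (T : Fin k → Affine.Triangle ℝ (Fin 2 → ℝ)) (n : ℕ) (hn : 1 ≤ n) :
    (unionMesh T n).card ≤ k * (2 * n ^ 2 + 2 * n + 2) :=
  (Finset.card_biUnion_le_card_mul _ _ (2 * n ^ 2 + 2 * n + 2) fun i _ =>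
    (card_triangleMesh (T i) n hn).le).trans (by simp)

/-- The union of the meshes of finitely many triangles is a weakly admissible mesh of the union of
the triangles. -/
lemma isWAM_unionMesh {k : ℕ} (hk : 0 < k) (T : Fin k → Affine.Triangle ℝ (Fin 2 → ℝ))
    (K : Set (Fin 2 → ℝ)) (hK : (⋃ i, triangleSet (T i)) = K) :
    IsWAM K (unionMesh T) paduaConst := by
  have hmesh : ∀ n i, triangleMesh (T i) n ⊆ unionMesh T n := fun n i =>
    Finset.subset_biUnion_of_mem (fun i => triangleMesh (T i) n) (Finset.mem_univ i)
  have hsub : ∀ i, triangleSet (T i) ⊆ K := fun i =>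
    hK ▸ Set.subset_iUnion (fun i => triangleSet (T i)) i
  set i₀ : Fin k := ⟨0, hk⟩
  have hcardge : ∀ n, 1 ≤ n → 2 * n ^ 2 + 2 * n + 2 ≤ (unionMesh T n).card := fun n hn =>
    card_triangleMesh (T i₀) n hn ▸ Finset.card_le_card (hmesh n i₀)
  refine ⟨?_, ?_, ?_, ?_, ?_, ⟨2, by norm_num, ?_⟩, ⟨2, by norm_num, ?_⟩⟩
  · rw [← hK]
    exact isCompact_iUnion fun i => isCompact_triangleSet (T i)
  · exact polynomialDetermining_of_interior K
      ((interior_triangleSet_nonempty (T i₀)).mono (interior_mono (hsub i₀)))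
  · intro n _ x hx
    rw [Finset.mem_coe, unionMesh, Finset.mem_biUnion] at hx
    obtain ⟨i, -, hi⟩ := hx
    exact hsub i (triangleMesh_subset (T i) n hi)
  · intro n hn p hp
    rw [MvPolynomial.mem_restrictTotalDegree] at hp
    have hne : K.Nonempty :=
      ((interior_triangleSet_nonempty (T i₀)).mono interior_subset).mono (hsub i₀)
    refine csSup_le (hne.image _) ?_
    rintro _ ⟨x, hx, rfl⟩
    rw [← hK, Set.mem_iUnion] at hx
    obtain ⟨i, hi⟩ := hx
    exact abs_eval_le_of_triangleMesh (T i) n hn p hp _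
      (fun y hy => abs_eval_le_supNorm _ p y (hmesh n i hy)) x hi
  · intro n hn
    refine le_trans ?_ (hcardge n hn)
    rw [Nat.choose_two_right]
    apply Nat.div_le_of_le_mul
    have : n + 2 - 1 = n + 1 := rfl
    rw [this]
    nlinarith
  · refine IsBigO.of_bound (k * 6) ?_
    filter_upwards [eventually_ge_atTop 1] with n hn
    have hn1 : (1 : ℝ) ≤ n := by exact_mod_cast hn
    rw [Real.norm_of_nonneg (by positivity), Real.norm_of_nonneg (by positivity)]
    have h1 : ((unionMesh T n).card : ℝ) ≤ k * (2 * n ^ 2 + 2 * n + 2) := by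
      exact_mod_cast card_unionMesh_le T n hn
    have h2 : (n : ℝ) ^ (2 : ℝ) = n ^ 2 := by norm_cast
    rw [h2]
    refine h1.trans ?_
    rw [mul_assoc]
    gcongr
    nlinarith
  · refine paduaConst_isBigO.trans (IsBigO.of_bound 1 ?_)
    filter_upwards [eventually_ge_atTop 1] with n hn
    have hn1 : (1 : ℝ) ≤ n := by exact_mod_cast hn
    have hl := Real.log_nonneg hn1
    rw [Real.norm_of_nonneg (by positivity), Real.norm_of_nonneg (by positivity), one_mul]
    have h2 : (n : ℝ) ^ (2 : ℝ) = n ^ 2 := by norm_cast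
    rw [h2]
    gcongr
    exact (Real.log_le_sub_one_of_pos (by linarith)).trans (by linarith)

lemma isWAM_triangleMesh (T : Affine.Triangle ℝ (Fin 2 → ℝ)) :
    IsWAM (triangleSet T) (triangleMesh T) paduaConst := by
  have h := isWAM_unionMesh (k := 1) one_pos (fun _ => T) (triangleSet T)
    (Set.iUnion_const _)
  have : unionMesh (fun _ : Fin 1 => T) = triangleMesh T := by
    funext n
    simp [unionMesh]
  rwa [this] at h

/-! ### Separation by compact plane sets, through continuous logarithms -/

/-- The point `x` of the plane as a complex number. -/
noncomputable def toC (x : Fin 2 → ℝ) : ℂ := (x 0 : ℂ) + (x 1 : ℂ) * Complex.I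

lemma continuous_toC : Continuous toC := by unfold toC; fun_prop

lemma toC_eq_zero_iff (x : Fin 2 → ℝ) : toC x = 0 ↔ x = 0 := by
  constructor
  · intro h
    have h0 := congrArg Complex.re h
    have h1 := congrArg Complex.im h
    simp [toC] at h0 h1
    funext i
    fin_cases i
    · exact h0
    · exact h1
  · rintro rfl; simp [toC]

/-- `z - x` has a continuous logarithm on `U`, for every `x` outside `U`. For compact `U` this says
that the complement of `U` is connected, in a form that is stable under gluing. -/
def HasLog (U : Set (Fin 2 → ℝ)) : Prop :=
  ∀ x, x ∉ U → ∃ g : (Fin 2 → ℝ) → ℂ, ContinuousOn g U ∧ ∀ z ∈ U, Complex.exp (g z) = toC (z - x)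

lemma constant_of_exp_eq_one {X : Type*} [TopologicalSpace X] {S : Set X} (hS : IsPreconnected S)
    (f : X → ℂ) (hf : ContinuousOn f S) (h1 : ∀ x ∈ S, Complex.exp (f x) = 1) {x y : X}
    (hx : x ∈ S) (hy : y ∈ S) : f x = f y := by
  have hpi : (2 * Real.pi : ℝ) ≠ 0 := by positivity
  have hval : ∀ z ∈ S, ∃ n : ℤ, f z = n * (2 * Real.pi * Complex.I) := fun z hz =>
    Complex.exp_eq_one_iff.mp (h1 z hz)
  have hdisc : IsDiscrete (Set.range ((↑) : ℤ → ℝ)) :=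
    ⟨(Int.isClosedEmbedding_coe_real.isEmbedding.toHomeomorph).symm.isEmbedding.discreteTopology⟩
  have hc := hS.constant_of_mapsTo (f := fun z => (f z).im / (2 * Real.pi))
    hdisc
    ((Complex.continuous_im.comp_continuousOn hf).div_const _)
    (fun z hz => by
      obtain ⟨n, hn⟩ := hval z hz
      refine ⟨n, ?_⟩
      simp only [hn]
      simp) hx hy
  obtain ⟨n, hn⟩ := hval x hx
  obtain ⟨k, hk⟩ := hval y hy
  simp only [hn, hk] at hc ⊢
  simp at hc
  rw [hc]

lemma continuousLinearMap_plane (f : (Fin 2 → ℝ) →L[ℝ] ℝ) :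
    ∃ α β : ℝ, ∀ x, f x = α * x 0 + β * x 1 := by
  refine ⟨f (Pi.single 0 1), f (Pi.single 1 1), fun x => ?_⟩
  have : x = x 0 • (Pi.single 0 1 : Fin 2 → ℝ) + x 1 • (Pi.single 1 1 : Fin 2 → ℝ) := by
    funext i; fin_cases i <;> simp
  conv_lhs => rw [this]
  simp [mul_comm]

/-- On a convex set `z - x` stays in a half plane, where the principal logarithm serves. -/
lemma hasLog_of_convex {U : Set (Fin 2 → ℝ)} (hU : Convex ℝ U) (hc : IsClosed U) : HasLog U := by
  intro x hx
  rcases U.eq_empty_or_nonempty with rfl | hne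
  · exact ⟨0, continuousOn_empty _, by simp⟩
  obtain ⟨f, u, hxu, hu⟩ := geometric_hahn_banach_point_closed hU hc hx
  obtain ⟨α, β, hf⟩ := continuousLinearMap_plane f
  set c : ℂ := ⟨α, -β⟩ with hcdef
  have hre : ∀ z, (c * toC z).re = f z := by
    intro z
    rw [hf]
    simp [toC, hcdef]
  have hslit : ∀ z ∈ U, c * toC (z - x) ∈ Complex.slitPlane := by
    intro z hz
    left
    rw [hre, map_sub]
    linarith [hu z hz]
  have hc0 : c ≠ 0 := by
    obtain ⟨z, hz⟩ := hne
    intro h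
    have := Complex.slitPlane_ne_zero (hslit z hz)
    simp [h] at this
  refine ⟨fun z => Complex.log (c * toC (z - x)) - Complex.log c, ?_, ?_⟩
  · refine ContinuousOn.sub (ContinuousOn.clog ?_ hslit) continuousOn_const
    exact (continuous_const.mul
      (continuous_toC.comp (continuous_id.sub continuous_const))).continuousOn
  · intro z hz
    rw [Complex.exp_sub, Complex.exp_log (Complex.slitPlane_ne_zero (hslit z hz)),
      Complex.exp_log hc0]
    field_simp

/-- Two continuous logarithms on closed sets with connected intersection differ there by a
constant, so that they glue. -/
lemma HasLog.union {U₁ U₂ : Set (Fin 2 → ℝ)} (h₁ : HasLog U₁) (h₂ : HasLog U₂) (hc₁ : IsClosed U₁)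
    (hc₂ : IsClosed U₂) (hconn : IsPreconnected (U₁ ∩ U₂)) : HasLog (U₁ ∪ U₂) := by
  classical
  intro x hx
  obtain ⟨g₁, hg₁, he₁⟩ := h₁ x (fun h => hx (Or.inl h))
  obtain ⟨g₂, hg₂, he₂⟩ := h₂ x (fun h => hx (Or.inr h))
  have hdiff : ∀ z ∈ U₁ ∩ U₂, Complex.exp (g₁ z - g₂ z) = 1 := by
    intro z hz
    rw [Complex.exp_sub, he₁ z hz.1, ← he₂ z hz.2, div_self (Complex.exp_ne_zero _)]
  obtain ⟨c, hc1, hc⟩ : ∃ c : ℂ, Complex.exp c = 1 ∧ ∀ z ∈ U₁ ∩ U₂, g₁ z = g₂ z + c := by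
    rcases (U₁ ∩ U₂).eq_empty_or_nonempty with h | ⟨p, hp⟩
    · exact ⟨0, Complex.exp_zero, by simp [h]⟩
    · refine ⟨g₁ p - g₂ p, hdiff p hp, fun z hz => ?_⟩
      have := constant_of_exp_eq_one hconn (fun z => g₁ z - g₂ z)
        ((hg₁.mono Set.inter_subset_left).sub (hg₂.mono Set.inter_subset_right)) hdiff hz hp
      linear_combination this
  refine ⟨U₁.piecewise g₁ (fun z => g₂ z + c), ?_, ?_⟩
  · refine ContinuousOn.union_of_isClosed ?_ ?_ hc₁ hc₂
    · exact hg₁.congr fun z hz => Set.piecewise_eq_of_mem _ _ _ hz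
    · refine (hg₂.add (continuousOn_const (c := c))).congr fun z hz => ?_
      by_cases hz1 : z ∈ U₁
      · rw [Set.piecewise_eq_of_mem _ _ _ hz1, hc z ⟨hz1, hz⟩]; rfl
      · rw [Set.piecewise_eq_of_notMem _ _ _ hz1]; rfl
  · intro z hz
    by_cases hz1 : z ∈ U₁
    · rw [Set.piecewise_eq_of_mem _ _ _ hz1, he₁ z hz1]
    · rw [Set.piecewise_eq_of_notMem _ _ _ hz1, Complex.exp_add, hc1, mul_one,
        he₂ z (hz.resolve_left hz1)]

lemma isSimplyConnected_univ_plane : IsSimplyConnected (Set.univ : Set (Fin 2 → ℝ)) := by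
  have : ContractibleSpace (Set.univ : Set (Fin 2 → ℝ)) :=
    convex_univ.contractibleSpace ⟨0, trivial⟩
  exact SimplyConnectedSpace.ofContractible _

/-- A nowhere vanishing continuous function on the plane cannot coincide with `z - x` outside a
bounded set: a logarithm of it would unwind a large circle around `x`. -/
lemma not_continuous_of_eq_sub (x : Fin 2 → ℝ) (F : (Fin 2 → ℝ) → ℂ) (hF : Continuous F)
    (hF0 : ∀ z, F z ≠ 0) (W : Set (Fin 2 → ℝ)) (hW : Bornology.IsBounded W)
    (hFW : ∀ z, z ∉ W → F z = toC (z - x)) : False := by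
  obtain ⟨h, hh, he⟩ := Complex.exists_continuousOn_eqOn_exp_comp isSimplyConnected_univ_plane
    isOpen_univ hF.continuousOn (by rintro ⟨z, -, hz⟩; exact hF0 z hz)
  rw [continuousOn_univ] at hh
  obtain ⟨R, hR0, hR⟩ := hW.subset_ball_lt 0 x
  set γ : ℝ → Fin 2 → ℝ := fun t => ![x 0 + 2 * R * Real.cos t, x 1 + 2 * R * Real.sin t] with hγ
  have hγc : Continuous γ := by
    refine continuous_pi fun i => ?_
    fin_cases i
    · simp only [hγ, Fin.zero_eta, Matrix.cons_val_zero]; fun_prop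
    · simp only [hγ, Fin.mk_one, Matrix.cons_val_one]; fun_prop
  have hγW : ∀ t, γ t ∉ W := by
    intro t ht
    have := hR ht
    rw [Metric.mem_ball, dist_pi_lt_iff hR0] at this
    have h0 := this 0
    have h1 := this 1
    simp only [hγ, Matrix.cons_val_zero, Matrix.cons_val_one, Real.dist_eq,
      add_sub_cancel_left] at h0 h1
    have e0 := sq_lt_sq' (abs_lt.mp h0).1 (abs_lt.mp h0).2
    have e1 := sq_lt_sq' (abs_lt.mp h1).1 (abs_lt.mp h1).2
    have := Real.sin_sq_add_cos_sq t
    nlinarith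
  have hexp : ∀ t : ℝ, Complex.exp (h (γ t)) = 2 * R * Complex.exp (t * Complex.I) := by
    intro t
    have h1 := he (Set.mem_univ (γ t))
    rw [Function.comp_apply, hFW _ (hγW t)] at h1
    rw [h1, Complex.exp_mul_I]
    simp [toC, hγ]
    ring
  have hRc : (2 * R : ℂ) ≠ 0 := by
    have : (2 * R : ℝ) ≠ 0 := by positivity
    exact_mod_cast this
  have hconst := constant_of_exp_eq_one (S := (Set.univ : Set ℝ)) isPreconnected_univ
    (fun t : ℝ => h (γ t) - t * Complex.I - Complex.log (2 * R))
    (by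
      have : Continuous fun t : ℝ => h (γ t) := hh.comp hγc
      fun_prop)
    (fun t _ => by
      rw [Complex.exp_sub, Complex.exp_sub, hexp, Complex.exp_log hRc]
      rw [mul_div_assoc, div_self (Complex.exp_ne_zero _), mul_one, div_self hRc])
    (Set.mem_univ (0 : ℝ)) (Set.mem_univ (2 * Real.pi))
  have hγ2 : γ (2 * Real.pi) = γ 0 := by simp [hγ]
  simp only [hγ2] at hconst
  have h2 : (2 * Real.pi * Complex.I : ℂ) = 0 := by
    push_cast at hconst
    linear_combination hconst
  exact Complex.two_pi_I_ne_zero h2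

/-- A connected set that avoids the frontier of `U` and contains a point outside `U` avoids `U`. -/
lemma notMem_of_isPreconnected {A U : Set (Fin 2 → ℝ)}
    (hA : IsPreconnected A) (hAU : ∀ x ∈ A, x ∉ frontier U) {z : Fin 2 → ℝ} (hzA : z ∈ A)
    (hzU : z ∉ U) : ∀ x ∈ A, x ∉ U := by
  intro x hxA hxU
  have hcl : ∀ y ∈ A, y ∈ closure U → y ∈ interior U := fun y hy hyc => by
    by_contra hcon
    exact hAU y hy ⟨hyc, hcon⟩
  obtain ⟨y, hyA, hy1, hy2⟩ := hA (interior U) (closure U)ᶜ isOpen_interior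
    isClosed_closure.isOpen_compl
    (fun y hy => by
      by_cases h : y ∈ closure U
      · exact Or.inl (hcl y hy h)
      · exact Or.inr h)
    ⟨x, hxA, hcl x hxA (subset_closure hxU)⟩
    ⟨z, hzA, fun h => hzU (interior_subset (hcl z hzA h))⟩
  exact hy2 (subset_closure (interior_subset hy1))

/-- A point outside a compact set `U` with `HasLog U` lies in an unbounded component of the
complement. -/
lemma HasLog.not_isBounded {U : Set (Fin 2 → ℝ)} (h : HasLog U) (hU : IsClosed U)
    {x : Fin 2 → ℝ} (hx : x ∉ U) : ¬ Bornology.IsBounded (connectedComponentIn Uᶜ x) := by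
  classical
  intro hb
  set W := connectedComponentIn Uᶜ x with hWdef
  have hxW : x ∈ W := mem_connectedComponentIn hx
  have hWo : IsOpen W := hU.isOpen_compl.connectedComponentIn
  have hfr : ∀ y ∈ frontier W, y ∈ U := by
    intro y hy
    by_contra hyU
    have hyo : IsOpen (connectedComponentIn Uᶜ y) := hU.isOpen_compl.connectedComponentIn
    obtain ⟨z, hz1, hz2⟩ := mem_closure_iff.mp hy.1 _ hyo (mem_connectedComponentIn hyU)
    have e1 := connectedComponentIn_eq hz1
    have e2 := connectedComponentIn_eq hz2
    have : y ∈ W := by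
      rw [hWdef, e2, ← e1]
      exact mem_connectedComponentIn hyU
    rw [hWo.frontier_eq] at hy
    exact hy.2 this
  obtain ⟨g, hg, he⟩ := h x hx
  obtain ⟨G, hG⟩ := ContinuousMap.exists_restrict_eq hU
    ⟨U.domRestrict g, continuousOn_iff_continuous_domRestrict.mp hg⟩
  have hGU : ∀ z ∈ U, G z = g z := fun z hz => congr($hG ⟨z, hz⟩)
  refine not_continuous_of_eq_sub x (W.piecewise (fun z => Complex.exp (G z))
    (fun z => toC (z - x))) ?_ ?_ W hb ?_
  · refine Continuous.piecewise (fun a ha => ?_) (Complex.continuous_exp.comp G.continuous)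
      (continuous_toC.comp (continuous_id.sub continuous_const))
    have := hfr a ha
    rw [hGU a this, he a this]
  · intro z
    by_cases hz : z ∈ W
    · rw [Set.piecewise_eq_of_mem _ _ _ hz]; exact Complex.exp_ne_zero _
    · rw [Set.piecewise_eq_of_notMem _ _ _ hz, Ne, toC_eq_zero_iff, sub_eq_zero]
      rintro rfl
      exact hz hxW
  · intro z hz
    exact Set.piecewise_eq_of_notMem _ _ _ hz

/-- A bounded set whose frontier lies in a closed convex set lies in that convex set. -/
lemma subset_of_frontier_subset_convex {V C : Set (Fin 2 → ℝ)} (hV : Bornology.IsBounded V)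
    (hC : Convex ℝ C) (hCc : IsClosed C) (hfr : frontier V ⊆ C) : V ⊆ C := by
  rcases V.eq_empty_or_nonempty with rfl | hne
  · exact Set.empty_subset _
  have hCne : C.Nonempty := by
    rw [Set.nonempty_iff_ne_empty]
    rintro rfl
    have : (frontier V).Nonempty := nonempty_frontier_iff.mpr ⟨hne, fun h => by
      rw [h] at hV
      exact NoncompactSpace.noncompact_univ
        (Metric.isCompact_of_isClosed_isBounded isClosed_univ hV)⟩
    exact (hfr this.some_mem)
  intro x hx
  by_contra hxC
  obtain ⟨f, u, hu, hxu⟩ := geometric_hahn_banach_closed_point hC hCc hxC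
  obtain ⟨c, hc⟩ := hCne
  -- on the ray from `x` in the direction `x - c` the functional `f` increases without bound
  have hfd : 0 < f (x - c) := by rw [map_sub]; linarith [hu c hc]
  have hconn : IsPreconnected {y | u < f y} :=
    ((convex_halfSpace_gt f.toLinearMap.isLinear u)).isPreconnected
  obtain ⟨R, hR⟩ := hV.subset_ball x
  have hRay : ∀ t : ℝ, 0 ≤ t → x + t • (x - c) ∈ {y | u < f y} := by
    intro t ht
    have : 0 ≤ t * f (x - c) := by positivity
    simp only [Set.mem_ofPred_eq, map_add, map_smul, smul_eq_mul]
    linarith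
  have hxc : 0 < ‖x - c‖ := by
    rw [norm_pos_iff]; intro h; rw [h, map_zero] at hfd; exact lt_irrefl _ hfd
  have hnot : x + (|R| / ‖x - c‖) • (x - c) ∉ V := by
    intro hmem
    have := hR hmem
    rw [Metric.mem_ball, dist_eq_norm, add_sub_cancel_left, norm_smul, Real.norm_of_nonneg
      (by positivity), div_mul_cancel₀ _ hxc.ne'] at this
    exact absurd this (not_lt.mpr (le_abs_self R))
  exact notMem_of_isPreconnected hconn
    (fun y hy hyf => absurd (hu y (hfr hyf)) (not_lt.mpr (le_of_lt hy)))
    (hRay _ (by positivity)) hnot x hxu hx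

/-! ### Gluing two triangulated regions along a segment -/

/-- `B` is the outline of a region cut into `k` non-overlapping triangles whose complement is
connected: the triangles cover `B`, and the frontier of their union lies in `B`. -/
def BoundsTriangles (k : ℕ) (B : Set (Fin 2 → ℝ)) : Prop :=
  ∃ T : Fin k → Affine.Triangle ℝ (Fin 2 → ℝ),
    (∀ i j, i ≠ j → Disjoint (interior (triangleSet (T i))) (interior (triangleSet (T j)))) ∧
    frontier (⋃ i, triangleSet (T i)) ⊆ B ∧ B ⊆ (⋃ i, triangleSet (T i)) ∧
    HasLog (⋃ i, triangleSet (T i))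

lemma area_of_mem_segment {p q x : Fin 2 → ℝ} (hx : x ∈ segment ℝ p q) : area p q x = 0 := by
  obtain ⟨a, b, -, -, hab, rfl⟩ := hx
  obtain rfl : a = 1 - b := by linarith
  simp [area]
  ring

/-- A nonempty open set is not contained in a line. -/
lemma exists_area_ne_zero {p q : Fin 2 → ℝ} (hpq : p ≠ q) {O : Set (Fin 2 → ℝ)} (hO : IsOpen O)
    (hne : O.Nonempty) : ∃ y ∈ O, area p q y ≠ 0 := by
  obtain ⟨x, hx⟩ := hne
  by_contra hcon
  push Not at hcon
  set γ : ℝ → Fin 2 → ℝ := fun t => ![x 0 - t * (q 1 - p 1), x 1 + t * (q 0 - p 0)] with hγ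
  have hγc : Continuous γ := by
    refine continuous_pi fun i => ?_
    fin_cases i
    · simp only [hγ, Fin.zero_eta, Matrix.cons_val_zero]; fun_prop
    · simp only [hγ, Fin.mk_one, Matrix.cons_val_one]; fun_prop
  have h0 : γ 0 = x := by
    funext i; fin_cases i <;> simp [hγ]
  have hev : ∀ᶠ t in nhds (0 : ℝ), γ t ∈ O := by
    apply hγc.continuousAt.eventually_mem
    rw [h0]
    exact hO.mem_nhds hx
  obtain ⟨t, ht, htne⟩ := (hev.filter_mono nhdsWithin_le_nhds |>.and
    (eventually_mem_nhdsWithin (a := (0 : ℝ)) (s := {0}ᶜ))).exists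
  have h1 := hcon _ ht
  have h2 := hcon _ hx
  simp only [area, hγ, Matrix.cons_val_zero, Matrix.cons_val_one] at h1 h2
  have h3 : t * ((q 0 - p 0) ^ 2 + (q 1 - p 1) ^ 2) = 0 := by linear_combination h1 - h2
  have h4 := (mul_eq_zero.mp h3).resolve_left htne
  apply hpq
  have h5 : q 0 - p 0 = 0 := by nlinarith [sq_nonneg (q 0 - p 0), sq_nonneg (q 1 - p 1)]
  have h6 : q 1 - p 1 = 0 := by nlinarith [sq_nonneg (q 0 - p 0), sq_nonneg (q 1 - p 1)]
  funext i
  fin_cases i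
  · simp only [Fin.zero_eta]; linarith
  · simp only [Fin.mk_one]; linarith

lemma isCompact_iUnion_triangleSet {k : ℕ} (T : Fin k → Affine.Triangle ℝ (Fin 2 → ℝ)) :
    IsCompact (⋃ i, triangleSet (T i)) := isCompact_iUnion fun i => isCompact_triangleSet (T i)

lemma iUnion_triangleSet_subset_closure_interior {k : ℕ}
    (T : Fin k → Affine.Triangle ℝ (Fin 2 → ℝ)) :
    (⋃ i, triangleSet (T i)) ⊆ closure (interior (⋃ i, triangleSet (T i))) := by
  refine Set.iUnion_subset fun i => ?_
  have h := (convex_triangleSet (T i)).closure_interior_eq_closure_of_nonempty_interior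
    (interior_triangleSet_nonempty (T i))
  refine (subset_closure.trans h.superset).trans (closure_mono (interior_mono ?_))
  exact Set.subset_iUnion (fun i => triangleSet (T i)) i

lemma isClosed_segment_plane (p q : Fin 2 → ℝ) : IsClosed (segment ℝ p q) := by
  rw [segment_eq_image_lineMap]
  exact (isCompact_Icc.image (AffineMap.lineMap_continuous)).isClosed

/-- If two regions with outlines `A₁ ∪ [p,q]` and `A₂ ∪ [p,q]` do not lie inside one another, they
meet exactly in the common segment, and the open segment is interior to their union. -/
lemma region_gluing {A₁ A₂ U₁ U₂ : Set (Fin 2 → ℝ)} {p q : Fin 2 → ℝ} (hpq : p ≠ q)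
    (hU₁ : IsCompact U₁) (hU₂ : IsCompact U₂)
    (hr₁ : U₁ ⊆ closure (interior U₁)) (hr₂ : U₂ ⊆ closure (interior U₂))
    (hf₁ : frontier U₁ ⊆ A₁ ∪ segment ℝ p q) (hf₂ : frontier U₂ ⊆ A₂ ∪ segment ℝ p q)
    (hb₁ : segment ℝ p q ⊆ U₁) (hb₂ : segment ℝ p q ⊆ U₂)
    (hA₁ : IsPreconnected A₁) (hA₂ : IsPreconnected A₂)
    (hd₁ : Disjoint A₁ (A₂ ∪ segment ℝ p q)) (hd₂ : Disjoint A₂ (A₁ ∪ segment ℝ p q))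
    (hclosed : IsClosed (A₁ ∪ A₂ ∪ {p, q}))
    (hw₁ : ∃ z ∈ A₁, z ∉ U₂) (hw₂ : ∃ z ∈ A₂, z ∉ U₁) :
    U₁ ∩ U₂ = segment ℝ p q ∧ Disjoint (interior U₁) (interior U₂) ∧
      frontier (U₁ ∪ U₂) ⊆ A₁ ∪ A₂ ∪ {p, q} := by
  have hA₁U₂ : ∀ x ∈ A₁, x ∉ U₂ := by
    obtain ⟨z, hz, hzU⟩ := hw₁
    exact notMem_of_isPreconnected hA₁
      (fun x hx hxf => Set.disjoint_left.mp hd₁ hx (hf₂ hxf)) hz hzU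
  have hA₂U₁ : ∀ x ∈ A₂, x ∉ U₁ := by
    obtain ⟨z, hz, hzU⟩ := hw₂
    exact notMem_of_isPreconnected hA₂
      (fun x hx hxf => Set.disjoint_left.mp hd₂ hx (hf₁ hxf)) hz hzU
  have hinter : U₁ ∩ U₂ = segment ℝ p q := by
    refine Set.Subset.antisymm ?_ (Set.subset_inter hb₁ hb₂)
    refine subset_of_frontier_subset_convex (hU₁.isBounded.subset Set.inter_subset_left)
      (convex_segment p q) (isClosed_segment_plane p q) ?_
    intro x hx
    have hxU := (hU₁.isClosed.inter hU₂.isClosed).frontier_subset hx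
    rcases frontier_inter_subset _ _ hx with h | h
    · exact (hf₁ h.1).resolve_left fun h' => hA₁U₂ x h' hxU.2
    · exact (hf₂ h.2).resolve_left fun h' => hA₂U₁ x h' hxU.1
  have hint : Disjoint (interior U₁) (interior U₂) := by
    rw [Set.disjoint_iff_inter_eq_empty, ← Set.not_nonempty_iff_eq_empty]
    intro hne
    obtain ⟨y, hy, hya⟩ := exists_area_ne_zero hpq (isOpen_interior.inter isOpen_interior) hne
    have : y ∈ U₁ ∩ U₂ := ⟨interior_subset hy.1, interior_subset hy.2⟩
    rw [hinter] at this
    exact hya (area_of_mem_segment this)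
  refine ⟨hinter, hint, ?_⟩
  intro x hx
  by_contra hxC
  have hxd : x ∈ segment ℝ p q := by
    rcases frontier_union_subset _ _ hx with h | h
    · exact (hf₁ h.1).resolve_left fun h' => hxC (Or.inl (Or.inl h'))
    · exact (hf₂ h.2).resolve_left fun h' => hxC (Or.inl (Or.inr h'))
  -- a small disc around `x` is cut by the line `p q` into two halves, one in each region
  obtain ⟨r, hr, hball⟩ := Metric.isOpen_iff.mp hclosed.isOpen_compl x hxC
  set P := Metric.ball x r ∩ {y | 0 < area p q y} with hP
  set M := Metric.ball x r ∩ {y | area p q y < 0} with hM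
  have hcont : Continuous (area p q) := by unfold area; fun_prop
  have haff : ∀ y z : Fin 2 → ℝ, ∀ a b : ℝ, a + b = 1 →
      area p q (a • y + b • z) = a * area p q y + b * area p q z := by
    intro y z a b hab
    obtain rfl : a = 1 - b := by linarith
    simp [area]; ring
  have hPc : IsPreconnected P := by
    refine ((convex_ball x r).inter ?_).isPreconnected
    intro y hy z hz a b ha hb hab
    rw [Set.mem_ofPred_eq] at hy hz ⊢
    rw [haff y z a b hab]
    rcases ha.eq_or_lt with rfl | ha'
    · obtain rfl : b = 1 := by linarith
      simpa using hz
    · have := mul_pos ha' hy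
      have := mul_nonneg hb hz.le
      linarith
  have hMc : IsPreconnected M := by
    refine ((convex_ball x r).inter ?_).isPreconnected
    intro y hy z hz a b ha hb hab
    rw [Set.mem_ofPred_eq] at hy hz ⊢
    rw [haff y z a b hab]
    rcases ha.eq_or_lt with rfl | ha'
    · obtain rfl : b = 1 := by linarith
      simpa using hz
    · have := mul_pos_of_neg_of_neg (neg_lt_zero.mpr ha') hy
      have := mul_nonpos_of_nonneg_of_nonpos hb hz.le
      linarith
  have hPo : IsOpen P := Metric.isOpen_ball.inter (isOpen_lt continuous_const hcont)
  have hMo : IsOpen M := Metric.isOpen_ball.inter (isOpen_lt hcont continuous_const)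
  have hnofr : ∀ A U : Set (Fin 2 → ℝ), A ⊆ A₁ ∪ A₂ ∪ {p, q} → frontier U ⊆ A ∪ segment ℝ p q →
      ∀ y ∈ Metric.ball x r, area p q y ≠ 0 → y ∉ frontier U := by
    intro A U hA hf y hy hya hyf
    rcases hf hyf with h | h
    · exact hball hy (hA h)
    · exact hya (area_of_mem_segment h)
  have hhalf : ∀ A U : Set (Fin 2 → ℝ), A ⊆ A₁ ∪ A₂ ∪ {p, q} → frontier U ⊆ A ∪ segment ℝ p q →
      x ∈ closure (interior U) → P ⊆ U ∨ M ⊆ U := by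
    intro A U hA hf hxU
    have hne : (Metric.ball x r ∩ interior U).Nonempty :=
      mem_closure_iff.mp hxU _ Metric.isOpen_ball (Metric.mem_ball_self hr)
    obtain ⟨y, hy, hya⟩ := exists_area_ne_zero hpq (Metric.isOpen_ball.inter isOpen_interior) hne
    rcases lt_or_gt_of_ne hya with h | h
    · right
      intro z hz
      by_contra hzU
      exact notMem_of_isPreconnected hMc (fun w hw => hnofr A U hA hf w hw.1 hw.2.ne)
        hz hzU y ⟨hy.1, h⟩ (interior_subset hy.2)
    · left
      intro z hz
      by_contra hzU
      exact notMem_of_isPreconnected hPc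
        (fun w hw => hnofr A U hA hf w hw.1 (ne_of_gt hw.2)) hz hzU y ⟨hy.1, h⟩
        (interior_subset hy.2)
  have h1 := hhalf A₁ U₁ (fun y hy => Or.inl (Or.inl hy)) hf₁ (hr₁ (hb₁ hxd))
  have h2 := hhalf A₂ U₂ (fun y hy => Or.inl (Or.inr hy)) hf₂ (hr₂ (hb₂ hxd))
  have hnoteq : ∀ H : Set (Fin 2 → ℝ), IsOpen H → H.Nonempty → ¬ (H ⊆ U₁ ∧ H ⊆ U₂) := by
    intro H hH ⟨y, hy⟩ ⟨k1, k2⟩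
    exact Set.disjoint_left.mp hint (interior_maximal k1 hH hy) (interior_maximal k2 hH hy)
  have hPne : P.Nonempty ∧ M.Nonempty := by
    obtain ⟨y, hy, hya⟩ := exists_area_ne_zero hpq (O := Metric.ball x r) Metric.isOpen_ball
      ⟨x, Metric.mem_ball_self hr⟩
    -- reflect `y` in the centre `x`, which lies on the line
    have hx0 := area_of_mem_segment hxd
    have hrefl : area p q ((2 : ℝ) • x + (-1 : ℝ) • y) = -area p q y := by
      rw [haff _ _ _ _ (by norm_num), hx0]; ring
    have hy' : (2 : ℝ) • x + (-1 : ℝ) • y ∈ Metric.ball x r := by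
      rw [Metric.mem_ball, dist_eq_norm] at hy ⊢
      rw [show (2 : ℝ) • x + (-1 : ℝ) • y - x = -(y - x) by module, norm_neg]
      exact hy
    rcases lt_or_gt_of_ne hya with h | h
    · exact ⟨⟨_, hy', by rw [Set.mem_ofPred_eq, hrefl]; linarith⟩, ⟨y, hy, h⟩⟩
    · exact ⟨⟨y, hy, h⟩, ⟨_, hy', by rw [Set.mem_ofPred_eq, hrefl]; linarith⟩⟩
  have hPM : P ⊆ U₁ ∪ U₂ ∧ M ⊆ U₁ ∪ U₂ := by
    rcases h1 with h1 | h1 <;> rcases h2 with h2 | h2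
    · exact absurd ⟨h1, h2⟩ (hnoteq P hPo hPne.1)
    · exact ⟨h1.trans Set.subset_union_left, h2.trans Set.subset_union_right⟩
    · exact ⟨h2.trans Set.subset_union_right, h1.trans Set.subset_union_left⟩
    · exact absurd ⟨h1, h2⟩ (hnoteq M hMo hPne.2)
  have hballU : Metric.ball x r ⊆ U₁ ∪ U₂ := by
    intro y hy
    by_contra hyU
    have hop : IsOpen (Metric.ball x r ∩ (U₁ ∪ U₂)ᶜ) :=
      Metric.isOpen_ball.inter (hU₁.isClosed.union hU₂.isClosed).isOpen_compl
    obtain ⟨z, hz, hza⟩ := exists_area_ne_zero hpq hop ⟨y, hy, hyU⟩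
    rcases lt_or_gt_of_ne hza with h | h
    · exact hz.2 (hPM.2 ⟨hz.1, h⟩)
    · exact hz.2 (hPM.1 ⟨hz.1, h⟩)
  exact hx.2 (interior_maximal hballU Metric.isOpen_ball (Metric.mem_ball_self hr))

/-- Two triangulated regions are glued along a segment. The hypotheses `hw₁` and `hw₂` say that
neither outline lies inside the other region. -/
lemma BoundsTriangles.glue {k₁ k₂ : ℕ} {A₁ A₂ : Set (Fin 2 → ℝ)} {p q : Fin 2 → ℝ} (hpq : p ≠ q)
    (h₁ : BoundsTriangles k₁ (A₁ ∪ segment ℝ p q)) (h₂ : BoundsTriangles k₂ (A₂ ∪ segment ℝ p q))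
    (hA₁ : IsPreconnected A₁) (hA₂ : IsPreconnected A₂)
    (hd₁ : Disjoint A₁ (A₂ ∪ segment ℝ p q)) (hd₂ : Disjoint A₂ (A₁ ∪ segment ℝ p q))
    (hclosed : IsClosed (A₁ ∪ A₂ ∪ {p, q}))
    (hw₁ : ∀ U, IsCompact U → frontier U ⊆ A₂ ∪ segment ℝ p q → ∃ z ∈ A₁, z ∉ U)
    (hw₂ : ∀ U, IsCompact U → frontier U ⊆ A₁ ∪ segment ℝ p q → ∃ z ∈ A₂, z ∉ U) :
    BoundsTriangles (k₁ + k₂) (A₁ ∪ A₂ ∪ {p, q}) := by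
  obtain ⟨T₁, hT₁, hf₁, hb₁, hl₁⟩ := h₁
  obtain ⟨T₂, hT₂, hf₂, hb₂, hl₂⟩ := h₂
  have hc₁ := isCompact_iUnion_triangleSet T₁
  have hc₂ := isCompact_iUnion_triangleSet T₂
  obtain ⟨hinter, hint, hfr⟩ := region_gluing hpq hc₁ hc₂
    (iUnion_triangleSet_subset_closure_interior T₁)
    (iUnion_triangleSet_subset_closure_interior T₂) hf₁ hf₂
    (Set.subset_union_right.trans hb₁) (Set.subset_union_right.trans hb₂) hA₁ hA₂ hd₁ hd₂ hclosed
    (hw₁ _ hc₂ hf₂) (hw₂ _ hc₁ hf₁)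
  have hlog := hl₁.union hl₂ hc₁.isClosed hc₂.isClosed
    (hinter ▸ (convex_segment p q).isPreconnected)
  have hU : (⋃ i, triangleSet (Fin.append T₁ T₂ i)) =
      (⋃ i, triangleSet (T₁ i)) ∪ ⋃ i, triangleSet (T₂ i) := by
    ext x
    simp only [Set.mem_iUnion, Set.mem_union]
    constructor
    · rintro ⟨i, hi⟩
      induction i using Fin.addCases with
      | left i => left; exact ⟨i, by simpa using hi⟩
      | right i => right; exact ⟨i, by simpa using hi⟩
    · rintro (⟨i, hi⟩ | ⟨i, hi⟩)
      · exact ⟨Fin.castAdd k₂ i, by simpa using hi⟩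
      · exact ⟨Fin.natAdd k₁ i, by simpa using hi⟩
  refine ⟨Fin.append T₁ T₂, ?_, ?_, ?_, ?_⟩
  · have h12 : ∀ i j, Disjoint (interior (triangleSet (T₁ i))) (interior (triangleSet (T₂ j))) :=
      fun i j => hint.mono
        (interior_mono (Set.subset_iUnion (fun i => triangleSet (T₁ i)) i))
        (interior_mono (Set.subset_iUnion (fun i => triangleSet (T₂ i)) j))
    intro i j hij
    induction i using Fin.addCases with
    | left i =>
      induction j using Fin.addCases with
      | left j =>
        simp only [Fin.append_left]
        exact hT₁ i j fun h => hij (by rw [h])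
      | right j =>
        simp only [Fin.append_left, Fin.append_right]
        exact h12 i j
    | right i =>
      induction j using Fin.addCases with
      | left j =>
        simp only [Fin.append_left, Fin.append_right]
        exact (h12 j i).symm
      | right j =>
        simp only [Fin.append_right]
        exact hT₂ i j fun h => hij (by rw [h])
  · rw [hU]; exact hfr
  · rw [hU]
    refine Set.union_subset (Set.union_subset ?_ ?_) ?_
    · exact (Set.subset_union_left.trans hb₁).trans Set.subset_union_left
    · exact (Set.subset_union_left.trans hb₂).trans Set.subset_union_right
    · rintro x (rfl | rfl)
      · exact Or.inl (hb₁ (Or.inr (left_mem_segment ℝ _ _)))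
      · exact Or.inl (hb₁ (Or.inr (right_mem_segment ℝ _ _)))
  · rw [hU]; exact hlog

/-- The outline of a single triangle. -/
lemma boundsTriangles_triangle (p : Fin 3 → Fin 2 → ℝ) (hp : area (p 0) (p 1) (p 2) ≠ 0) :
    BoundsTriangles 1 (segment ℝ (p 0) (p 1) ∪ segment ℝ (p 1) (p 2) ∪ segment ℝ (p 2) (p 0)) := by
  let T : Affine.Triangle ℝ (Fin 2 → ℝ) := ⟨p, (affineIndependent_iff_area_ne_zero p).mpr hp⟩
  have hU : (⋃ _ : Fin 1, triangleSet T) = triangleSet T := Set.iUnion_const _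
  refine ⟨fun _ => T, fun i j hij => absurd (Subsingleton.elim i j) hij, ?_, ?_, ?_⟩
  · rw [hU]; exact frontier_triangleSet_subset T
  · rw [hU]
    have hm : ∀ i, p i ∈ triangleSet T := fun i => subset_convexHull ℝ _ (Set.mem_range_self i)
    have hc := convex_triangleSet T
    exact Set.union_subset (Set.union_subset (hc.segment_subset (hm 0) (hm 1))
      (hc.segment_subset (hm 1) (hm 2))) (hc.segment_subset (hm 2) (hm 0))
  · rw [hU]
    exact hasLog_of_convex (convex_triangleSet T) (isCompact_triangleSet T).isClosed

/-! ### Simple closed polygons as periodic sequences of vertices -/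

/-- The `i`-th edge of a polygonal curve. -/
def edge (w : ℕ → Fin 2 → ℝ) (i : ℕ) : Set (Fin 2 → ℝ) := segment ℝ (w i) (w (i + 1))

/-- The polygonal curve formed by the first `k` edges. -/
def arc (w : ℕ → Fin 2 → ℝ) (k : ℕ) : Set (Fin 2 → ℝ) := ⋃ i ∈ Set.Iio k, edge w i

/-- A simple closed polygon with `m` vertices, encoded as an `m`-periodic sequence of vertices, so
that every vertex may serve as the first one. -/
structure SimpleLoop (m : ℕ) (w : ℕ → Fin 2 → ℝ) : Prop where
  period : Function.Periodic w m
  ne : ∀ i, w i ≠ w (i + 1)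
  inter : ∀ i j, i < j → j < i + m → ∀ x ∈ edge w i, x ∈ edge w j →
    (j = i + 1 ∧ x = w j) ∨ (i + m = j + 1 ∧ x = w i)

/-- The sequence that starts at the `r`-th vertex. -/
def shift (w : ℕ → Fin 2 → ℝ) (r : ℕ) : ℕ → Fin 2 → ℝ := fun i => w (i + r)

/-- The closed polygon formed by the first `k` edges and the segment from `w k` back to `w 0`. -/
def cutOff (w : ℕ → Fin 2 → ℝ) (k : ℕ) : ℕ → Fin 2 → ℝ := fun i => w (i % (k + 1))

lemma mem_arc {w : ℕ → Fin 2 → ℝ} {k : ℕ} {x : Fin 2 → ℝ} :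
    x ∈ arc w k ↔ ∃ i < k, x ∈ edge w i := by
  simp [arc]

lemma left_mem_edge (w : ℕ → Fin 2 → ℝ) (i : ℕ) : w i ∈ edge w i := left_mem_segment ℝ _ _

lemma right_mem_edge (w : ℕ → Fin 2 → ℝ) (i : ℕ) : w (i + 1) ∈ edge w i := right_mem_segment ℝ _ _

lemma isClosed_arc (w : ℕ → Fin 2 → ℝ) (k : ℕ) : IsClosed (arc w k) :=
  (Set.finite_Iio k).isClosed_biUnion fun _ _ => isClosed_segment_plane _ _

lemma edge_shift (w : ℕ → Fin 2 → ℝ) (r i : ℕ) : edge (shift w r) i = edge w (i + r) := by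
  simp only [edge, shift, add_right_comm]

lemma arc_split (w : ℕ → Fin 2 → ℝ) {k m : ℕ} (hk : k ≤ m) :
    arc w m = arc w k ∪ arc (shift w k) (m - k) := by
  ext x
  simp only [Set.mem_union, mem_arc, edge_shift]
  constructor
  · rintro ⟨i, hi, hx⟩
    rcases lt_or_ge i k with h | h
    · exact Or.inl ⟨i, h, hx⟩
    · exact Or.inr ⟨i - k, by omega, by rwa [Nat.sub_add_cancel h]⟩
  · rintro (⟨i, hi, hx⟩ | ⟨i, hi, hx⟩)
    · exact ⟨i, by omega, hx⟩
    · exact ⟨i + k, by omega, hx⟩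

lemma edge_mod {m : ℕ} {w : ℕ → Fin 2 → ℝ} (hw : Function.Periodic w m) (i : ℕ) :
    edge w i = edge w (i % m) := by
  have h := fun a => (hw.nat_mul (i / m)) a
  have h1 := h (i % m)
  have h2 := h (i % m + 1)
  have e : i % m + i / m * m = i := by rw [mul_comm]; exact Nat.mod_add_div i m
  simp only [Nat.cast_id] at h1 h2
  rw [e] at h1
  rw [add_right_comm, e] at h2
  simp only [edge, h1, h2]

lemma arc_shift {m : ℕ} (hm : 0 < m) {w : ℕ → Fin 2 → ℝ} (hw : Function.Periodic w m) (r : ℕ) :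
    arc (shift w r) m = arc w m := by
  ext x
  simp only [mem_arc, edge_shift]
  constructor
  · rintro ⟨i, -, hx⟩
    exact ⟨(i + r) % m, Nat.mod_lt _ hm, by rwa [← edge_mod hw]⟩
  · rintro ⟨j, hj, hx⟩
    refine ⟨(j + r * (m - 1)) % m, Nat.mod_lt _ hm, ?_⟩
    have : ((j + r * (m - 1)) % m + r) % m = j := by
      rw [Nat.mod_add_mod]
      have : j + r * (m - 1) + r = j + m * r := by
        obtain ⟨l, rfl⟩ : ∃ l, m = l + 1 := ⟨m - 1, by omega⟩
        rw [Nat.add_sub_cancel]; ring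
      rw [this, Nat.add_mul_mod_self_left, Nat.mod_eq_of_lt hj]
    rwa [edge_mod hw, this]

namespace SimpleLoop

variable {m : ℕ} {w : ℕ → Fin 2 → ℝ}

lemma shift (hw : SimpleLoop m w) (r : ℕ) : SimpleLoop m (shift w r) := by
  refine ⟨fun i => ?_, fun i => ?_, fun i j hij hjm x hx hx' => ?_⟩
  · simp only [WAM.shift, add_right_comm i m r]
    exact hw.period _
  · simp only [WAM.shift, add_right_comm i 1 r]
    exact hw.ne _
  · rw [edge_shift] at hx hx'
    rcases hw.inter (i + r) (j + r) (by omega) (by omega) x hx hx' with h | h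
    · exact Or.inl ⟨by omega, h.2⟩
    · exact Or.inr ⟨by omega, h.2⟩

/-- It suffices to know how the first `m` edges meet. -/
lemma of_base (hm : 0 < m) (hp : Function.Periodic w m) (hne : ∀ i < m, w i ≠ w (i + 1))
    (hinter : ∀ i j, i < j → j < m → ∀ x ∈ edge w i, x ∈ edge w j →
      (j = i + 1 ∧ x = w j) ∨ (i + m = j + 1 ∧ x = w i)) : SimpleLoop m w := by
  have hadd : ∀ i c, w (i + c * m) = w i := fun i c => by simpa using hp.nat_mul c i
  have key : ∀ i j, i < m → i < j → j < i + m → ∀ x ∈ edge w i, x ∈ edge w j →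
      (j = i + 1 ∧ x = w j) ∨ (i + m = j + 1 ∧ x = w i) := by
    intro i j hi hij hjm x hx hx'
    rcases lt_or_ge j m with h | h
    · exact hinter i j hij h x hx hx'
    · obtain ⟨l, rfl⟩ : ∃ l, j = l + m := ⟨j - m, by omega⟩
      have e : edge w (l + m) = edge w l := by
        rw [edge_mod hp, Nat.add_mod_right, ← edge_mod hp]
      rw [e] at hx'
      rcases hinter l i (by omega) hi x hx' hx with h | h
      · exact Or.inr ⟨by omega, h.2⟩
      · exact Or.inl ⟨by omega, by rw [hp l]; exact h.2⟩
  refine ⟨hp, fun i => ?_, fun i j hij hjm x hx hx' => ?_⟩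
  · have h := hne (i % m) (Nat.mod_lt _ hm)
    rw [← hadd (i % m) (i / m), ← hadd (i % m + 1) (i / m)] at h
    have e : i % m + i / m * m = i := by rw [mul_comm]; exact Nat.mod_add_div i m
    rwa [add_right_comm, e] at h
  · have e : i % m + i / m * m = i := by rw [mul_comm]; exact Nat.mod_add_div i m
    have hlt := Nat.mod_lt i hm
    obtain ⟨l, hl⟩ : ∃ l, j = l + i / m * m := ⟨j - i / m * m, by omega⟩
    have e1 : edge w i = edge w (i % m) := edge_mod hp i
    have e2 : edge w j = edge w l := by
      rw [edge_mod hp, hl, Nat.add_mul_mod_self_right, ← edge_mod hp]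
    rw [e1] at hx
    rw [e2] at hx'
    have hwi : w i = w (i % m) := by conv_lhs => rw [← e, hadd]
    have hwj : w j = w l := by rw [hl, hadd]
    rcases key (i % m) l hlt (by omega) (by omega) x hx hx' with h | h
    · exact Or.inl ⟨by omega, by rw [hwj]; exact h.2⟩
    · exact Or.inr ⟨by omega, by rw [hwi]; exact h.2⟩

/-- A vertex lies only on the two edges that end there. -/
lemma eq_of_mem_edge (hw : SimpleLoop m w) {i j : ℕ} (hij : i < j) (hj : j < i + m)
    (h : w j ∈ edge w i) : j = i + 1 := by
  rcases hw.inter i j hij hj (w j) h (left_mem_edge w j) with h' | h'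
  · exact h'.1
  · exfalso
    apply hw.ne j
    rw [h'.2, ← h'.1, hw.period]

lemma vertex_ne (hw : SimpleLoop m w) {i j : ℕ} (hij : i < j) (hj : j < i + m) : w j ≠ w i := by
  intro h
  have := hw.eq_of_mem_edge hij hj (h ▸ left_mem_edge w i)
  subst this
  exact hw.ne i h.symm

lemma w_m (hw : SimpleLoop m w) : w m = w 0 := by simpa using hw.period 0

lemma isPreconnected_arc_diff (hw : SimpleLoop m w) {k : ℕ} (hkm : k < m) :
    IsPreconnected (arc w k \ {w 0, w k}) := by
  have e : arc w k \ {w 0, w k} = ⋃ i ∈ Set.Iio k, (edge w i \ {w 0, w k}) := by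
    simp only [arc, Set.iUnion_sdiff]
  rw [e]
  refine IsPreconnected.biUnion_of_chain Set.ordConnected_Iio (fun i hi => ?_) (fun i hi hi' => ?_)
  · rw [Set.mem_Iio] at hi
    refine (convex_openSegment (𝕜 := ℝ) (w i) (w (i + 1))).isPreconnected.subset_closure ?_
      (Set.sdiff_subset.trans segment_subset_closure_openSegment)
    have hend : ∀ c, (c ∈ edge w i → c = w i ∨ c = w (i + 1)) →
        c ∉ openSegment ℝ (w i) (w (i + 1)) := by
      intro c hc hmem
      rcases hc (openSegment_subset_segment ℝ _ _ hmem) with rfl | h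
      · exact hw.ne i (left_mem_openSegment_iff.mp hmem)
      · rw [h] at hmem
        exact hw.ne i (right_mem_openSegment_iff.mp hmem)
    intro x hx
    refine ⟨openSegment_subset_segment ℝ _ _ hx, ?_⟩
    rintro (rfl | h)
    · refine hend _ (fun h => ?_) hx
      rcases Nat.eq_zero_or_pos i with rfl | hi0
      · exact Or.inl rfl
      · right
        rw [← hw.w_m] at h ⊢
        rw [hw.eq_of_mem_edge (by omega) (by omega) h]
    · rw [Set.mem_singleton_iff] at h
      rw [h] at hx
      refine hend _ (fun h => ?_) hx
      right
      rw [hw.eq_of_mem_edge (by omega) (by omega) h]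
  · rw [Set.mem_Iio, Order.succ_eq_add_one] at hi'
    refine ⟨w (i + 1), ⟨right_mem_edge w i, ?_⟩, ⟨left_mem_edge w _, ?_⟩⟩ <;>
    · rintro (h | h)
      · exact hw.vertex_ne (by omega) (by omega) h
      · exact hw.vertex_ne (i := i + 1) (j := k) (by omega) (by omega) (by
          rw [Set.mem_singleton_iff] at h; exact h.symm)

lemma arc_inter_arc_shift (hw : SimpleLoop m w) {k : ℕ} {x : Fin 2 → ℝ}
    (hx : x ∈ arc w k) (hx' : x ∈ arc (WAM.shift w k) (m - k)) : x = w 0 ∨ x = w k := by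
  obtain ⟨i, hi, hxi⟩ := mem_arc.mp hx
  obtain ⟨j, hj, hxj⟩ := mem_arc.mp hx'
  rw [edge_shift] at hxj
  rcases hw.inter i (j + k) (by omega) (by omega) x hxi hxj with h | h
  · right
    obtain rfl : j = 0 := by omega
    rw [h.2, zero_add]
  · left
    obtain rfl : i = 0 := by omega
    exact h.2

lemma cutOff_of_le {k i : ℕ} (h : i ≤ k) : cutOff w k i = w i := by
  rw [cutOff, Nat.mod_eq_of_lt (by omega)]

lemma cutOff_last {k : ℕ} : cutOff w k (k + 1) = w 0 := by
  rw [cutOff, Nat.mod_self]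

lemma edge_cutOff_of_lt {k i : ℕ} (h : i < k) : edge (cutOff w k) i = edge w i := by
  rw [edge, cutOff_of_le h.le, cutOff_of_le h, edge]

lemma edge_cutOff_last {k : ℕ} : edge (cutOff w k) k = segment ℝ (w 0) (w k) := by
  rw [edge, cutOff_of_le le_rfl, cutOff_last, segment_symm]

lemma arc_cutOff (k : ℕ) : arc (cutOff w k) (k + 1) = arc w k ∪ segment ℝ (w 0) (w k) := by
  ext x
  rw [Set.mem_union, mem_arc, mem_arc]
  constructor
  · rintro ⟨i, hi, hx⟩
    rcases (Nat.lt_succ_iff.mp hi).lt_or_eq with h | rfl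
    · exact Or.inl ⟨i, h, by rwa [edge_cutOff_of_lt h] at hx⟩
    · exact Or.inr (by rwa [edge_cutOff_last] at hx)
  · rintro (⟨i, hi, hx⟩ | hx)
    · exact ⟨i, by omega, by rwa [edge_cutOff_of_lt hi]⟩
    · exact ⟨k, by omega, by rwa [edge_cutOff_last]⟩

/-- Cutting along a diagonal leaves a simple closed polygon. -/
lemma cutOff_simple (hw : SimpleLoop m w) {k : ℕ} (hk : 2 ≤ k) (hkm : k + 2 ≤ m)
    (hdiag : ∀ x ∈ segment ℝ (w 0) (w k), x ∈ arc w m → x = w 0 ∨ x = w k) :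
    SimpleLoop (k + 1) (cutOff w k) := by
  refine of_base (by omega) (fun i => ?_) (fun i hi => ?_) (fun i j hij hj x hx hx' => ?_)
  · simp [cutOff]
  · rcases (Nat.lt_succ_iff.mp hi).lt_or_eq with h | rfl
    · rw [cutOff_of_le h.le, cutOff_of_le h]; exact hw.ne i
    · rw [cutOff_of_le le_rfl, cutOff_last]
      exact hw.vertex_ne (by omega) (by omega)
  · have hik : i < k := by omega
    rw [edge_cutOff_of_lt hik] at hx
    rw [cutOff_of_le (show i ≤ k by omega), cutOff_of_le (show j ≤ k by omega)]
    rcases (Nat.lt_succ_iff.mp hj).lt_or_eq with h | rfl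
    · rw [edge_cutOff_of_lt h] at hx'
      rcases hw.inter i j hij (by omega) x hx hx' with h' | h'
      · exact Or.inl h'
      · omega
    · rw [edge_cutOff_last] at hx'
      rcases hdiag x hx' (mem_arc.mpr ⟨i, by omega, hx⟩) with rfl | rfl
      · right
        rcases Nat.eq_zero_or_pos i with rfl | h0
        · exact ⟨by omega, rfl⟩
        · rw [← hw.w_m] at hx
          have := hw.eq_of_mem_edge (by omega) (by omega) hx
          omega
      · left
        exact ⟨hw.eq_of_mem_edge (by omega) (by omega) hx, rfl⟩

/-- The two polygons cut off by an inner diagonal are glued along it. -/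
lemma boundsTriangles_of_diagonal (hw : SimpleLoop m w) {k : ℕ} (hk : 2 ≤ k) (hkm : k + 2 ≤ m)
    (hdiag : ∀ x ∈ segment ℝ (w 0) (w k), x ∈ arc w m → x = w 0 ∨ x = w k)
    (hw₁ : ∀ U, IsCompact U → frontier U ⊆ arc (WAM.shift w k) (m - k) ∪ segment ℝ (w 0) (w k) →
      ∃ z ∈ arc w k, z ≠ w 0 ∧ z ≠ w k ∧ z ∉ U)
    (hw₂ : ∀ U, IsCompact U → frontier U ⊆ arc w k ∪ segment ℝ (w 0) (w k) →
      ∃ z ∈ arc (WAM.shift w k) (m - k), z ≠ w 0 ∧ z ≠ w k ∧ z ∉ U)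
    (ih : ∀ m' < m, 3 ≤ m' → ∀ w', SimpleLoop m' w' → BoundsTriangles (m' - 2) (arc w' m')) :
    BoundsTriangles (m - 2) (arc w m) := by
  set w' := WAM.shift w k with hw'
  have hsl : SimpleLoop m w' := hw.shift k
  have h0 : w' 0 = w k := by simp [hw', WAM.shift]
  have hm : w' (m - k) = w 0 := by
    rw [← hw.w_m, hw', WAM.shift, Nat.sub_add_cancel (by omega)]
  have h₁ := ih (k + 1) (by omega) (by omega) _ (hw.cutOff_simple hk hkm hdiag)
  have h₂ := ih (m - k + 1) (by omega) (by omega) _ (hsl.cutOff_simple (k := m - k) (by omega)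
    (by omega) (fun x hx hx' => by
      rw [h0, hm, segment_symm] at hx
      rw [hw', arc_shift (by omega) hw.period] at hx'
      rw [h0, hm]
      exact (hdiag x hx hx').symm))
  rw [arc_cutOff] at h₁ h₂
  rw [h0, hm, segment_symm] at h₂
  have hpair : ({w 0, w k} : Set (Fin 2 → ℝ)) ⊆ segment ℝ (w 0) (w k) := by
    rintro x (rfl | rfl)
    · exact left_mem_segment ℝ _ _
    · exact right_mem_segment ℝ _ _
  have hun : ∀ S : Set (Fin 2 → ℝ), S \ {w 0, w k} ∪ segment ℝ (w 0) (w k) =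
      S ∪ segment ℝ (w 0) (w k) := by
    intro S
    ext x
    have := @hpair x
    simp only [Set.mem_union, Set.mem_sdiff]
    tauto
  have hall : arc w k \ {w 0, w k} ∪ arc w' (m - k) \ {w 0, w k} ∪ {w 0, w k} = arc w m := by
    rw [arc_split w (show k ≤ m by omega), ← hw']
    have h0k : w 0 ∈ arc w k := mem_arc.mpr ⟨0, by omega, left_mem_edge w 0⟩
    have hkk : w k ∈ arc w k := mem_arc.mpr ⟨k - 1, by omega, by
      have := right_mem_edge w (k - 1)
      rwa [Nat.sub_add_cancel (by omega)] at this⟩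
    have hp : ({w 0, w k} : Set (Fin 2 → ℝ)) ⊆ arc w k := by
      rintro x (rfl | rfl) <;> assumption
    ext x
    have := @hp x
    simp only [Set.mem_union, Set.mem_sdiff]
    by_cases hx : x ∈ ({w 0, w k} : Set (Fin 2 → ℝ))
    · exact iff_of_true (Or.inr hx) (Or.inl (this hx))
    · simp only [hx, not_false_eq_true, and_true, or_false]
  have hgl := BoundsTriangles.glue (k₁ := k + 1 - 2) (k₂ := m - k + 1 - 2)
    (A₁ := arc w k \ {w 0, w k}) (A₂ := arc w' (m - k) \ {w 0, w k}) (p := w 0) (q := w k)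
    (hw.vertex_ne (by omega) (by omega)).symm (by rwa [hun]) (by rwa [hun])
    (hw.isPreconnected_arc_diff (by omega)) (by
      have := hsl.isPreconnected_arc_diff (k := m - k) (by omega)
      rwa [h0, hm, Set.pair_comm] at this) ?_ ?_ ?_ ?_ ?_
  · rw [hall] at hgl
    rwa [show m - 2 = k + 1 - 2 + (m - k + 1 - 2) by omega]
  · rw [Set.disjoint_left]
    rintro x ⟨hx, hxp⟩ (hx' | hx')
    · exact hxp (hw.arc_inter_arc_shift hx hx'.1)
    · refine hxp (hdiag x hx' ?_)
      rw [arc_split w (show k ≤ m by omega)]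
      exact Or.inl hx
  · rw [Set.disjoint_left]
    rintro x ⟨hx, hxp⟩ (hx' | hx')
    · exact hxp (hw.arc_inter_arc_shift hx'.1 hx)
    · refine hxp (hdiag x hx' ?_)
      rw [arc_split w (show k ≤ m by omega)]
      exact Or.inr hx
  · rw [hall]
    exact isClosed_arc w m
  · intro U hU hf
    rw [hun] at hf
    obtain ⟨z, hz, hz0, hzk, hzU⟩ := hw₁ U hU hf
    exact ⟨z, ⟨hz, by rintro (h | h); exacts [hz0 h, hzk h]⟩, hzU⟩
  · intro U hU hf
    rw [hun] at hf
    obtain ⟨z, hz, hz0, hzk, hzU⟩ := hw₂ U hU hf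
    exact ⟨z, ⟨hz, by rintro (h | h); exacts [hz0 h, hzk h]⟩, hzU⟩

end SimpleLoop

/-! ### Diagonals of a simple closed polygon -/

lemma mem_segment_of_area_eq_zero (f : (Fin 2 → ℝ) →L[ℝ] ℝ) {v a b : Fin 2 → ℝ} (hb : f b < f v)
    (hab : f b ≤ f a) (ha : f a < f v) (h : area v a b = 0) : a ∈ segment ℝ v b := by
  have h0 : f b - f v ≠ 0 := by linarith
  obtain ⟨c, d, hf⟩ := continuousLinearMap_plane f
  rw [segment_eq_image_lineMap]
  refine ⟨(f a - f v) / (f b - f v), ⟨?_, ?_⟩, ?_⟩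
  · exact div_nonneg_of_nonpos (by linarith) (by linarith)
  · rw [div_le_one_of_neg (by linarith)]
    linarith
  · have key : ∀ i, (f b - f v) * (a i - v i) = (f a - f v) * (b i - v i) := by
      intro i
      rw [hf a, hf b, hf v]
      simp only [area] at h
      fin_cases i
      · simp only [Fin.zero_eta]
        linear_combination d * h
      · simp only [Fin.mk_one]
        linear_combination -c * h
    funext i
    simp only [AffineMap.lineMap_apply, vsub_eq_sub, vadd_eq_add, Pi.add_apply, Pi.smul_apply,
      Pi.sub_apply, smul_eq_mul]
    rw [div_mul_eq_mul_div, ← key i, mul_div_cancel_left₀ _ h0]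
    ring

lemma area_ne_zero_of_lt (f : (Fin 2 → ℝ) →L[ℝ] ℝ) {v a b : Fin 2 → ℝ} (ha : f a < f v)
    (hb : f b < f v) (h₁ : a ∉ segment ℝ v b) (h₂ : b ∉ segment ℝ v a) : area v a b ≠ 0 := by
  intro h
  rcases le_total (f b) (f a) with hle | hle
  · exact h₁ (mem_segment_of_area_eq_zero f hb hle ha h)
  · refine h₂ (mem_segment_of_area_eq_zero f ha hle hb ?_)
    simp only [area] at h ⊢
    linarith

/-- An endpoint of a segment is extreme. -/
lemma eq_or_eq_of_right_mem_segment {c d x y : Fin 2 → ℝ} (hcd : c ≠ d) (hx : x ∈ segment ℝ c d)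
    (hy : y ∈ segment ℝ c d) (h : d ∈ segment ℝ x y) : d = x ∨ d = y := by
  rw [segment_eq_image_lineMap] at hx hy h
  obtain ⟨s, hs, rfl⟩ := hx
  obtain ⟨t, ht, rfl⟩ := hy
  obtain ⟨u, hu, hd⟩ := h
  have hd' : AffineMap.lineMap c d ((1 - u) * s + u * t) = AffineMap.lineMap c d (1 : ℝ) := by
    rw [AffineMap.lineMap_apply_one]
    conv_rhs => rw [← hd]
    simp only [AffineMap.lineMap_apply_module]
    module
  have h1 := AffineMap.lineMap_injective ℝ hcd hd'
  have h2 : (1 - u) * (1 - s) + u * (1 - t) = 0 := by linarith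
  have h3 : 0 ≤ (1 - u) * (1 - s) := mul_nonneg (by linarith [hu.2]) (by linarith [hs.2])
  have h4 : 0 ≤ u * (1 - t) := mul_nonneg hu.1 (by linarith [ht.2])
  rcases mul_eq_zero.mp (show (1 - u) * (1 - s) = 0 by linarith) with h5 | h5
  · right
    rcases mul_eq_zero.mp (show u * (1 - t) = 0 by linarith) with h6 | h6
    · linarith
    · rw [show t = 1 by linarith, AffineMap.lineMap_apply_one]
  · left
    rw [show s = 1 by linarith, AffineMap.lineMap_apply_one]

/-- A bounded set whose frontier reaches `v` only along the segments from `v` to `b` and to `q`,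
where `q` lies in the angle between `a` and `b` at `v`, omits points of the segment from `v` to `a`
near `v`: from such a point one escapes in the direction of `v - q` into the half-plane
`f > f v`. -/
lemma exists_lineMap_notMem (f : (Fin 2 → ℝ) →L[ℝ] ℝ) {v a b q : Fin 2 → ℝ} {α β : ℝ}
    (hA : area v a b ≠ 0) (ha : f a < f v) (hb : f b < f v) (hα : 0 < α) (hβ : 0 < β)
    (hq : q = (1 - α - β) • v + α • a + β • b) {U R : Set (Fin 2 → ℝ)} (hU : Bornology.IsBounded U)
    (hR : IsClosed R) (hvR : v ∉ R) (hfR : ∀ x ∈ R, f x ≤ f v)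
    (hfr : frontier U ⊆ segment ℝ v b ∪ segment ℝ v q ∪ R) :
    ∃ t : ℝ, 0 < t ∧ t < 1 ∧ AffineMap.lineMap v a t ∉ U := by
  set p : Fin 3 → Fin 2 → ℝ := ![v, a, b] with hp
  have hA' : area (p 0) (p 1) (p 2) ≠ 0 := hA
  have hfq : f q ≤ f v := by
    rw [hq]
    simp only [map_add, map_smul, smul_eq_mul]
    nlinarith
  have hUf : U ⊆ {x | f x ≤ f v} := by
    have hc : Convex ℝ {x | f x ≤ f v} := convex_halfSpace_le f.isLinear (f v)
    refine subset_of_frontier_subset_convex hU hc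
      (isClosed_le f.continuous continuous_const) (hfr.trans ?_)
    rintro x ((hx | hx) | hx)
    · exact hc.segment_subset (x := v) (y := b) (le_refl (f v)) hb.le hx
    · exact hc.segment_subset (x := v) (y := q) (le_refl (f v)) hfq hx
    · exact hfR x hx
  obtain ⟨δ, hδ, hball⟩ := Metric.isOpen_iff.mp hR.isOpen_compl v hvR
  set c := β / α with hc
  have hc0 : 0 < c := div_pos hβ hα
  set M := ‖a - v‖ + 2 * c * ‖b - v‖ + 1 with hM
  have hM0 : 0 < M := by positivity
  set ε := min (1 / 2) (δ / (2 * M)) with hε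
  have hε0 : 0 < ε := lt_min (by norm_num) (by positivity)
  have hε1 : ε < 1 := (min_le_left _ _).trans_lt (by norm_num)
  have hεM : ε * M < δ := by
    have : ε * M ≤ δ / (2 * M) * M := mul_le_mul_of_nonneg_right (min_le_right _ _) hM0.le
    have e : δ / (2 * M) * M = δ / 2 := by field_simp
    linarith
  set γ : ℝ → Fin 2 → ℝ := fun τ =>
    (1 - ε * (1 - τ) - (-(ε * τ * c))) • v + (ε * (1 - τ)) • a + (-(ε * τ * c)) • b with hγ
  have hγc : Continuous γ := by fun_prop
  refine ⟨ε, hε0, hε1, ?_⟩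
  have hγ0 : γ 0 = AffineMap.lineMap v a ε := by
    simp only [hγ, AffineMap.lineMap_apply_module]
    module
  rw [← hγ0]
  have hpre : IsPreconnected (γ '' Set.Icc 0 2) := isPreconnected_Icc.image γ hγc.continuousOn
  refine notMem_of_isPreconnected (z := γ 2) hpre ?_
    (Set.mem_image_of_mem γ (by norm_num)) ?_ (γ 0) (Set.mem_image_of_mem γ (by norm_num))
  · rintro _ ⟨τ, ⟨hτ0, hτ2⟩, rfl⟩ hmem
    obtain ⟨-, h1, h2⟩ := bary_of_combo p hA' (1 - ε * (1 - τ) - (-(ε * τ * c))) (ε * (1 - τ))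
      (-(ε * τ * c)) (by ring)
    change bary p 1 (γ τ) = _ at h1
    change bary p 2 (γ τ) = _ at h2
    rcases hfr hmem with (hx | hx) | hx
    · obtain ⟨s, u, hs, hu, hsu, hx⟩ := hx
      obtain ⟨-, h1', h2'⟩ := bary_of_combo p hA' s 0 u (by linarith)
      have e : s • p 0 + (0 : ℝ) • p 1 + u • p 2 = γ τ := by
        rw [← hx, zero_smul, add_zero]; rfl
      rw [e] at h1' h2'
      have h3 : ε * τ * c = 0 := by
        have : 0 ≤ ε * τ * c := by positivity
        linarith
      have h4 : τ = 0 := by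
        rcases mul_eq_zero.mp h3 with h | h
        · exact (mul_eq_zero.mp h).resolve_left hε0.ne'
        · exact absurd h hc0.ne'
      rw [h4] at h1 h1'
      linarith
    · obtain ⟨s, u, hs, hu, hsu, hx⟩ := hx
      obtain ⟨-, h1', h2'⟩ := bary_of_combo p hA' (s + u * (1 - α - β)) (u * α) (u * β)
        (by linear_combination hsu)
      have e : (s + u * (1 - α - β)) • p 0 + (u * α) • p 1 + (u * β) • p 2 = γ τ := by
        rw [← hx, hq]
        change (s + u * (1 - α - β)) • v + (u * α) • a + (u * β) • b = _
        module
      rw [e] at h1' h2'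
      have h3 : 0 ≤ ε * τ * c := by positivity
      have h3' : 0 ≤ u * β := by positivity
      have h4 : τ = 0 := by
        have h3 : ε * τ * c = 0 := by linarith
        rcases mul_eq_zero.mp h3 with h | h
        · exact (mul_eq_zero.mp h).resolve_left hε0.ne'
        · exact absurd h hc0.ne'
      have h5 : u = 0 := (mul_eq_zero.mp (show u * β = 0 by linarith)).resolve_right hβ.ne'
      rw [h4] at h1
      rw [h4, h5] at h1'
      linarith
    · refine hball ?_ hx
      rw [mem_ball_iff_norm]
      have e : γ τ - v = ε • ((1 - τ) • (a - v) - (τ * c) • (b - v)) := by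
        simp only [hγ]
        module
      rw [e, norm_smul, Real.norm_of_nonneg hε0.le]
      refine lt_of_le_of_lt (mul_le_mul_of_nonneg_left ?_ hε0.le) hεM
      refine (norm_sub_le _ _).trans ?_
      rw [norm_smul, norm_smul, Real.norm_eq_abs, Real.norm_of_nonneg (by positivity)]
      have h6 : |1 - τ| ≤ 1 := abs_le.mpr ⟨by linarith, by linarith⟩
      have h7 : |1 - τ| * ‖a - v‖ ≤ ‖a - v‖ := mul_le_of_le_one_left (norm_nonneg _) h6
      have h8 : τ * c * ‖b - v‖ ≤ 2 * c * ‖b - v‖ := by gcongr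
      linarith
  · intro hmem
    have h := hUf hmem
    simp only [hγ, Set.mem_ofPred_eq, map_add, map_smul, smul_eq_mul] at h
    have h1 : 0 < ε * (f v - f a) := mul_pos hε0 (by linarith)
    have h2 : 0 < ε * c * (f v - f b) := mul_pos (by positivity) (by linarith)
    nlinarith

namespace SimpleLoop

variable {m : ℕ} {w : ℕ → Fin 2 → ℝ}

/-- Some vertex is strictly exposed: a vertex of largest Euclidean norm. -/
lemma exists_exposed (hw : SimpleLoop m w) (hm : 0 < m) :
    ∃ r, ∃ f : (Fin 2 → ℝ) →L[ℝ] ℝ, ∀ i, 0 < i → i < m →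
      f (WAM.shift w r i) < f (WAM.shift w r 0) := by
  set N : ℕ → ℝ := fun i => w i 0 ^ 2 + w i 1 ^ 2 with hN
  obtain ⟨r, -, hr⟩ := Finset.exists_max_image (Finset.range m) N ⟨0, by simpa using hm⟩
  have hr' : ∀ i, N i ≤ N r := by
    intro i
    have e : w i = w (i % m) := (hw.period.map_mod_nat i).symm
    have := hr (i % m) (by simpa using Nat.mod_lt i hm)
    simpa only [hN, e] using this
  refine ⟨r, (w r 0) • ContinuousLinearMap.proj 0 + (w r 1) • ContinuousLinearMap.proj 1,
    fun i hi him => ?_⟩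
  have hne : w (i + r) ≠ w r := hw.vertex_ne (by omega) (by omega)
  have h := hr' (i + r)
  simp only [WAM.shift, zero_add, hN, add_apply, smul_apply,
    ContinuousLinearMap.proj_apply, smul_eq_mul] at h ⊢
  have hpos : 0 < (w (i + r) 0 - w r 0) ^ 2 + (w (i + r) 1 - w r 1) ^ 2 := by
    by_contra hcon
    apply hne
    have h1 : w (i + r) 0 - w r 0 = 0 := by
      nlinarith [sq_nonneg (w (i + r) 0 - w r 0), sq_nonneg (w (i + r) 1 - w r 1)]
    have h2 : w (i + r) 1 - w r 1 = 0 := by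
      nlinarith [sq_nonneg (w (i + r) 0 - w r 0), sq_nonneg (w (i + r) 1 - w r 1)]
    funext j
    fin_cases j
    · simp only [Fin.zero_eta]; linarith
    · simp only [Fin.mk_one]; linarith
  nlinarith

lemma edge_last (hw : SimpleLoop m w) (hm : 0 < m) :
    edge w (m - 1) = segment ℝ (w 0) (w (m - 1)) := by
  rw [edge, Nat.sub_add_cancel hm, hw.w_m, segment_symm]

lemma area_ne_zero (hw : SimpleLoop m w) (hm : 3 ≤ m) (f : (Fin 2 → ℝ) →L[ℝ] ℝ)
    (hf : ∀ i, 0 < i → i < m → f (w i) < f (w 0)) : area (w 0) (w 1) (w (m - 1)) ≠ 0 := by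
  refine area_ne_zero_of_lt f (hf 1 (by omega) (by omega)) (hf (m - 1) (by omega) (by omega))
    (fun h => ?_) (fun h => ?_)
  · rw [← hw.edge_last (by omega), ← hw.period 1] at h
    have := hw.eq_of_mem_edge (i := m - 1) (j := 1 + m) (by omega) (by omega) h
    omega
  · have := hw.eq_of_mem_edge (i := 0) (j := m - 1) (by omega) (by omega) h
    omega

end SimpleLoop

/-! ### Existence of a diagonal and of a triangulation -/

lemma bary_vertex (p : Fin 3 → Fin 2 → ℝ) (hp : area (p 0) (p 1) (p 2) ≠ 0) (i j : Fin 3) :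
    bary p i (p j) = if i = j then 1 else 0 := by
  obtain ⟨a0, a1, a2⟩ := bary_of_combo p hp 1 0 0 (by norm_num)
  obtain ⟨b0, b1, b2⟩ := bary_of_combo p hp 0 1 0 (by norm_num)
  obtain ⟨c0, c1, c2⟩ := bary_of_combo p hp 0 0 1 (by norm_num)
  simp only [one_smul, zero_smul, add_zero, zero_add] at a0 a1 a2 b0 b1 b2 c0 c1 c2
  fin_cases i <;> fin_cases j <;> assumption

lemma mem_segment_of_bary_one {p : Fin 3 → Fin 2 → ℝ} (hp : area (p 0) (p 1) (p 2) ≠ 0)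
    {x : Fin 2 → ℝ} (h0 : 0 ≤ bary p 0 x) (h1 : bary p 1 x = 0) (h2 : 0 ≤ bary p 2 x) :
    x ∈ segment ℝ (p 0) (p 2) := by
  refine ⟨bary p 0 x, bary p 2 x, h0, h2, by linarith [bary_sum p hp x], ?_⟩
  conv_rhs => rw [bary_combo p hp x, h1, zero_smul, add_zero]

lemma mem_segment_of_bary_two {p : Fin 3 → Fin 2 → ℝ} (hp : area (p 0) (p 1) (p 2) ≠ 0)
    {x : Fin 2 → ℝ} (h0 : 0 ≤ bary p 0 x) (h1 : 0 ≤ bary p 1 x) (h2 : bary p 2 x = 0) :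
    x ∈ segment ℝ (p 0) (p 1) := by
  refine ⟨bary p 0 x, bary p 1 x, h0, h1, by linarith [bary_sum p hp x], ?_⟩
  conv_rhs => rw [bary_combo p hp x, h2, zero_smul, add_zero]

lemma exists_bary_ge {p : Fin 3 → Fin 2 → ℝ} (i : Fin 3) {c d x : Fin 2 → ℝ}
    (hx : x ∈ segment ℝ c d) : bary p i x ≤ bary p i c ∨ bary p i x ≤ bary p i d := by
  rw [segment_eq_image_lineMap] at hx
  obtain ⟨t, ⟨ht0, ht1⟩, rfl⟩ := hx
  rw [bary_lineMap]
  rcases le_total (bary p i c) (bary p i d) with h | h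
  · right
    nlinarith
  · left
    nlinarith

namespace SimpleLoop

variable {m : ℕ} {w : ℕ → Fin 2 → ℝ}

/-- The vertex `w 0` and its two neighbours, in this order: `bary (corner m w) 0` vanishes on the
line through the neighbours. -/
def corner (m : ℕ) (w : ℕ → Fin 2 → ℝ) : Fin 3 → Fin 2 → ℝ := ![w 0, w 1, w (m - 1)]

/-- An edge that enters the cone of the corner at `w 0` cannot leave it through the two edges
meeting at `w 0`, so it can leave the triangle only across its third side. -/
lemma bary_nonneg_of_mem_edge (hw : SimpleLoop m w) (hm : 3 ≤ m)
    (hA : area (w 0) (w 1) (w (m - 1)) ≠ 0) {i : ℕ} (hi : 1 ≤ i) (him : i + 2 ≤ m)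
    {x y : Fin 2 → ℝ} (hx : x ∈ edge w i) (hy : y ∈ edge w i)
    (hx0 : 0 ≤ bary (corner m w) 0 x) (hx1 : 0 < bary (corner m w) 1 x)
    (hx2 : 0 < bary (corner m w) 2 x) (hy0 : 0 ≤ bary (corner m w) 0 y) :
    0 ≤ bary (corner m w) 1 y ∧ 0 ≤ bary (corner m w) 2 y := by
  set p := corner m w with hp
  have hA' : area (p 0) (p 1) (p 2) ≠ 0 := hA
  by_contra hcon
  set g : ℝ → ℝ := fun t => min (bary p 1 (AffineMap.lineMap x y t))
    (bary p 2 (AffineMap.lineMap x y t)) with hg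
  have hgc : Continuous g := by
    simp only [hg, bary_lineMap]
    fun_prop
  have hg0 : 0 ≤ g 0 := by simp [hg, hx1.le, hx2.le]
  have hg1 : g 1 ≤ 0 := by
    simp only [hg, AffineMap.lineMap_apply_one, min_le_iff]
    rw [not_and_or, not_le, not_le] at hcon
    exact hcon.imp le_of_lt le_of_lt
  obtain ⟨t, ht, hgt⟩ := intermediate_value_Icc' zero_le_one hgc.continuousOn ⟨hg1, hg0⟩
  set h := AffineMap.lineMap x y t with hh
  have hxy : h ∈ segment ℝ x y := by
    rw [segment_eq_image_lineMap]
    exact ⟨t, ht, rfl⟩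
  have he : h ∈ edge w i := (convex_segment _ _).segment_subset hx hy hxy
  have hh0 : 0 ≤ bary p 0 h := by
    rw [hh, bary_lineMap]
    have := ht.1
    have := ht.2
    have : 0 ≤ 1 - t := by linarith
    positivity
  rcases min_choice (bary p 1 h) (bary p 2 h) with hmin | hmin
  · have h1 : bary p 1 h = 0 := hmin ▸ hgt
    have h2 : 0 ≤ bary p 2 h := by rw [← hgt]; exact min_le_right _ _
    have hmem := mem_segment_of_bary_one hA' hh0 h1 h2
    change h ∈ segment ℝ (w 0) (w (m - 1)) at hmem
    rw [← hw.edge_last (by omega)] at hmem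
    rcases hw.inter i (m - 1) (by omega) (by omega) h he hmem with h' | h'
    · rw [h'.1] at h'
      rcases eq_or_eq_of_right_mem_segment (hw.ne i) hx hy (h'.2 ▸ hxy) with e | e
      · rw [← e, ← h'.2] at hx1
        linarith
      · rw [← e, ← h'.2] at hcon
        exact hcon ⟨h1.ge, h2⟩
    · omega
  · have h1 : bary p 2 h = 0 := hmin ▸ hgt
    have h2 : 0 ≤ bary p 1 h := by rw [← hgt]; exact min_le_left _ _
    have hmem := mem_segment_of_bary_two hA' hh0 h2 h1
    change h ∈ edge w 0 at hmem
    rcases hw.inter 0 i (by omega) (by omega) h hmem he with h' | h'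
    · rw [edge, segment_symm] at hx hy
      rcases eq_or_eq_of_right_mem_segment (hw.ne i).symm hx hy (h'.2 ▸ hxy) with e | e
      · rw [← e, ← h'.2] at hx2
        linarith
      · rw [← e, ← h'.2] at hcon
        exact hcon ⟨h2, h1.ge⟩
    · omega

lemma bary_edge_zero (hA : area (w 0) (w 1) (w (m - 1)) ≠ 0) {x : Fin 2 → ℝ}
    (hx : x ∈ edge w 0) : bary (corner m w) 2 x = 0 := by
  rw [edge, segment_eq_image_lineMap] at hx
  obtain ⟨t, -, rfl⟩ := hx
  have h0 : bary (corner m w) 2 (w 0) = 0 := bary_vertex (corner m w) hA 2 0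
  have h1 : bary (corner m w) 2 (w 1) = 0 := bary_vertex (corner m w) hA 2 1
  rw [bary_lineMap, zero_add, h0, h1]
  ring

lemma bary_edge_last (hw : SimpleLoop m w) (hm : 0 < m)
    (hA : area (w 0) (w 1) (w (m - 1)) ≠ 0) {x : Fin 2 → ℝ}
    (hx : x ∈ edge w (m - 1)) : bary (corner m w) 1 x = 0 := by
  rw [hw.edge_last hm, segment_eq_image_lineMap] at hx
  obtain ⟨t, -, rfl⟩ := hx
  have h0 : bary (corner m w) 1 (w 0) = 0 := bary_vertex (corner m w) hA 1 0
  have h1 : bary (corner m w) 1 (w (m - 1)) = 0 := bary_vertex (corner m w) hA 1 2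
  rw [bary_lineMap, h0, h1]
  ring

/-- If the triangle at an exposed vertex contains no further vertex, it can be cut off. -/
lemma boundsTriangles_of_ear (hw : SimpleLoop m w) (hm : 4 ≤ m)
    (f : (Fin 2 → ℝ) →L[ℝ] ℝ) (hf : ∀ i, 0 < i → i < m → f (w i) < f (w 0))
    (hear : ∀ j, 2 ≤ j → j + 2 ≤ m → ¬ ∀ i, 0 ≤ bary (corner m w) i (w j))
    (ih : ∀ m' < m, 3 ≤ m' → ∀ w', SimpleLoop m' w' → BoundsTriangles (m' - 2) (arc w' m')) :
    BoundsTriangles (m - 2) (arc w m) := by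
  have hA := hw.area_ne_zero (by omega) f hf
  set p := corner m w with hp
  have hA' : area (p 0) (p 1) (p 2) ≠ 0 := hA
  set u := WAM.shift w (m - 1) with hu
  have hul : SimpleLoop m u := hw.shift _
  have hu0 : u 0 = w (m - 1) := by simp [hu, WAM.shift]
  have hu1 : u 1 = w 0 := by
    rw [← hw.w_m, hu, WAM.shift, Nat.add_sub_cancel' (by omega)]
  have hu2 : u 2 = w 1 := by
    rw [← hw.period 1, hu, WAM.shift]
    congr 1
    omega
  rw [← arc_shift (by omega) hw.period (m - 1)]
  refine hul.boundsTriangles_of_diagonal (k := 2) le_rfl (by omega) ?_ ?_ ?_ ih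
  · rw [arc_shift (by omega) hw.period, hu0, hu2]
    intro x hx hxa
    obtain ⟨i, him, hxi⟩ := mem_arc.mp hxa
    have hcoord : bary p 0 x = 0 ∧ 0 ≤ bary p 1 x ∧ 0 ≤ bary p 2 x := by
      obtain ⟨s, t, hs, ht, hst, rfl⟩ := hx
      obtain ⟨h0, h1, h2⟩ := bary_of_combo p hA' 0 t s (by linarith)
      have e : (0 : ℝ) • p 0 + t • p 1 + s • p 2 = s • w (m - 1) + t • w 1 := by
        rw [zero_smul, zero_add, add_comm]; rfl
      rw [e] at h0 h1 h2
      exact ⟨h0, by rwa [h1], by rwa [h2]⟩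
    obtain ⟨h0, h1, h2⟩ := hcoord
    have hsum := bary_sum p hA' x
    have hcombo := bary_combo p hA' x
    rcases h1.eq_or_lt with h1' | h1'
    · left
      rw [h0, ← h1', show bary p 2 x = 1 by linarith, zero_smul, zero_smul, one_smul, zero_add,
        zero_add] at hcombo
      exact hcombo
    rcases h2.eq_or_lt with h2' | h2'
    · right
      rw [h0, ← h2', show bary p 1 x = 1 by linarith, zero_smul, zero_smul, one_smul, zero_add,
        add_zero] at hcombo
      exact hcombo
    exfalso
    have hi0 : i ≠ 0 := by
      rintro rfl
      exact h2'.ne' (bary_edge_zero hA hxi)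
    have hi1 : i ≠ m - 1 := by
      rintro rfl
      exact h1'.ne' (hw.bary_edge_last (by omega) hA hxi)
    have hno : ∀ j, 2 ≤ j → j + 2 ≤ m → w j ∈ edge w i → bary p 0 (w j) < 0 := by
      intro j hj hjm hji
      by_contra! hcon
      obtain ⟨ha, hb⟩ := hw.bary_nonneg_of_mem_edge (by omega) hA (by omega) (by omega) hxi hji
        h0.ge h1' h2' hcon
      refine hear j hj hjm fun l => ?_
      fin_cases l
      exacts [hcon, ha, hb]
    have hv1 : bary p 0 (w 1) = 0 := bary_vertex p hA' 0 1
    have hv2 : bary p 0 (w (m - 1)) = 0 := bary_vertex p hA' 0 2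
    have hle : ∀ j, 1 ≤ j → j + 1 ≤ m → w j ∈ edge w i → bary p 0 (w j) ≤ 0 := by
      intro j hj hjm hji
      by_cases hj1 : j = 1
      · rw [hj1, hv1]
      by_cases hj2 : j = m - 1
      · rw [hj2, hv2]
      exact (hno j (by omega) (by omega) hji).le
    have hA0 := hle i (by omega) (by omega) (left_mem_edge w i)
    have hA1 := hle (i + 1) (by omega) (by omega) (right_mem_edge w i)
    have hlt : bary p 0 (w i) < 0 ∨ bary p 0 (w (i + 1)) < 0 := by
      by_cases hi : i = 1
      · exact Or.inr (hno (i + 1) (by omega) (by omega) (right_mem_edge w i))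
      · exact Or.inl (hno i (by omega) (by omega) (left_mem_edge w i))
    have hxi' := hxi
    rw [edge, segment_eq_image_lineMap] at hxi'
    obtain ⟨t, ⟨ht0, ht1⟩, htx⟩ := hxi'
    -- `x` lies on the line `λ₀ = 0`, so it is the endpoint of its edge that lies on this line,
    -- which is `w 1` or `w (m - 1)`
    have hz : (1 - t) * bary p 0 (w i) + t * bary p 0 (w (i + 1)) = 0 := by
      rw [← bary_lineMap, htx, h0]
    have hz1 : (1 - t) * bary p 0 (w i) ≤ 0 := mul_nonpos_of_nonneg_of_nonpos (by linarith) hA0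
    have hz2 : t * bary p 0 (w (i + 1)) ≤ 0 := mul_nonpos_of_nonneg_of_nonpos ht0 hA1
    rcases hlt with hlt | hlt
    · have ht : t = 1 := by
        rcases mul_eq_zero.mp (show (1 - t) * bary p 0 (w i) = 0 by linarith) with h | h <;>
          linarith
      rw [ht, AffineMap.lineMap_apply_one] at htx
      by_cases hi : i + 1 = m - 1
      · rw [hi] at htx
        have : bary p 1 x = 0 := htx ▸ bary_vertex p hA' 1 2
        linarith
      · have := hno (i + 1) (by omega) (by omega) (right_mem_edge w i)
        rw [htx] at this
        linarith
    · have ht : t = 0 := by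
        rcases mul_eq_zero.mp (show t * bary p 0 (w (i + 1)) = 0 by linarith) with h | h <;>
          linarith
      rw [ht, AffineMap.lineMap_apply_zero] at htx
      by_cases hi : i = 1
      · rw [hi] at htx
        have : bary p 2 x = 0 := htx ▸ bary_vertex p hA' 2 1
        linarith
      · have := hno i (by omega) (by omega) (left_mem_edge w i)
        rw [htx] at this
        linarith
  · intro U hU hfr
    refine ⟨u 1, mem_arc.mpr ⟨0, by omega, right_mem_edge u 0⟩, (hul.ne 0).symm, hul.ne 1, ?_⟩
    rw [hu1]
    intro hmem
    set S : Set (Fin 2 → ℝ) := w '' Set.Icc 1 (m - 1) with hS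
    have hSf : S.Finite := (Set.finite_Icc _ _).image _
    have hwS : ∀ j, 1 ≤ j → j + 1 ≤ m → w j ∈ convexHull ℝ S := fun j h1 h2 =>
      subset_convexHull ℝ S (Set.mem_image_of_mem w ⟨h1, by omega⟩)
    have hc := convex_convexHull ℝ S
    have hUS : U ⊆ convexHull ℝ S := by
      refine subset_of_frontier_subset_convex hU.isBounded hc
        (hSf.isCompact_convexHull ℝ).isClosed (hfr.trans (Set.union_subset ?_ ?_))
      · intro x hx
        obtain ⟨i, hi, hx⟩ := mem_arc.mp hx
        rw [edge_shift, hu, edge_shift, show i + 2 + (m - 1) = i + 1 + m by omega,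
          edge_mod hw.period, Nat.add_mod_right, ← edge_mod hw.period] at hx
        exact hc.segment_subset (hwS _ (by omega) (by omega)) (hwS _ (by omega) (by omega)) hx
      · rw [hu0, hu2]
        exact hc.segment_subset (hwS _ (by omega) (by omega)) (hwS _ (by omega) (by omega))
    have hlt : convexHull ℝ S ⊆ {x | f x < f (w 0)} := by
      refine convexHull_min ?_ (convex_halfSpace_lt f.isLinear _)
      rintro _ ⟨j, ⟨h1, h2⟩, rfl⟩
      exact hf j (by omega) (by omega)
    exact lt_irrefl (f (w 0)) (hlt (hUS hmem))
  · intro U hU hfr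
    have hz : u 3 = w 2 := by
      rw [← hw.period 2, hu, WAM.shift]
      congr 1
      omega
    refine ⟨u 3, mem_arc.mpr ⟨0, by omega, right_mem_edge _ 0⟩, hul.vertex_ne (by omega) (by omega),
      (hul.ne 2).symm, ?_⟩
    rw [hz]
    intro hmem
    set T : Affine.Triangle ℝ (Fin 2 → ℝ) :=
      ⟨p, (affineIndependent_iff_area_ne_zero p).mpr hA'⟩ with hT
    have hc := convex_triangleSet T
    have hv : ∀ j, p j ∈ triangleSet T := fun j => subset_convexHull ℝ _ ⟨j, rfl⟩
    have hUT : U ⊆ triangleSet T := by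
      refine subset_of_frontier_subset_convex hU.isBounded hc (isCompact_triangleSet T).isClosed
        (hfr.trans (Set.union_subset ?_ ?_))
      · intro x hx
        obtain ⟨i, hi, hx⟩ := mem_arc.mp hx
        rw [edge] at hx
        interval_cases i
        · rw [hu0, zero_add, hu1] at hx
          exact hc.segment_subset (hv 2) (hv 0) hx
        · rw [hu1, one_add_one_eq_two, hu2] at hx
          exact hc.segment_subset (hv 0) (hv 1) hx
      · rw [hu0, hu2]
        exact hc.segment_subset (hv 2) (hv 1)
    exact hear 2 le_rfl (by omega) ((mem_triangleSet_iff_bary T _).mp (hUT hmem))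

lemma notMem_arc_shift (hw : SimpleLoop m w) {r l : ℕ} (hr : 1 ≤ r) (hrl : r + l + 1 ≤ m) :
    w 0 ∉ arc (WAM.shift w r) l := by
  intro h
  obtain ⟨i, hi, h⟩ := mem_arc.mp h
  rw [edge_shift, ← hw.w_m] at h
  have := hw.eq_of_mem_edge (by omega) (by omega) h
  omega

lemma le_of_mem_arc (f : (Fin 2 → ℝ) →L[ℝ] ℝ) (hw : SimpleLoop m w)
    (hf : ∀ i, 0 < i → i < m → f (w i) < f (w 0)) {x : Fin 2 → ℝ} (hx : x ∈ arc w m) :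
    f x ≤ f (w 0) := by
  obtain ⟨i, hi, hx⟩ := mem_arc.mp hx
  have h : ∀ j ≤ m, f (w j) ≤ f (w 0) := by
    intro j hj
    rcases Nat.eq_zero_or_pos j with rfl | h0
    · exact le_rfl
    rcases hj.eq_or_lt with rfl | hlt
    · rw [hw.w_m]
    · exact (hf j h0 hlt).le
  exact (convex_halfSpace_le f.isLinear (f (w 0))).segment_subset (h i hi.le) (h (i + 1) hi) hx

lemma arc_shift_subset {r l : ℕ} (hrl : r + l ≤ m) :
    arc (WAM.shift w r) l ⊆ arc w m := by
  intro x hx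
  obtain ⟨i, hi, hx⟩ := mem_arc.mp hx
  rw [edge_shift] at hx
  exact mem_arc.mpr ⟨i + r, by omega, hx⟩

/-- If the triangle at an exposed vertex contains further vertices, the one farthest from the
opposite side is joined to the exposed vertex by a diagonal. -/
lemma boundsTriangles_of_chord (hw : SimpleLoop m w) (hm : 4 ≤ m)
    (f : (Fin 2 → ℝ) →L[ℝ] ℝ) (hf : ∀ i, 0 < i → i < m → f (w i) < f (w 0)) {k : ℕ}
    (hk : 2 ≤ k) (hkm : k + 2 ≤ m) (hkT : ∀ i, 0 ≤ bary (corner m w) i (w k))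
    (hmax : ∀ j, 2 ≤ j → j + 2 ≤ m → (∀ i, 0 ≤ bary (corner m w) i (w j)) →
      bary (corner m w) 0 (w j) ≤ bary (corner m w) 0 (w k))
    (ih : ∀ m' < m, 3 ≤ m' → ∀ w', SimpleLoop m' w' → BoundsTriangles (m' - 2) (arc w' m')) :
    BoundsTriangles (m - 2) (arc w m) := by
  have hA := hw.area_ne_zero (by omega) f hf
  set p := corner m w with hp
  have hA' : area (p 0) (p 1) (p 2) ≠ 0 := hA
  have hsum := bary_sum p hA' (w k)
  have hk0 : w k ∉ edge w 0 := fun h => by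
    have := hw.eq_of_mem_edge (by omega) (by omega) h
    omega
  have hk1 : w k ∉ edge w (m - 1) := fun h => by
    rw [← hw.period k] at h
    have := hw.eq_of_mem_edge (by omega) (by omega) h
    omega
  have hq1 : 0 < bary p 1 (w k) := by
    refine (hkT 1).lt_of_ne fun h => hk1 ?_
    rw [hw.edge_last (by omega)]
    exact mem_segment_of_bary_one hA' (hkT 0) h.symm (hkT 2)
  have hq2 : 0 < bary p 2 (w k) :=
    (hkT 2).lt_of_ne fun h => hk0 (mem_segment_of_bary_two hA' (hkT 0) (hkT 1) h.symm)
  have hv : ∀ i, i ≠ 0 → bary p i (w 0) = 0 := fun i hi => by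
    have := bary_vertex p hA' i 0
    rwa [if_neg hi] at this
  have hv0 : bary p 0 (w 0) = 1 := bary_vertex p hA' 0 0
  have hq := bary_combo p hA' (w k)
  have ha := hf 1 (by omega) (by omega)
  have hb := hf (m - 1) (by omega) (by omega)
  refine hw.boundsTriangles_of_diagonal hk hkm ?_ ?_ ?_ ih
  · intro x hx hxa
    obtain ⟨i, him, hxi⟩ := mem_arc.mp hxa
    rw [segment_eq_image_lineMap] at hx
    obtain ⟨t, ⟨ht0, ht1⟩, rfl⟩ := hx
    rcases ht0.eq_or_lt with rfl | ht0
    · exact Or.inl (AffineMap.lineMap_apply_zero _ _)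
    rcases ht1.eq_or_lt with rfl | ht1
    · exact Or.inr (AffineMap.lineMap_apply_one _ _)
    exfalso
    set x := AffineMap.lineMap (w 0) (w k) t with hx
    have h0 : bary p 0 (w k) < bary p 0 x := by
      rw [hx, bary_lineMap, hv0]
      nlinarith
    have h1 : 0 < bary p 1 x := by
      rw [hx, bary_lineMap, hv 1 (by decide)]
      have := mul_pos ht0 hq1
      linarith
    have h2 : 0 < bary p 2 x := by
      rw [hx, bary_lineMap, hv 2 (by decide)]
      have := mul_pos ht0 hq2
      linarith
    have hi0 : i ≠ 0 := by
      rintro rfl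
      exact h2.ne' (bary_edge_zero hA hxi)
    have hi1 : i ≠ m - 1 := by
      rintro rfl
      exact h1.ne' (hw.bary_edge_last (by omega) hA hxi)
    have h00 : 0 ≤ bary p 0 (w k) := hkT 0
    have hno : ∀ j, 1 ≤ j → j + 1 ≤ m → w j ∈ edge w i → ¬ bary p 0 x ≤ bary p 0 (w j) := by
      intro j hj hjm hji hle
      by_cases hj1 : j = 1
      · have : bary p 0 (w 1) = 0 := bary_vertex p hA' 0 1
        rw [hj1] at hle
        linarith
      by_cases hj2 : j = m - 1
      · have : bary p 0 (w (m - 1)) = 0 := bary_vertex p hA' 0 2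
        rw [hj2] at hle
        linarith
      obtain ⟨hja, hjb⟩ := hw.bary_nonneg_of_mem_edge (by omega) hA (by omega) (by omega) hxi hji
        (by linarith) h1 h2 (by linarith)
      have := hmax j (by omega) (by omega) fun l => by
        fin_cases l
        exacts [by change 0 ≤ bary p 0 (w j); linarith, hja, hjb]
      linarith
    rcases exists_bary_ge (p := p) 0 hxi with h | h
    · exact hno i (by omega) (by omega) (left_mem_edge w i) h
    · exact hno (i + 1) (by omega) (by omega) (right_mem_edge w i) h
  · intro U hU hfr
    obtain ⟨t, ht0, ht1, ht⟩ := exists_lineMap_notMem f (R := arc (WAM.shift w k) (m - k - 1)) hA ha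
      hb hq1 hq2 (q := w k) (by
        rw [← show bary p 0 (w k) = 1 - bary p 1 (w k) - bary p 2 (w k) by linarith]
        exact hq) hU.isBounded (isClosed_arc _ _) (hw.notMem_arc_shift (by omega) (by omega))
      (fun x hx => hw.le_of_mem_arc f hf (arc_shift_subset (by omega) hx)) (by
        intro x hx
        rcases hfr hx with hx | hx
        · obtain ⟨i, hi, hx⟩ := mem_arc.mp hx
          rcases Nat.lt_or_ge i (m - k - 1) with h | h
          · exact Or.inr (mem_arc.mpr ⟨i, h, hx⟩)
          · rw [edge_shift, show i + k = m - 1 by omega, hw.edge_last (by omega)] at hx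
            exact Or.inl (Or.inl hx)
        · exact Or.inl (Or.inr hx))
    have he : AffineMap.lineMap (w 0) (w 1) t ∈ edge w 0 := by
      rw [edge, segment_eq_image_lineMap]
      exact ⟨t, ⟨ht0.le, ht1.le⟩, rfl⟩
    refine ⟨_, mem_arc.mpr ⟨0, by omega, he⟩, fun h => ?_, fun h => hk0 (h ▸ he), ht⟩
    rw [AffineMap.lineMap_eq_left_iff] at h
    exact h.elim (hw.ne 0) ht0.ne'
  · intro U hU hfr
    obtain ⟨t, ht0, ht1, ht⟩ := exists_lineMap_notMem f (v := w 0) (a := w (m - 1)) (b := w 1)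
      (R := arc (WAM.shift w 1) (k - 1)) (by
        intro h
        apply hA
        simp only [area] at h ⊢
        linarith) hb ha hq2 hq1 (q := w k) (by
        rw [← show bary p 0 (w k) = 1 - bary p 2 (w k) - bary p 1 (w k) by linarith,
          add_right_comm]
        exact hq) hU.isBounded (isClosed_arc _ _) (hw.notMem_arc_shift (by omega) (by omega))
      (fun x hx => hw.le_of_mem_arc f hf (arc_shift_subset (by omega) hx)) (by
        intro x hx
        rcases hfr hx with hx | hx
        · obtain ⟨i, hi, hx⟩ := mem_arc.mp hx
          rcases Nat.eq_zero_or_pos i with rfl | h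
          · exact Or.inl (Or.inl hx)
          · refine Or.inr (mem_arc.mpr ⟨i - 1, by omega, ?_⟩)
            rwa [edge_shift, Nat.sub_add_cancel h]
        · exact Or.inl (Or.inr hx))
    have he : AffineMap.lineMap (w 0) (w (m - 1)) t ∈ edge w (m - 1) := by
      rw [hw.edge_last (by omega), segment_eq_image_lineMap]
      exact ⟨t, ⟨ht0.le, ht1.le⟩, rfl⟩
    refine ⟨_, mem_arc.mpr ⟨m - k - 1, by omega, ?_⟩, fun h => ?_, fun h => hk1 (h ▸ he), ht⟩
    · rwa [edge_shift, show m - k - 1 + k = m - 1 by omega]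
    · rw [AffineMap.lineMap_eq_left_iff] at h
      exact h.elim (hw.vertex_ne (by omega) (by omega)).symm ht0.ne'

/-- A simple closed polygon with `m` vertices bounds a region cut into `m - 2` triangles. -/
theorem boundsTriangles : ∀ (m : ℕ), 3 ≤ m → ∀ w : ℕ → Fin 2 → ℝ, SimpleLoop m w →
    BoundsTriangles (m - 2) (arc w m) := by
  intro m
  induction m using Nat.strong_induction_on with
  | h m ih =>
    intro hm w hw
    obtain ⟨r, f, hf⟩ := hw.exists_exposed (by omega)
    rw [← arc_shift (by omega) hw.period r]
    replace hw := hw.shift r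
    set u := WAM.shift w r
    rcases hm.eq_or_lt with rfl | hm
    · have h := boundsTriangles_triangle ![u 0, u 1, u 2] (hw.area_ne_zero le_rfl f hf)
      have e : arc u 3 = segment ℝ (u 0) (u 1) ∪ segment ℝ (u 1) (u 2) ∪ segment ℝ (u 2) (u 0) := by
        ext x
        have h2 : edge u 2 = segment ℝ (u 2) (u 0) := by rw [← hw.w_m, edge]
        rw [mem_arc, ← h2]
        constructor
        · rintro ⟨i, hi, hx⟩
          interval_cases i
          exacts [Or.inl (Or.inl hx), Or.inl (Or.inr hx), Or.inr hx]
        · rintro ((hx | hx) | hx)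
          exacts [⟨0, by omega, hx⟩, ⟨1, by omega, hx⟩, ⟨2, by omega, hx⟩]
      rw [e]
      exact h
    · classical
      set S := (Finset.Icc 2 (m - 2)).filter fun j => ∀ i, 0 ≤ bary (corner m u) i (u j) with hS
      rcases S.eq_empty_or_nonempty with hSe | hSn
      · refine hw.boundsTriangles_of_ear hm f hf (fun j hj hjm hT => ?_) ih
        have : j ∈ S := Finset.mem_filter.mpr ⟨Finset.mem_Icc.mpr ⟨hj, by omega⟩, hT⟩
        rw [hSe] at this
        exact absurd this (Finset.notMem_empty j)
      · obtain ⟨k, hkS, hk⟩ := Finset.exists_max_image S (fun j => bary (corner m u) 0 (u j)) hSn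
        obtain ⟨hkI, hkT⟩ := Finset.mem_filter.mp hkS
        rw [Finset.mem_Icc] at hkI
        exact hw.boundsTriangles_of_chord hm f hf hkI.1 (by omega) hkT (fun j hj hjm hT =>
          hk j (Finset.mem_filter.mpr ⟨Finset.mem_Icc.mpr ⟨hj, by omega⟩, hT⟩)) ih

end SimpleLoop

/-! ### The region bounded by a simple polygon -/

/-- The vertices of a polygon as a periodic sequence. -/
def vertexSeq {m : ℕ} (P : Polygon (Fin 2 → ℝ) m) (hm : 0 < m) : ℕ → Fin 2 → ℝ :=
  fun i => P ⟨i % m, Nat.mod_lt i hm⟩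

lemma finRotate_mk_mod {m : ℕ} (hm : 0 < m) (i : ℕ) :
    finRotate m ⟨i % m, Nat.mod_lt i hm⟩ = ⟨(i + 1) % m, Nat.mod_lt _ hm⟩ := by
  obtain ⟨n, rfl⟩ : ∃ n, m = n + 1 := ⟨m - 1, by omega⟩
  rw [finRotate_apply]
  ext
  simp [Fin.val_add]

lemma edgePath_mk_mod {m : ℕ} (P : Polygon (Fin 2 → ℝ) m) (hm : 0 < m) (i : ℕ) (t : ℝ) :
    P.edgePath ℝ ⟨i % m, Nat.mod_lt i hm⟩ t =
      AffineMap.lineMap (vertexSeq P hm i) (vertexSeq P hm (i + 1)) t := by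
  rw [Polygon.edgePath, finRotate_mk_mod hm]
  rfl

lemma periodic_vertexSeq {m : ℕ} (P : Polygon (Fin 2 → ℝ) m) (hm : 0 < m) :
    Function.Periodic (vertexSeq P hm) m := fun i => by
  simp only [vertexSeq, Nat.add_mod_right]

lemma simpleLoop_vertexSeq {m : ℕ} (P : Polygon (Fin 2 → ℝ) m) (hm : 3 ≤ m) (hP : IsSimple P) :
    SimpleLoop m (vertexSeq P (by omega)) := by
  have hm0 : 0 < m := by omega
  set w := vertexSeq P hm0 with hw
  have hinj : ∀ i j, ∀ s ∈ Set.Ico (0 : ℝ) 1, ∀ t ∈ Set.Ico (0 : ℝ) 1,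
      AffineMap.lineMap (w i) (w (i + 1)) s = AffineMap.lineMap (w j) (w (j + 1)) t →
        i % m = j % m ∧ s = t := by
    intro i j s hs t ht h
    rw [hw, ← edgePath_mk_mod, ← edgePath_mk_mod] at h
    obtain ⟨h1, h2⟩ := hP _ _ s hs t ht h
    exact ⟨congrArg Fin.val h1, h2⟩
  have h0 : (0 : ℝ) ∈ Set.Ico (0 : ℝ) 1 := by norm_num
  -- the end of an edge is the beginning of the next one
  have hend : ∀ i, AffineMap.lineMap (w i) (w (i + 1)) (1 : ℝ) =
      AffineMap.lineMap (w (i + 1)) (w (i + 1 + 1)) (0 : ℝ) := fun i => by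
    rw [AffineMap.lineMap_apply_one, AffineMap.lineMap_apply_zero]
  have hmod : ∀ i < m, (i + 1) % m = i + 1 ∨ i + 1 = m ∧ (i + 1) % m = 0 := by
    intro i hi
    rcases (show i + 1 ≤ m from hi).lt_or_eq with h | h
    · exact Or.inl (Nat.mod_eq_of_lt h)
    · exact Or.inr ⟨h, by rw [h, Nat.mod_self]⟩
  refine SimpleLoop.of_base hm0 (periodic_vertexSeq P hm0) (fun i hi h => ?_)
    (fun i j hij hj x hx hx' => ?_)
  · obtain ⟨h1, -⟩ := hinj i (i + 1) 0 h0 0 h0 (by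
      rw [AffineMap.lineMap_apply_zero, AffineMap.lineMap_apply_zero]
      exact h)
    rw [Nat.mod_eq_of_lt hi] at h1
    have := hmod i hi
    omega
  · rw [edge, segment_eq_image_lineMap] at hx hx'
    obtain ⟨s, ⟨hs0, hs1⟩, rfl⟩ := hx
    obtain ⟨t, ⟨ht0, ht1⟩, hst⟩ := hx'
    have hi' := Nat.mod_eq_of_lt (hij.trans hj)
    have hj' := Nat.mod_eq_of_lt hj
    have hmi := hmod i (hij.trans hj)
    have hmj := hmod j hj
    rcases hs1.lt_or_eq with hs1 | rfl <;> rcases ht1.lt_or_eq with ht1 | rfl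
    · have := (hinj j i t ⟨ht0, ht1⟩ s ⟨hs0, hs1⟩ hst).1
      omega
    · rw [hend] at hst
      obtain ⟨h1, rfl⟩ := hinj (j + 1) i 0 h0 s ⟨hs0, hs1⟩ hst
      exact Or.inr ⟨by omega, AffineMap.lineMap_apply_zero _ _⟩
    · have hst' := hst
      rw [hend] at hst'
      obtain ⟨h1, rfl⟩ := hinj j (i + 1) t ⟨ht0, ht1⟩ 0 h0 hst'
      refine Or.inl ⟨by omega, ?_⟩
      rw [← hst, AffineMap.lineMap_apply_zero]
    · rw [hend, hend] at hst
      have := (hinj (j + 1) (i + 1) 0 h0 0 h0 hst).1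
      omega

lemma boundary_eq_arc {m : ℕ} (P : Polygon (Fin 2 → ℝ) m) (hm : 0 < m) :
    P.boundary ℝ = arc (vertexSeq P hm) m := by
  have h : ∀ i, P.edgeSet ℝ ⟨i % m, Nat.mod_lt i hm⟩ = edge (vertexSeq P hm) i := by
    intro i
    rw [Polygon.edgeSet, finRotate_mk_mod hm, affineSegment_eq_segment]
    rfl
  ext x
  rw [Polygon.boundary, Set.mem_iUnion, mem_arc]
  constructor
  · rintro ⟨i, hx⟩
    refine ⟨i, i.2, ?_⟩
    rw [← h]
    convert hx
    exact Nat.mod_eq_of_lt i.2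
  · rintro ⟨i, -, hx⟩
    exact ⟨_, (h i).symm ▸ hx⟩

/-- The region bounded by `P` is any compact set with frontier in `P` and connected complement. -/
lemma region_eq {m : ℕ} (P : Polygon (Fin 2 → ℝ) m) {U : Set (Fin 2 → ℝ)} (hU : IsCompact U)
    (hfr : frontier U ⊆ P.boundary ℝ) (hPU : P.boundary ℝ ⊆ U) (hlog : HasLog U) :
    region P = U := by
  ext x
  constructor
  · rintro (hx | hx)
    · exact hPU hx
    · by_contra hxU
      exact hlog.not_isBounded hU.isClosed hxU
        (hx.subset (connectedComponentIn_mono x (Set.compl_subset_compl.mpr hPU)))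
  · intro hxU
    by_cases hx : x ∈ P.boundary ℝ
    · exact Or.inl hx
    · refine Or.inr (hU.isBounded.subset fun y hy => ?_)
      by_contra hyU
      exact notMem_of_isPreconnected isPreconnected_connectedComponentIn
        (fun z hz hzf => connectedComponentIn_subset (P.boundary ℝ)ᶜ x hz (hfr hzf)) hy hyU x
        (mem_connectedComponentIn hx) hxU

theorem exists_isSubdivision {m : ℕ} (P : Polygon (Fin 2 → ℝ) m) (hm : 3 ≤ m) (hP : IsSimple P) :
    ∃ T : Fin (m - 2) → Affine.Triangle ℝ (Fin 2 → ℝ), IsSubdivision T (region P) := by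
  obtain ⟨T, hT, hfr, hsub, hlog⟩ :=
    SimpleLoop.boundsTriangles m hm _ (simpleLoop_vertexSeq P hm hP)
  rw [← boundary_eq_arc] at hfr hsub
  exact ⟨T, (region_eq P (isCompact_iUnion_triangleSet T) hfr hsub hlog).symm, hT⟩

end WAM

theorem mainTheorem4 :
    (∀ T : Affine.Triangle ℝ (Fin 2 → ℝ),
      (∃ q : Fin 2 → MvPolynomial (Fin 2) ℝ, (∀ i, (q i).totalDegree ≤ 2) ∧
        ∀ y i, WAM.duffy T y i = MvPolynomial.eval y (q i)) ∧
      WAM.duffy T '' WAM.square = WAM.triangleSet T) ∧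
    ∃ C : ℕ → ℝ, C =O[atTop] (fun n : ℕ => Real.log (n : ℝ) ^ 2) ∧
      (∀ T : Affine.Triangle ℝ (Fin 2 → ℝ),
        WAM.IsWAM (WAM.triangleSet T) (WAM.triangleMesh T) C ∧
        ∀ n, 1 ≤ n → (WAM.triangleMesh T n).card = 2 * n ^ 2 + 2 * n + 2) ∧
      (∀ (m : ℕ) (P : Polygon (Fin 2 → ℝ) m), 3 ≤ m → WAM.IsSimple P →
        (∃ T : Fin (m - 2) → Affine.Triangle ℝ (Fin 2 → ℝ),
          WAM.IsSubdivision T (WAM.region P)) ∧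
        ∀ T : Fin (m - 2) → Affine.Triangle ℝ (Fin 2 → ℝ),
          WAM.IsSubdivision T (WAM.region P) →
            WAM.IsWAM (WAM.region P) (WAM.unionMesh T) C ∧
            ∀ n, 1 ≤ n → (WAM.unionMesh T n).card ≤ (m - 2) * (2 * n ^ 2 + 2 * n + 2)) := by
  refine ⟨fun T => ⟨⟨WAM.duffyPoly T, WAM.totalDegree_duffyPoly T, fun y i =>
    (WAM.eval_duffyPoly T y i).symm⟩, WAM.duffy_image_square T⟩, WAM.paduaConst,
    WAM.paduaConst_isBigO, fun T => ⟨WAM.isWAM_triangleMesh T, WAM.card_triangleMesh T⟩,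
    fun m P hm hP => ⟨WAM.exists_isSubdivision P hm hP, fun T hT =>
      ⟨WAM.isWAM_unionMesh (by omega) T _ hT.1, WAM.card_unionMesh_le T⟩⟩⟩
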